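/- Fix $C>0$, $\lambda>0$, $\gamma>0$ and a probability measure $\nu$ on $[C^{-1},C]$. Let $\mathbf m=(m_x)_{x\in\mathbb Z}$ be i.i.d. with law $\nu$, let $\omega=(\omega_x)_{x\in\mathbb Z}$ be, under $\mu_\beta$ ($\beta>0$), i.i.d. centered Gaussian of variance $\beta^{-1}$, and let $\mathbb E^\star_\beta$ be the expectation under the product of the two laws. Put $\chi(\beta)=\mathrm{Var}_{\mu_\beta}(\omega_0^2)$. Let $(\tau_xf)(\mathbf m,\omega)=f(\tau_x\mathbf m,\tau_x\omega)$ with $(\tau_x\omega)_z=\omega_{x+z}$, $(\tau_x\mathbf m)_z=m_{x+z}$; let $\nabla_xf$ (resp. $\nabla_{x,x+1}f$) be the variation of $f$ when $\omega_x$ is changed into $-\omega_x$ (resp. $\omega_x$ and $\omega_{x+1}$ are exchanged), and let $\Gamma_f=\sum_x\tau_xf$ (a formal sum, whose gradients $\nabla_0\Gamma_f$, $\nabla_{0,1}\Gamma_f$ are well defined for local $f$). Let $\mathcal Q$ be the set of functions $$f(\mathbf m,\omega)=\sum_i\psi_{i,i}(\mathbf m)(\omega_{i+1}^2-\omega_i^2)+\sum_{i\ne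 j}\psi_{i,j}(\mathbf m)\omega_i\omega_j,$$ where the $\psi_{i,j}=\psi_{j,i}$ are continuous functions of finitely many coordinates of $\mathbf m$ and all but finitely many of them vanish. Let $$\mathcal S=\gamma\sum_x\nabla_x+\lambda\sum_x\nabla_{x,x+1},\qquad \mathcal A^{\mathbf m}=\sum_x\Big(\frac{\omega_{x+1}}{\sqrt{m_xm_{x+1}}}-\frac{\omega_{x-1}}{\sqrt{m_{x-1}m_x}}\Big)\frac{\partial}{\partial\omega_x},$$ $\mathcal L^{\mathbf m}=\mathcal S+\mathcal A^{\mathbf m}$, $\mathcal L^{\mathbf m,\star}=\mathcal S-\mathcal A^{\mathbf m}$, $j^S_{0,1}=\lambda(\omega_1^2-\omega_0^2)$, $j^A_{0,1}=2\omega_0\omega_1/\sqrt{m_0m_1}$, $j_{0,1}=j^S_{0,1}+j^A_{0,1}$, $j^\star_{0,1}=j^S_{0,1}-j^A_{0,1}$. For local functions let $\ll g,h\gg_{\beta,\star}=\sum_x\mathbb E^\star_\beta[g\,\tau_xh]$, $\ll g\gg_{\beta,\star\star}=\sum_xx\,\mathbb E^\star_\beta[g\,\omega_x^2]$ and $$|||\varphi|||_\beta^2=\sup_{g\in\mathcal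 Q,\,a\in\mathbb R}\Big\{2\ll\varphi,g\gg_{\beta,\star}+2a\ll\varphi\gg_{\beta,\star\star}-\tfrac\lambda2\mathbb E^\star_\beta\big[(\nabla_{0,1}(a\omega_0^2+\Gamma_g))^2\big]-\tfrac\gamma2\mathbb E^\star_\beta\big[(\nabla_0(a\omega_0^2+\Gamma_g))^2\big]\Big\}.$$ Theorem. There is a number $D\in(0,\infty)$, not depending on $\beta$, such that for every $\beta>0$ (in particular for $\beta=1$): (i) $D=\lambda+\dfrac1{\chi(\beta)}\displaystyle\inf_{f\in\mathcal Q}\sup_{g\in\mathcal Q}\big\{\ll f,-\mathcal Sf\gg_{\beta,\star}+2\ll j^A_{0,1}-\mathcal A^{\mathbf m}f,g\gg_{\beta,\star}-\ll g,-\mathcal Sg\gg_{\beta,\star}\big\}$; (ii) $D$ is the unique real number $a$ for which there is a sequence $(f_k)$ in $\mathcal Q$ with $|||j_{0,1}-a(\omega_1^2-\omega_0^2)-\mathcal L^{\mathbf m}f_k|||_\beta\to0$; (iii) $$D=\frac1{\chi(\beta)}\inf_{f\in\mathcal Q}|||j^\star_{0,1}-\mathcal L^{\mathbf m,\star}f|||_\beta^2=\frac{\lambda^2\chi(\beta)}{\inf_{f\in\mathcal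 Q}|||j^S_{0,1}-\mathcal L^{\mathbf m,\star}f|||_\beta^2}.$$ -/

import Mathlib

open MeasureTheory ProbabilityTheory Filter Topology

namespace DisorderedChain

/-- Disorder fields `m = (m_x)`, with `C⁻¹ ≤ m_x ≤ C` for every site `x`. -/
abbrev Disorder (C : ℝ) : Type := ℤ → Set.Icc C⁻¹ C

/-- Configurations `ω = (ω_x)` on the infinite line. -/
abbrev Config : Type := ℤ → ℝ

/-- Functions `φ(m, ω)` of the disorder and of the configuration. -/
abbrev Obs (C : ℝ) : Type := Disorder C → Config → ℝ

/-- The law of the i.i.d. disorder whose one-site law is `ν`. -/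
noncomputable def disorderLaw {C : ℝ} (ν : Measure (Set.Icc C⁻¹ C)) [IsProbabilityMeasure ν] :
    Measure (Disorder C) :=
  Measure.infinitePi (fun _ : ℤ => ν)

/-- The Gibbs measure at inverse temperature `β`: the `ω_x` are i.i.d. centered Gaussian
variables of variance `β⁻¹`. -/
noncomputable def gibbs (β : ℝ) : Measure Config :=
  Measure.infinitePi (fun _ : ℤ => gaussianReal 0 (Real.toNNReal β⁻¹))

/-- The static compressibility, that is the variance of `ω_0²` under the Gibbs measure. -/
noncomputable def chi (β : ℝ) : ℝ :=
  (∫ ω : Config, ω 0 ^ 4 ∂(gibbs β)) - (∫ ω : Config, ω 0 ^ 2 ∂(gibbs β)) ^ 2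

/-- Expectation with respect to the product of the disorder law and the Gibbs measure. -/
noncomputable def expect {C : ℝ} (ν : Measure (Set.Icc C⁻¹ C)) [IsProbabilityMeasure ν]
    (β : ℝ) (φ : Obs C) : ℝ :=
  ∫ p : Disorder C × Config, φ p.1 p.2 ∂((disorderLaw ν).prod (gibbs β))

/-- Translation by `x`: `(τ_x f)(m, ω) = f(τ_x m, τ_x ω)` with `(τ_x ω)_z = ω_{x+z}`. -/
def shift {C : ℝ} (x : ℤ) (f : Obs C) : Obs C :=
  fun m ω => f (fun z => m (x + z)) (fun z => ω (x + z))

/-- The configuration `ω` with the value at site `x` flipped. -/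
def flipAt (x : ℤ) (ω : Config) : Config := Function.update ω x (-ω x)

/-- The configuration `ω` with the values at the sites `x` and `x + 1` exchanged. -/
def exchAt (x : ℤ) (ω : Config) : Config := fun z => ω (Equiv.swap x (x + 1) z)

/-- `(∇_x f)(m, ω) = f(m, ω^x) - f(m, ω)`. -/
def gradFlip {C : ℝ} (x : ℤ) (f : Obs C) : Obs C :=
  fun m ω => f m (flipAt x ω) - f m ω

/-- `(∇_{x,x+1} f)(m, ω) = f(m, ω^{x,x+1}) - f(m, ω)`. -/
def gradExch {C : ℝ} (x : ℤ) (f : Obs C) : Obs C :=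
  fun m ω => f m (exchAt x ω) - f m ω

/-- `∇_0(Γ_f)` for the formal sum `Γ_f = ∑_x τ_x f`. For a cylinder function `f` only finitely
many terms are nonzero. -/
noncomputable def gradFlipGamma {C : ℝ} (f : Obs C) : Obs C :=
  fun m ω => ∑ᶠ x : ℤ, gradFlip 0 (shift x f) m ω

/-- `∇_{0,1}(Γ_f)` for the formal sum `Γ_f = ∑_x τ_x f`. -/
noncomputable def gradExchGamma {C : ℝ} (f : Obs C) : Obs C :=
  fun m ω => ∑ᶠ x : ℤ, gradExch 0 (shift x f) m ω

/-- The set `Q` of quadratic cylinder functions: finite sums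
`∑_i ψ_{i,i}(m) (ω_{i+1}² - ω_i²) + ∑_{i ≠ j} ψ_{i,j}(m) ω_i ω_j`, where the `ψ_{i,j}` are
continuous cylinder functions of the disorder, symmetric in `(i, j)`, and zero for all but
finitely many pairs. -/
def Quad (C : ℝ) : Set (Obs C) :=
  {f | ∃ (Λ : Finset ℤ) (ψ : ℤ → ℤ → Disorder C → ℝ),
    (∀ i j, ∃ S : Finset ℤ, DependsOn (ψ i j) (S : Set ℤ)) ∧
    (∀ i j, Continuous (ψ i j)) ∧
    (∀ i j, i ∉ Λ ∨ j ∉ Λ → ψ i j = 0) ∧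
    (∀ i j, ψ i j = ψ j i) ∧
    ∀ m ω, f m ω =
      ∑ i ∈ Λ, ψ i i m * (ω (i + 1) ^ 2 - ω i ^ 2) +
        ∑ i ∈ Λ, ∑ j ∈ Λ.erase i, ψ i j m * (ω i * ω j)}

/-- The bond coefficient `1 / √(m_x m_{x+1})`. -/
noncomputable def bond {C : ℝ} (m : Disorder C) (x : ℤ) : ℝ :=
  1 / Real.sqrt ((m x : ℝ) * (m (x + 1) : ℝ))

/-- The antisymmetric part `A^m` of the generator,
`∑_x (ω_{x+1} / √(m_x m_{x+1}) - ω_{x-1} / √(m_{x-1} m_x)) ∂/∂ω_x`. -/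
noncomputable def genA {C : ℝ} (f : Obs C) : Obs C :=
  fun m ω => ∑ᶠ x : ℤ,
    (ω (x + 1) * bond m x - ω (x - 1) * bond m (x - 1)) *
      deriv (fun t : ℝ => f m (Function.update ω x t)) (ω x)

/-- The symmetric part `S = γ S^flip + λ S^exch` of the generator. -/
noncomputable def genS {C : ℝ} (lam gam : ℝ) (f : Obs C) : Obs C :=
  fun m ω => gam * (∑ᶠ x : ℤ, gradFlip x f m ω) + lam * ∑ᶠ x : ℤ, gradExch x f m ω

/-- The generator `L^m = S + A^m`. -/
noncomputable def genL {C : ℝ} (lam gam : ℝ) (f : Obs C) : Obs C :=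
  genS lam gam f + genA f

/-- The adjoint generator `L^{m,⋆} = S - A^m`. -/
noncomputable def genLStar {C : ℝ} (lam gam : ℝ) (f : Obs C) : Obs C :=
  genS lam gam f - genA f

/-- The gradient `ω_1² - ω_0²` of the energy. -/
def energyGrad (C : ℝ) : Obs C := fun _ ω => ω 1 ^ 2 - ω 0 ^ 2

/-- The one-site energy `ω_0²`. -/
def energy (C : ℝ) : Obs C := fun _ ω => ω 0 ^ 2

/-- The antisymmetric current `j^A_{0,1} = 2 ω_0 ω_1 / √(m_0 m_1)`. -/
noncomputable def currentA (C : ℝ) : Obs C := fun m ω => 2 * (ω 0 * ω 1) * bond m 0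

/-- The symmetric current `j^S_{0,1} = λ (ω_1² - ω_0²)`. -/
def currentS (C lam : ℝ) : Obs C := lam • energyGrad C

/-- The total current `j_{0,1} = j^A_{0,1} + j^S_{0,1}`. -/
noncomputable def current (C lam : ℝ) : Obs C := currentA C + currentS C lam

/-- The current `j^⋆_{0,1} = j^S_{0,1} - j^A_{0,1}`. -/
noncomputable def currentStar (C lam : ℝ) : Obs C := currentS C lam - currentA C

section Forms

variable {C : ℝ} (ν : Measure (Set.Icc C⁻¹ C)) [IsProbabilityMeasure ν]

/-- The semi-inner product `≪g, h≫_{β,⋆} = ∑_x E⋆_β[g τ_x h]`. -/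
noncomputable def inner1 (β : ℝ) (g h : Obs C) : ℝ :=
  ∑ᶠ x : ℤ, expect ν β (g * shift x h)

/-- The linear form `≪g≫_{β,⋆⋆} = ∑_x x E⋆_β[g ω_x²]`. -/
noncomputable def inner2 (β : ℝ) (g : Obs C) : ℝ :=
  ∑ᶠ x : ℤ, (x : ℝ) * expect ν β (fun m ω => g m ω * ω x ^ 2)

/-- The Dirichlet form at the origin of the formal function `a ω_0² + Γ_g`:
`(λ/2) E⋆_β[(∇_{0,1}(a ω_0² + Γ_g))²] + (γ/2) E⋆_β[(∇_0(a ω_0² + Γ_g))²]`. -/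
noncomputable def dirichlet0 (lam gam β a : ℝ) (g : Obs C) : ℝ :=
  lam / 2 * expect ν β ((a • gradExch 0 (energy C) + gradExchGamma g) ^ 2) +
    gam / 2 * expect ν β ((a • gradFlip 0 (energy C) + gradFlipGamma g) ^ 2)

/-- The squared semi-norm `|||φ|||_β²`, the supremum over `g ∈ Q` and `a ∈ ℝ` of
`2 ≪φ, g≫_{β,⋆} + 2 a ≪φ≫_{β,⋆⋆} - D_0(P⋆_β; a ω_0² + Γ_g)`, taken in the extended reals. -/
noncomputable def normSq (lam gam β : ℝ) (φ : Obs C) : EReal :=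
  ⨆ g ∈ Quad C, ⨆ a : ℝ,
    ((2 * inner1 ν β φ g + 2 * a * inner2 ν β φ - dirichlet0 ν lam gam β a g : ℝ) : EReal)

/-- The diffusion coefficient `D(β)`, defined by the inf-sup formula
`λ + χ(β)⁻¹ inf_{f ∈ Q} sup_{g ∈ Q} {≪f, -S f≫ + 2 ≪j^A_{0,1} - A^m f, g≫ - ≪g, -S g≫}`,
a priori an extended real number. -/
noncomputable def diffusionCoeff (lam gam β : ℝ) : EReal :=
  (lam : EReal) + ((1 / chi β : ℝ) : EReal) *
    ⨅ f ∈ Quad C, ⨆ g ∈ Quad C,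
      ((inner1 ν β f (-genS lam gam f) + 2 * inner1 ν β (currentA C - genA f) g
        - inner1 ν β g (-genS lam gam g) : ℝ) : EReal)

end Forms

end DisorderedChain

namespace DisorderedChain

/-! ### The abstract Hilbert space problem -/

section Variational

open scoped RealInnerProductSpace

/-! Modulo translations, a quadratic function `f` is described by a finite sequence `d` of local
functions of the disorder: `d 0` is the coefficient of ω_1² - ω_0², and `d k` for `k ≥ 1` that of
ω_0 ω_k. Let W be `d` with `d 0` replaced by its negative Laplacian (2 - τ_1 - τ_{-1}) d_0. On
sequences take the scalar product ⟨w, w'⟩ = E[w_0 w'_0] + ½ ∑_{k ≥ 1} E[w_k w'_k], and let e = (1,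
0, 0, …). Gaussian fourth moments then show that ≪f, g≫_⋆ = χ ⟨d, W'⟩, that ≪f≫_⋆⋆ = χ ⟨d, e⟩ and
that the Dirichlet form of a ω_0² + Γ_f is χ (λ a² + ⟨N W, W⟩). Here N is symmetric, coercive and
bounded, and N e = λ e. The generator acts by S f ↦ -N W and A f ↦ A W with A bounded and
antisymmetric, and the currents are j^S ↦ N e, j^A ↦ -A e. The temperature enters only through the
common factor χ, which cancels in the end; hence D does not depend on β.

The second ingredient is that the vectors W are dense in the orthogonal of e. For the coefficients
`k ≥ 1` there is nothing to prove; for `k = 0` it says that Laplacians of local functions are dense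
in L² among centered ones. A centered φ and a far translate of it are independent, so their average
has half the variance, while φ minus that average is a gradient. Iterating gives density of
gradients, and applying this twice gives Laplacians (`exists_sub_laplacian_lt`).

What remains is Hilbert space geometry (`hilbert_variational`). Put r = (N - A)⁻¹ e, s = (N + A)⁻¹ e
and q = ⟨r, e⟩ = ⟨s, e⟩; then D = 1/q. The seminorm is the dual norm ⟨N⁻¹ x, x⟩. Testing it against
multiples of r or s gives the lower bounds in (iii) and the uniqueness in (ii), and explicit
combinations of r and s attain them. The inf-sup in (i) has the saddle point (r + s)/(2q), (s -
r)/(2q). `form_variational` passes to the completion, `data_variational` specializes to sequences,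
and the relation `HasData` carries the result back to functions. -/

/-- A bounded coercive operator on a Hilbert space has a bounded right inverse. -/
lemma exists_rightInverse_of_coercive {H : Type*} [NormedAddCommGroup H] [InnerProductSpace ℝ H]
    [CompleteSpace H] (T : H →L[ℝ] H) {c : ℝ} (hc : 0 < c)
    (hT : ∀ x, c * ‖x‖ ^ 2 ≤ ⟪T x, x⟫) : ∃ S : H →L[ℝ] H, ∀ x, T (S x) = x := by
  have hB : IsCoercive ((innerSL ℝ).comp T : H →L[ℝ] H →L[ℝ] ℝ) := by
    refine ⟨c, hc, fun x => ?_⟩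
    have := hT x
    simpa [mul_assoc, ← sq] using this
  refine ⟨hB.continuousLinearEquivOfBilin.symm.toContinuousLinearMap, fun x => ?_⟩
  refine ext_inner_right ℝ fun w => ?_
  have := hB.continuousLinearEquivOfBilin_apply (hB.continuousLinearEquivOfBilin.symm x) w
  simpa using this.symm

/-- Variational characterizations of the number `⟪e, (N - A)⁻¹ e⟫⁻¹` for a symmetric coercive `N`
with `N e = lam • e` and an antisymmetric `A`, in terms of a family of vectors that is dense in the
orthogonal of the unit vector `e`. -/
theorem hilbert_variational {H ι : Type*} [NormedAddCommGroup H] [InnerProductSpace ℝ H]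
    [CompleteSpace H] (N A : H →L[ℝ] H) (e : H) {lam c : ℝ} (hlam : 0 < lam) (hc : 0 < c)
    (hN : ∀ x y, ⟪N x, y⟫ = ⟪x, N y⟫) (hA : ∀ x y, ⟪A x, y⟫ = -⟪x, A y⟫)
    (hcoer : ∀ x, c * ‖x‖ ^ 2 ≤ ⟪N x, x⟫) (hNe : N e = lam • e) (he : ⟪e, e⟫ = 1)
    (v : ι → H) (hv : ∀ i, ⟪v i, e⟫ = 0)
    (hdense : ∀ x, ⟪x, e⟫ = 0 → x ∈ closure (Set.range v)) :
    ∃ D : ℝ, 0 < D ∧ ∃ nn n0 : H → ℝ,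
      (∀ x, IsLUB (Set.range fun p : ι × ℝ => 2 * ⟪x, v p.1⟫ + 2 * p.2 * ⟪x, e⟫
        - (lam * p.2 ^ 2 + ⟪N (v p.1), v p.1⟫)) (nn x)) ∧
      (∀ x, IsLUB (Set.range fun i => 2 * ⟪x, v i⟫ - ⟪N (v i), v i⟫) (n0 x)) ∧
      IsGLB (Set.range fun i => lam + ⟪N (v i), v i⟫ + n0 (-A (e + v i))) D ∧
      IsGLB (Set.range fun i => nn (N (e + v i) + A (e + v i))) D ∧
      IsGLB (Set.range fun i => nn (lam • e + (N (v i) + A (v i)))) (lam ^ 2 / D) ∧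
      ∀ a : ℝ, (∃ y : ℕ → ι, Tendsto
        (fun k => nn (N (e + v (y k)) - A (e + v (y k)) - a • e)) atTop (𝓝 0)) ↔ a = D := by
  have hAA : ∀ x, ⟪A x, x⟫ = 0 := fun x => by
    have h1 := hA x x
    have h2 := real_inner_comm (A x) x
    linarith
  have hNpos : ∀ x, 0 ≤ ⟪N x, x⟫ := fun x =>
    le_trans (by positivity) (hcoer x)
  obtain ⟨S, hS⟩ := exists_rightInverse_of_coercive N hc hcoer
  obtain ⟨R, hR⟩ := exists_rightInverse_of_coercive (N - A) hc (fun x => by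
    simp only [sub_apply, inner_sub_left, hAA, sub_zero]; exact hcoer x)
  obtain ⟨R', hR'⟩ := exists_rightInverse_of_coercive (N + A) hc (fun x => by
    simp only [add_apply, inner_add_left, hAA, add_zero]; exact hcoer x)
  -- The antisymmetric part does not contribute to ⟪A x, x⟫, so N - A and N + A are as coercive as N
  -- and both equations are solvable.
  obtain ⟨r, hr⟩ : ∃ r, N r - A r = e := ⟨R e, by simpa using hR e⟩
  obtain ⟨s, hs⟩ : ∃ s, N s + A s = e := ⟨R' e, by simpa using hR' e⟩
  -- the resolvents
  have adj : ∀ x z, ⟪N x + A x, z⟫ = ⟪x, N z - A z⟫ := fun x z => by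
    rw [inner_add_left, inner_sub_right, hN, hA]; ring
  have adj' : ∀ x z, ⟪N x - A x, z⟫ = ⟪x, N z + A z⟫ := fun x z => by
    rw [inner_sub_left, inner_add_right, hN, hA]; ring
  obtain ⟨q, hq⟩ : ∃ q, q = ⟪r, e⟫ := ⟨_, rfl⟩
  have hsq : ⟪s, e⟫ = q := by
    have h1 : ⟪N r - A r, s⟫ = ⟪r, N s + A s⟫ := adj' r s
    rw [hq, real_inner_comm, ← hr, h1, hs, hr]
  have hNr : ⟪N r, r⟫ = q := by
    have h1 : ⟪N r - A r, r⟫ = q := by rw [hr, real_inner_comm, hq]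
    rwa [inner_sub_left, hAA, sub_zero] at h1
  have hNs : ⟪N s, s⟫ = q := by
    have h1 : ⟪N s + A s, s⟫ = q := by rw [hs, real_inner_comm, hsq]
    rwa [inner_add_left, hAA, add_zero] at h1
  have hqpos : 0 < q := by
    have h1 : 0 ≤ q := hNr ▸ hNpos r
    rcases h1.lt_or_eq with h | h
    · exact h
    · exfalso
      have h2 := hcoer r
      rw [hNr, ← h] at h2
      have h3 : ‖r‖ ^ 2 = 0 := le_antisymm (by nlinarith [sq_nonneg ‖r‖]) (sq_nonneg _)
      have h4 : r = 0 := by simpa using h3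
      rw [h4, map_zero, map_zero, sub_zero] at hr
      rw [← hr, inner_zero_left] at he
      exact zero_ne_one he
  -- the dual norms
  have hSup : ∀ x z, 2 * ⟪x, z⟫ - ⟪N z, z⟫ ≤ ⟪S x, x⟫ := fun x z => by
    have h := hNpos (z - S x)
    have h1 : ⟪N z, S x⟫ = ⟪x, z⟫ := by rw [hN, hS, real_inner_comm]
    rw [map_sub, hS, inner_sub_left, inner_sub_right, inner_sub_right, h1,
      real_inner_comm (S x) x] at h
    linarith
  -- As e is an eigenvector of the symmetric N, the quadratic form splits along e and its
  -- orthogonal.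
  have hzae : ∀ z, ⟪z, e⟫ = 0 → ∀ a : ℝ,
      ⟪N (z + a • e), z + a • e⟫ = lam * a ^ 2 + ⟪N z, z⟫ := fun z hz a => by
      have h1 : ⟪N z, e⟫ = 0 := by rw [hN, hNe, inner_smul_right, hz, mul_zero]
      have h2 : ⟪e, z⟫ = 0 := by rw [real_inner_comm, hz]
      simp only [map_add, map_smul, hNe, inner_add_left, inner_add_right, inner_smul_left,
        inner_smul_right, h1, h2, he]
      simp; ring
  have hSe : ∀ x, lam * ⟪S x, e⟫ = ⟪x, e⟫ := fun x => by
    have : ⟪S x, N e⟫ = ⟪x, e⟫ := by rw [← hN, hS]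
    rwa [hNe, inner_smul_right] at this
  -- All extrema below are attained at explicit points of the orthogonal of e; density turns an
  -- attained value into a limit of values at the `v i`, hence into the exact extremum.
  have hcl : ∀ (f : H → ℝ), Continuous f → ∀ x, ⟪x, e⟫ = 0 →
      f x ∈ closure (Set.range fun i => f (v i)) := fun f hf x hx => by
    have := image_closure_subset_closure_image hf ⟨x, hdense x hx, rfl⟩
    rwa [← Set.range_comp] at this
  have hnn : ∀ x, IsLUB (Set.range fun p : ι × ℝ => 2 * ⟪x, v p.1⟫ + 2 * p.2 * ⟪x, e⟫
        - (lam * p.2 ^ 2 + ⟪N (v p.1), v p.1⟫)) ⟪S x, x⟫ := fun x => by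
    refine isLUB_of_mem_closure ?_ ?_
    · rintro _ ⟨⟨i, a⟩, rfl⟩
      have := hSup x (v i + a • e)
      rw [hzae (v i) (hv i), inner_add_right, inner_smul_right] at this
      simp only
      linarith
    -- The unconstrained maximizer is N⁻¹ x; it is split into its component along e, realized by the
    -- real parameter, and its orthogonal part, approximated by the `v i`.
    · have hx0 : ⟪S x - ⟪S x, e⟫ • e, e⟫ = 0 := by
        rw [inner_sub_left, inner_smul_left, he]; simp
      have := hcl (fun z => 2 * ⟪x, z⟫ + 2 * ⟪S x, e⟫ * ⟪x, e⟫
        - (lam * ⟪S x, e⟫ ^ 2 + ⟪N z, z⟫)) (by fun_prop) _ hx0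
      refine closure_mono (s := Set.range fun i => 2 * ⟪x, v i⟫ + 2 * ⟪S x, e⟫ * ⟪x, e⟫
        - (lam * ⟪S x, e⟫ ^ 2 + ⟪N (v i), v i⟫)) ?_ ?_
      · rintro _ ⟨i, rfl⟩
        exact ⟨(i, ⟪S x, e⟫), rfl⟩
      · convert this using 1
        have h1 := hSe x
        rw [map_sub, map_smul, hNe, hS]
        simp only [inner_sub_left, inner_sub_right, inner_smul_left, inner_smul_right, he,
          real_inner_comm (S x) e, real_inner_comm (S x) x, ← h1, RCLike.conj_to_real]
        ring
  -- Confining the test vectors to the orthogonal of e costs the maximum over a of 2 a ⟪x, e⟫ - lam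
  -- a², reached at a = ⟪x, e⟫ / lam.
  have hSup0 : ∀ x z, ⟪z, e⟫ = 0 →
      2 * ⟪x, z⟫ - ⟪N z, z⟫ ≤ ⟪S x, x⟫ - ⟪x, e⟫ ^ 2 / lam := fun x z hz => by
    have := hSup x (z + (⟪x, e⟫ / lam) • e)
    rw [hzae z hz, inner_add_right, inner_smul_right] at this
    have h2 : lam * (⟪x, e⟫ / lam) ^ 2 = ⟪x, e⟫ ^ 2 / lam := by field_simp
    have h3 : ⟪x, e⟫ / lam * ⟪x, e⟫ = ⟪x, e⟫ ^ 2 / lam := by ring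
    rw [h2, h3] at this
    linarith
  have hn0 : ∀ x, IsLUB (Set.range fun i => 2 * ⟪x, v i⟫ - ⟪N (v i), v i⟫)
      (⟪S x, x⟫ - ⟪x, e⟫ ^ 2 / lam) := fun x => by
    refine isLUB_of_mem_closure ?_ ?_
    · rintro _ ⟨i, rfl⟩
      exact hSup0 x (v i) (hv i)
    · have hx0 : ⟪S x - ⟪S x, e⟫ • e, e⟫ = 0 := by
        rw [inner_sub_left, inner_smul_left, he]; simp
      have := hcl (fun z => 2 * ⟪x, z⟫ - ⟪N z, z⟫) (by fun_prop) _ hx0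
      convert this using 1
      have h1 := hSe x
      rw [map_sub, map_smul, hNe, hS]
      simp only [inner_sub_left, inner_sub_right, inner_smul_left, inner_smul_right, he,
        real_inner_comm (S x) e, real_inner_comm (S x) x, ← h1, RCLike.conj_to_real]
      field_simp
      ring
  -- the saddle point
  have hw0 : ⟪(1 / (2 * q)) • (r + s) - e, e⟫ = 0 := by
    rw [inner_sub_left, inner_smul_left, inner_add_left, hsq, ← hq, he, RCLike.conj_to_real]
    field_simp
    ring
  have hz0 : ⟪(1 / (2 * q)) • (s - r), e⟫ = 0 := by
    rw [inner_smul_left, inner_sub_left, hsq, ← hq, sub_self, mul_zero]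
  have hAr : A r = N r - e := by rw [← hr]; abel
  have hAs : A s = e - N s := by rw [← hs]; abel
  -- Euler–Lagrange equations of the inf-sup, with w = (r + s)/(2q) and z = (s - r)/(2q): here
  -- stationarity in w, up to a multiplier along e for the constraint ⟪w, e⟫ = 1, and next
  -- stationarity in z.
  have hwz : N ((1 / (2 * q)) • (r + s)) + A ((1 / (2 * q)) • (s - r)) = (1 / q) • e := by
    simp only [map_smul, map_add, map_sub, hAr, hAs]
    match_scalars <;> field_simp <;> ring
  have hzw : -A ((1 / (2 * q)) • (r + s)) = N ((1 / (2 * q)) • (s - r)) := by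
    simp only [map_smul, map_add, map_sub, hAr, hAs]
    module
  have hval : ⟪N ((1 / (2 * q)) • (r + s)), (1 / (2 * q)) • (r + s)⟫
      + ⟪N ((1 / (2 * q)) • (s - r)), (1 / (2 * q)) • (s - r)⟫ = 1 / q := by
    simp only [map_smul, map_add, map_sub, inner_smul_left, inner_smul_right, inner_add_left,
      inner_add_right, inner_sub_left, inner_sub_right, hNr, hNs, RCLike.conj_to_real]
    field_simp
    ring
  have hNrs : N (r + s) + A (r + s) = (2 : ℝ) • N r := by
    rw [map_add, map_add, hAr, hAs, two_smul]; abel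
  have hScont : Continuous fun x => ⟪S x, x⟫ := by fun_prop
  refine ⟨1 / q, by positivity, fun x => ⟪S x, x⟫, fun x => ⟪S x, x⟫ - ⟪x, e⟫ ^ 2 / lam,
    hnn, hn0, ?_, ?_, ?_, fun a => ⟨?_, ?_⟩⟩
  · refine isGLB_of_mem_closure ?_ ?_
    · rintro _ ⟨i, rfl⟩
      -- The inner supremum is bounded below by its value at the saddle z. What remains is convex in
      -- e + v i, and completing the square around the saddle w bounds it by 2/q - 1/q.
      have h1 := hSup0 (-A (e + v i)) _ hz0
      have h2 := hNpos (e + v i - (1 / (2 * q)) • (r + s))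
      have h3 := hzae (v i) (hv i) 1
      have h4 : ⟪N ((1 / (2 * q)) • (r + s)), e + v i⟫
          + ⟪A ((1 / (2 * q)) • (s - r)), e + v i⟫ = 1 / q := by
        rw [← inner_add_left, hwz, inner_smul_left, inner_add_right, he, real_inner_comm, hv]
        simp
      have h5 : ⟪-A (e + v i), (1 / (2 * q)) • (s - r)⟫
          = ⟪A ((1 / (2 * q)) • (s - r)), e + v i⟫ := by
        rw [inner_neg_left, hA, neg_neg, real_inner_comm]
      rw [one_smul, add_comm (v i) e] at h3
      have h6 : ⟪N (e + v i), (1 / (2 * q)) • (r + s)⟫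
          = ⟪N ((1 / (2 * q)) • (r + s)), e + v i⟫ := by rw [hN, real_inner_comm]
      rw [map_sub, inner_sub_left, inner_sub_right, inner_sub_right, h6] at h2
      rw [h5] at h1
      simp only
      linarith
    · have := hcl (fun y => lam + ⟪N y, y⟫ + (⟪S (-A (e + y)), -A (e + y)⟫
        - ⟪-A (e + y), e⟫ ^ 2 / lam)) (by fun_prop) _ hw0
      convert this using 1
      have h3 := hzae _ hw0 1
      rw [one_smul, sub_add_cancel] at h3
      have h4 : ⟪N ((1 / (2 * q)) • (s - r)), e⟫ = 0 := by
        rw [hN, hNe, inner_smul_right, hz0, mul_zero]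
      rw [add_sub_cancel, hzw, ← hN, hS, ← hval, h4, h3]
      ring
  · refine isGLB_of_mem_closure ?_ ?_
    · rintro _ ⟨i, rfl⟩
      -- By adjointness ⟪(N + A)(e + v), r⟫ = ⟪e + v, e⟫ = 1 for every v, so this test vector gives
      -- the bound 2/q - 1/q uniformly; r/q is the best multiple.
      have h := hSup (N (e + v i) + A (e + v i)) ((1 / q) • r)
      rw [inner_smul_right, adj, hr, inner_add_left, he, hv, map_smul, inner_smul_left,
        inner_smul_right, hNr, RCLike.conj_to_real] at h
      refine le_trans (le_of_eq ?_) h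
      field_simp
      ring
    · have := hcl (fun y => ⟪S (N (e + y) + A (e + y)), N (e + y) + A (e + y)⟫) (by fun_prop)
        _ hw0
      convert this using 1
      rw [add_sub_cancel, map_smul, map_smul, ← smul_add, hNrs, smul_smul, map_smul,
        inner_smul_left, inner_smul_right, ← hN, hS, hNr, RCLike.conj_to_real]
      field_simp
  · refine isGLB_of_mem_closure ?_ ?_
    · rintro _ ⟨i, rfl⟩
      -- Again v drops out by adjointness, and the bound is 2 lam² q - lam² q. The next bullet
      -- attains it at v = (lam / 2)(r - s), which makes the whole vector equal to lam N r.
      have h := hSup (lam • e + (N (v i) + A (v i))) (lam • r)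
      rw [inner_smul_right, inner_add_left, adj, hr, hv, inner_smul_left, real_inner_comm r e,
        ← hq, map_smul, inner_smul_left, inner_smul_right, hNr, RCLike.conj_to_real] at h
      refine le_trans (le_of_eq ?_) h
      field_simp
      ring
    · have hy0 : ⟪(lam / 2) • (r - s), e⟫ = 0 := by
        rw [inner_smul_left, inner_sub_left, hsq, ← hq]; simp
      have := hcl (fun y => ⟪S (lam • e + (N y + A y)), lam • e + (N y + A y)⟫) (by fun_prop)
        _ hy0
      convert this using 1
      have h1 : lam • e + (N ((lam / 2) • (r - s)) + A ((lam / 2) • (r - s))) = lam • N r := by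
        simp only [map_smul, map_sub, hAr, hAs]
        module
      rw [h1, map_smul, inner_smul_left, inner_smul_right, ← hN, hS, hNr, RCLike.conj_to_real]
      field_simp
  · rintro ⟨y, hy⟩
    -- Testing against t s gives a quantity independent of the sequence, because ⟪(N - A)(e + v) - a
    -- e, s⟫ = 1 - a q. In the limit no t may make it positive; t = (1 - a q)/q then forces a q = 1.
    have key : ∀ t : ℝ, 2 * (t * (1 - a * q)) - t * (t * q) ≤ 0 := fun t => by
      refine ge_of_tendsto' hy fun k => ?_
      have h := hSup (N (e + v (y k)) - A (e + v (y k)) - a • e) (t • s)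
      rw [inner_smul_right, inner_sub_left, adj', hs, inner_add_left, he, hv, inner_smul_left,
        real_inner_comm s e, hsq, map_smul, inner_smul_left, inner_smul_right, hNs,
        RCLike.conj_to_real, RCLike.conj_to_real] at h
      simpa using h
    have h := key ((1 - a * q) / q)
    have h2 : 2 * ((1 - a * q) / q * (1 - a * q)) - (1 - a * q) / q * ((1 - a * q) / q * q)
      = (1 - a * q) ^ 2 / q := by field_simp; ring
    rw [h2] at h
    have h3 : (1 - a * q) ^ 2 = 0 := by
      refine le_antisymm ?_ (sq_nonneg _)
      by_contra hcon
      push Not at hcon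
      exact absurd h (not_le.2 (by positivity))
    have h4 : 1 - a * q = 0 := by simpa using h3
    field_simp
    linarith
  · rintro rfl
    -- For a = 1/q the vector is exactly zero at e + v = r/q, so it suffices to approximate r/q - e.
    have hx0 : ⟪(1 / q) • r - e, e⟫ = 0 := by
      rw [inner_sub_left, inner_smul_left, ← hq, he, RCLike.conj_to_real]
      field_simp; ring
    have := hdense _ hx0
    obtain ⟨u, hu, hlim⟩ := mem_closure_iff_seq_limit.1 this
    choose y hy using hu
    refine ⟨y, ?_⟩
    have hcont : Continuous fun z => ⟪S (N (e + z) - A (e + z) - (1 / q) • e),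
      N (e + z) - A (e + z) - (1 / q) • e⟫ := by fun_prop
    have h2 := (hcont.tendsto _).comp hlim
    have h3 : N (e + ((1 / q) • r - e)) - A (e + ((1 / q) • r - e)) - (1 / q) • e = 0 := by
      rw [add_sub_cancel, map_smul, map_smul, ← smul_sub, hr, sub_self]
    rw [h3] at h2
    simpa [Function.comp_def, hy] using h2

/-- The variational characterizations of `hilbert_variational` for a positive semidefinite bilinear
form, without completeness. -/
theorem form_variational {X ι : Type*} [AddCommGroup X] [Module ℝ X] (ip : X →ₗ[ℝ] X →ₗ[ℝ] ℝ)
    (hsymm : ∀ x y, ip x y = ip y x) (hpos : ∀ x, 0 ≤ ip x x) (N A : X →ₗ[ℝ] X) (e : X)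
    {lam c K : ℝ} (hlam : 0 < lam) (hc : 0 < c)
    (hNb : ∀ x, ip (N x) (N x) ≤ K * ip x x) (hAb : ∀ x, ip (A x) (A x) ≤ K * ip x x)
    (hN : ∀ x y, ip (N x) y = ip x (N y)) (hA : ∀ x y, ip (A x) y = -ip x (A y))
    (hcoer : ∀ x, c * ip x x ≤ ip (N x) x) (hNe : N e = lam • e) (he : ip e e = 1)
    (v : ι → X) (hv : ∀ i, ip (v i) e = 0)
    (hdense : ∀ x, ip x e = 0 → ∀ ε > 0, ∃ i, ip (x - v i) (x - v i) < ε) :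
    ∃ D : ℝ, 0 < D ∧ ∃ nn n0 : X → ℝ,
      (∀ x, IsLUB (Set.range fun p : ι × ℝ => 2 * ip x (v p.1) + 2 * p.2 * ip x e
        - (lam * p.2 ^ 2 + ip (N (v p.1)) (v p.1))) (nn x)) ∧
      (∀ x, IsLUB (Set.range fun i => 2 * ip x (v i) - ip (N (v i)) (v i)) (n0 x)) ∧
      IsGLB (Set.range fun i => lam + ip (N (v i)) (v i) + n0 (-A (e + v i))) D ∧
      IsGLB (Set.range fun i => nn (N (e + v i) + A (e + v i))) D ∧
      IsGLB (Set.range fun i => nn (lam • e + (N (v i) + A (v i)))) (lam ^ 2 / D) ∧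
      ∀ a : ℝ, (∃ y : ℕ → ι, Tendsto
        (fun k => nn (N (e + v (y k)) - A (e + v (y k)) - a • e)) atTop (𝓝 0)) ↔ a = D := by
  -- The form may vanish on nonzero vectors, for instance on functions that are zero almost surely;
  -- it only gives a seminorm, and the completion performs the quotient as well.
  let core : PreInnerProductSpace.Core ℝ X :=
    { inner := fun x y => ip x y
      conj_inner_symm := fun x y => hsymm y x
      re_inner_nonneg := hpos
      add_left := fun x y z => by simp
      smul_left := fun x y r => by simp }
  let _ : SeminormedAddCommGroup X := InnerProductSpace.Core.toSeminormedAddCommGroup (𝕜 := ℝ)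
  let _ : InnerProductSpace ℝ X := InnerProductSpace.ofCore core
  have hip : ∀ x y : X, ⟪x, y⟫ = ip x y := fun x y => rfl
  have hnorm : ∀ x : X, ‖x‖ ^ 2 = ip x x := fun x => by rw [← hip, real_inner_self_eq_norm_sq]
  have hbdd : ∀ T : X →ₗ[ℝ] X, (∀ x, ip (T x) (T x) ≤ K * ip x x) →
      ∀ x, ‖T x‖ ≤ √K * ‖x‖ := fun T hT x => by
    have h1 := Real.sqrt_le_sqrt (hT x)
    rwa [← hnorm, ← hnorm, Real.sqrt_sq (norm_nonneg _), Real.sqrt_mul' _ (sq_nonneg _),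
      Real.sqrt_sq (norm_nonneg _)] at h1
  let N' := (N.mkContinuous (√K) (hbdd N hNb)).completion
  let A' := (A.mkContinuous (√K) (hbdd A hAb)).completion
  have hN' : ∀ x : X, N' x = ((N x : X) : UniformSpace.Completion X) := fun x => by simp [N']
  have hA' : ∀ x : X, A' x = ((A x : X) : UniformSpace.Completion X) := fun x => by simp [A']
  have hin : ∀ x y : X, ⟪(x : UniformSpace.Completion X), (y : UniformSpace.Completion X)⟫
      = ip x y := fun x y => by rw [UniformSpace.Completion.inner_coe, hip]
  have hmain := hilbert_variational N' A' (e : UniformSpace.Completion X) hlam hc ?_ ?_ ?_ ?_ ?_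
    (fun i => (v i : UniformSpace.Completion X)) ?_ ?_
  · obtain ⟨D, hD, nn, n0, h1, h2, h3, h4, h5, h6⟩ := hmain
    refine ⟨D, hD, fun x => nn x, fun x => n0 x, fun x => ?_, fun x => ?_, ?_, ?_, ?_, fun a => ?_⟩
    · simpa only [hin, hN'] using h1 x
    · simpa only [hin, hN'] using h2 x
    · simpa only [hin, hN', hA', ← UniformSpace.Completion.coe_add,
        ← UniformSpace.Completion.coe_neg] using h3
    · simpa only [hin, hN', hA', ← UniformSpace.Completion.coe_add] using h4
    · simpa only [hin, hN', hA', ← UniformSpace.Completion.coe_add,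
        ← UniformSpace.Completion.coe_smul] using h5
    · simpa only [hin, hN', hA', ← UniformSpace.Completion.coe_add,
        ← UniformSpace.Completion.coe_sub, ← UniformSpace.Completion.coe_smul] using h6 a
  · intro x y
    induction x, y using UniformSpace.Completion.induction_on₂ with
    | hp => exact isClosed_eq (by fun_prop) (by fun_prop)
    | ih x y => rw [hN', hN', hin, hin, hN]
  · intro x y
    induction x, y using UniformSpace.Completion.induction_on₂ with
    | hp => exact isClosed_eq (by fun_prop) (by fun_prop)
    | ih x y => rw [hA', hA', hin, hin, hA]
  · intro x
    induction x using UniformSpace.Completion.induction_on with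
    | hp => exact isClosed_le (by fun_prop) (by fun_prop)
    | ih x => rw [hN', hin, UniformSpace.Completion.norm_coe, hnorm]; exact hcoer x
  · rw [hN', hNe, UniformSpace.Completion.coe_smul]
  · rw [hin, he]
  · intro i
    rw [hin, hv]
  · intro x hx
    -- The orthogonality condition is absorbed by a projection defined for every x; the claim
    -- becomes a closed condition and can be checked on the dense image of `X`.
    have h1 : x = x - ⟪x, (e : UniformSpace.Completion X)⟫ • (e : UniformSpace.Completion X) := by
      rw [hx, zero_smul, sub_zero]
    rw [h1]
    clear h1 hx
    induction x using UniformSpace.Completion.induction_on with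
    | hp => exact isClosed_closure.preimage (by fun_prop)
    | ih x =>
      rw [hin, ← UniformSpace.Completion.coe_smul, ← UniformSpace.Completion.coe_sub,
        Metric.mem_closure_range_iff]
      intro ε hε
      obtain ⟨i, hi⟩ := hdense (x - ip x e • e) (by simp [he]) (ε ^ 2) (by positivity)
      refine ⟨i, ?_⟩
      rw [dist_eq_norm, ← UniformSpace.Completion.coe_sub, UniformSpace.Completion.norm_coe]
      rw [← hnorm] at hi
      exact lt_of_pow_lt_pow_left₀ 2 hε.le hi

end Variational

/-! ### Local functions of the disorder and density of Laplacians -/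

section Disorder

variable {C : ℝ}

/-- The algebra of continuous functions of finitely many coordinates of the disorder. -/
def LocalAlg (C : ℝ) : Subalgebra ℝ (Disorder C → ℝ) where
  carrier := {φ | Continuous φ ∧ ∃ S : Finset ℤ, DependsOn φ (S : Set ℤ)}
  mul_mem' := by
    rintro φ ψ ⟨h1, S, hS⟩ ⟨h2, T, hT⟩
    refine ⟨h1.mul h2, S ∪ T, fun m m' h => ?_⟩
    rw [Pi.mul_apply, Pi.mul_apply, hS fun i hi => h i (by simp_all),
      hT fun i hi => h i (by simp_all)]
  add_mem' := by
    rintro φ ψ ⟨h1, S, hS⟩ ⟨h2, T, hT⟩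
    refine ⟨h1.add h2, S ∪ T, fun m m' h => ?_⟩
    rw [Pi.add_apply, Pi.add_apply, hS fun i hi => h i (by simp_all),
      hT fun i hi => h i (by simp_all)]
  algebraMap_mem' r := ⟨continuous_const, ∅, fun _ _ _ => rfl⟩

instance : CommRing (LocalAlg C) := inferInstance

instance : AddCommGroup (LocalAlg C) := inferInstance

instance : Module ℝ (LocalAlg C) := inferInstance

/-- Translation of the disorder field. -/
def translate (x : ℤ) (m : Disorder C) : Disorder C := fun z => m (x + z)

lemma translate_translate (x y : ℤ) (m : Disorder C) :
    translate x (translate y m) = translate (y + x) m := by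
  funext z; simp [translate, add_assoc]

@[simp] lemma translate_zero (m : Disorder C) : translate 0 m = m := by
  funext z; simp [translate]

lemma continuous_translate (x : ℤ) : Continuous (translate x : Disorder C → Disorder C) := by
  unfold translate; fun_prop

lemma DependsOn.comp_translate {φ : Disorder C → ℝ} {S : Finset ℤ}
    (h : DependsOn φ (S : Set ℤ)) (x : ℤ) :
    DependsOn (fun m => φ (translate x m)) ((S.image (x + ·) : Finset ℤ) : Set ℤ) :=
  fun m m' hm => h fun i hi => hm (x + i) (by simpa using hi)

/-- Translation of local functions of the disorder. -/
def tr (x : ℤ) : LocalAlg C →ₐ[ℝ] LocalAlg C where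
  toFun φ := ⟨fun m => (φ : Disorder C → ℝ) (translate x m),
    φ.2.1.comp (continuous_translate x), by
      obtain ⟨S, hS⟩ := φ.2.2
      exact ⟨_, DependsOn.comp_translate hS x⟩⟩
  map_one' := rfl
  map_mul' _ _ := rfl
  map_zero' := rfl
  map_add' _ _ := rfl
  commutes' _ := rfl

lemma tr_apply (x : ℤ) (φ : LocalAlg C) (m : Disorder C) :
    (tr x φ : Disorder C → ℝ) m = (φ : Disorder C → ℝ) (translate x m) := rfl

lemma tr_tr (x y : ℤ) (φ : LocalAlg C) : tr x (tr y φ) = tr (x + y) φ := by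
  ext m
  simp only [tr_apply, translate_translate]

@[simp] lemma tr_zero (φ : LocalAlg C) : tr 0 φ = φ := by
  ext m
  simp [tr_apply]

lemma bond_le (hC : 0 < C) (m : Disorder C) (x : ℤ) : bond m x ≤ C := by
  have h1 : C⁻¹ ≤ m x := (m x).2.1
  have h2 : C⁻¹ ≤ m (x + 1) := (m (x + 1)).2.1
  have h0 : 0 < C⁻¹ := inv_pos.2 hC
  have h3 : C⁻¹ ≤ √((m x : ℝ) * m (x + 1)) :=
    Real.le_sqrt_of_sq_le (by rw [sq]; exact mul_le_mul h1 h2 h0.le (h0.le.trans h1))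
  rw [bond, one_div]
  exact inv_le_of_inv_le₀ hC h3

lemma bond_nonneg (m : Disorder C) (x : ℤ) : 0 ≤ bond m x := by
  unfold bond; positivity

lemma bond_translate (m : Disorder C) (x y : ℤ) : bond (translate x m) y = bond m (x + y) := by
  simp [bond, translate, add_assoc]

lemma continuous_bond (hC : 0 < C) (x : ℤ) : Continuous fun m : Disorder C => bond m x := by
  unfold bond
  refine continuous_const.div (by fun_prop) fun m => ?_
  have h1 : 0 < (m x : ℝ) := (inv_pos.2 hC).trans_le (m x).2.1
  have h2 : 0 < (m (x + 1) : ℝ) := (inv_pos.2 hC).trans_le (m (x + 1)).2.1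
  positivity

/-- The bond coefficient as a local function; zero in the irrelevant case `C ≤ 0`. -/
noncomputable def bondL (C : ℝ) (x : ℤ) : LocalAlg C :=
  if h : 0 < C then ⟨fun m => bond m x, continuous_bond h x, {x, x + 1}, fun m m' hm => by
    simp only [bond]
    rw [hm x (by simp), hm (x + 1) (by simp)]⟩ else 0

lemma bondL_apply (hC : 0 < C) (x : ℤ) (m : Disorder C) :
    (bondL C x : Disorder C → ℝ) m = bond m x := by
  simp [bondL, hC]

lemma tr_bondL (hC : 0 < C) (x y : ℤ) : tr x (bondL C y) = bondL C (x + y) := by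
  ext m
  rw [tr_apply, bondL_apply hC, bondL_apply hC, bond_translate]

variable (ν : Measure (Set.Icc C⁻¹ C)) [IsProbabilityMeasure ν]

instance : IsProbabilityMeasure (disorderLaw ν) := by unfold disorderLaw; infer_instance

lemma integrable_localAlg (φ : LocalAlg C) :
    Integrable (φ : Disorder C → ℝ) (disorderLaw ν) := by
  obtain ⟨M, hM⟩ := isCompact_univ.exists_bound_of_continuousOn φ.2.1.continuousOn
  exact Integrable.of_bound φ.2.1.measurable.aestronglyMeasurable M
    (ae_of_all _ fun m => hM m trivial)

/-- The mean of a local function of the disorder. -/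
noncomputable def mean : LocalAlg C →ₗ[ℝ] ℝ where
  toFun φ := ∫ m, (φ : Disorder C → ℝ) m ∂(disorderLaw ν)
  map_add' φ ψ := integral_add (integrable_localAlg ν φ) (integrable_localAlg ν ψ)
  map_smul' r _ := integral_const_mul r _

lemma mean_apply (φ : LocalAlg C) :
    mean ν φ = ∫ m, (φ : Disorder C → ℝ) m ∂(disorderLaw ν) := rfl

lemma map_translate (x : ℤ) : (disorderLaw ν).map (translate x) = disorderLaw ν :=
  Measure.map_infinitePi_infinitePi_of_inj (P := fun _ : ℤ => ν) (f := fun z => x + z)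
    (add_right_injective x)

@[simp] lemma mean_tr (x : ℤ) (φ : LocalAlg C) : mean ν (tr x φ) = mean ν φ := by
  rw [mean_apply, mean_apply]
  conv_rhs => rw [← map_translate ν x]
  rw [integral_map (continuous_translate x).measurable.aemeasurable
    φ.2.1.measurable.aestronglyMeasurable]
  rfl

@[simp] lemma mean_one : mean ν (1 : LocalAlg C) = 1 := by
  rw [mean_apply]
  change ∫ m, (1 : ℝ) ∂(disorderLaw ν) = 1
  simp

lemma mean_mono {φ ψ : LocalAlg C}
    (h : ∀ m, (φ : Disorder C → ℝ) m ≤ (ψ : Disorder C → ℝ) m) : mean ν φ ≤ mean ν ψ :=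
  integral_mono (integrable_localAlg ν φ) (integrable_localAlg ν ψ) h

lemma mean_mul_self_nonneg (φ : LocalAlg C) : 0 ≤ mean ν (φ * φ) :=
  integral_nonneg fun _ => mul_self_nonneg _

lemma mean_tr_mul (x : ℤ) (φ ψ : LocalAlg C) :
    mean ν (tr x φ * ψ) = mean ν (φ * tr (-x) ψ) := by
  rw [← mean_tr ν (-x), map_mul, tr_tr]
  simp

/-- Coordinates in disjoint sets are independent under the product law. This is the only place where
independence of the disorder is used directly; elsewhere translation invariance suffices. -/
lemma integral_mul_of_disjoint {φ ψ : LocalAlg C} {S T : Finset ℤ}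
    (hφ : DependsOn (φ : Disorder C → ℝ) (S : Set ℤ))
    (hψ : DependsOn (ψ : Disorder C → ℝ) (T : Set ℤ)) (hST : Disjoint S T) :
    mean ν (φ * ψ) = mean ν φ * mean ν ψ := by
  classical
  have hind : iIndepFun (fun (i : ℤ) (m : Disorder C) => m i) (disorderLaw ν) :=
    iIndepFun_infinitePi (P := fun _ : ℤ => ν) (X := fun _ y => y) (fun _ => measurable_id)
  have h1 := hind.indepFun_finset S T hST (fun i => measurable_pi_apply i)
  -- A reference configuration fills the sites outside the support, so that a local function becomes
  -- a measurable function of its restricted coordinates.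
  obtain ⟨m0⟩ : Nonempty (Disorder C) := nonempty_of_isProbabilityMeasure (disorderLaw ν)
  let ext (R : Finset ℤ) (y : R → Set.Icc C⁻¹ C) : Disorder C :=
    fun z => if h : z ∈ R then y ⟨z, h⟩ else m0 z
  have hext : ∀ R, Measurable (ext R) := fun R => by
    refine measurable_pi_lambda _ fun z => ?_
    by_cases h : z ∈ R
    · simpa [ext, h] using measurable_pi_apply _
    · simp [ext, h]
  have h2 := h1.comp (φ.2.1.measurable.comp (hext S)) (ψ.2.1.measurable.comp (hext T))
  have hS : ((φ : Disorder C → ℝ) ∘ ext S) ∘ (fun (m : Disorder C) (i : S) => m i)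
      = (φ : Disorder C → ℝ) := by
    funext m
    refine hφ fun i hi => ?_
    simp only [ext]
    rw [dif_pos (by simpa using hi)]
  have hT : ((ψ : Disorder C → ℝ) ∘ ext T) ∘ (fun (m : Disorder C) (i : T) => m i)
      = (ψ : Disorder C → ℝ) := by
    funext m
    refine hψ fun i hi => ?_
    simp only [ext]
    rw [dif_pos (by simpa using hi)]
  rw [hS, hT] at h2
  exact h2.integral_mul_eq_mul_integral φ.2.1.measurable.aestronglyMeasurable
    ψ.2.1.measurable.aestronglyMeasurable

lemma exists_translate_uncorrelated (φ : LocalAlg C) :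
    ∃ n : ℕ, mean ν (φ * tr n φ) = mean ν φ * mean ν φ := by
  classical
  obtain ⟨S, hS⟩ := φ.2.2
  obtain ⟨M, hM⟩ : ∃ M : ℕ, ∀ i ∈ S, |i| ≤ M :=
    ⟨S.sup Int.natAbs, fun i hi => by
      have := Finset.le_sup (f := Int.natAbs) hi
      rw [Int.abs_eq_natAbs]
      exact_mod_cast this⟩
  -- The support lies in [-M, M]; a translation by more than its diameter makes it disjoint from
  -- itself.
  refine ⟨2 * M + 1, ?_⟩
  rw [integral_mul_of_disjoint ν hS (ψ := tr _ φ) (DependsOn.comp_translate hS _) ?_, mean_tr]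
  refine Finset.disjoint_left.2 fun i hi hi' => ?_
  obtain ⟨j, hj, rfl⟩ := Finset.mem_image.1 hi'
  have h1 := abs_le.1 (hM _ hi)
  have h2 := abs_le.1 (hM _ hj)
  push_cast at h1
  omega

/-- Telescoping: a difference over n steps is a sum of unit differences. -/
lemma sub_tr_mem_range (φ : LocalAlg C) (n : ℕ) :
    ∃ h : LocalAlg C, φ - tr n φ = h - tr 1 h := by
  induction n with
  | zero => exact ⟨0, by simp⟩
  | succ n ih =>
    obtain ⟨h, hh⟩ := ih
    refine ⟨h + tr n φ, ?_⟩
    rw [map_add, tr_tr, add_sub_add_comm, ← hh]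
    push_cast
    rw [add_comm (1 : ℤ)]
    abel

/-- Gradients are dense in the centered local functions: an averaging step against a far away
translate halves the variance of what remains. -/
lemma exists_sub_gradient_small (φ : LocalAlg C) (hφ : mean ν φ = 0) (n : ℕ) :
    ∃ h : LocalAlg C, mean ν ((φ - (h - tr 1 h)) * (φ - (h - tr 1 h)))
      = mean ν (φ * φ) / 2 ^ n := by
  induction n with
  | zero => exact ⟨0, by simp⟩
  | succ n ih =>
    obtain ⟨h, hh⟩ := ih
    obtain ⟨ψ, hψ⟩ : ∃ ψ, ψ = φ - (h - tr 1 h) := ⟨_, rfl⟩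
    have hψ0 : mean ν ψ = 0 := by rw [hψ]; simp [hφ]
    obtain ⟨k, hk⟩ := exists_translate_uncorrelated ν ψ
    obtain ⟨g, hg⟩ := sub_tr_mem_range ψ k
    refine ⟨h + (2⁻¹ : ℝ) • g, ?_⟩
    have h1 : φ - (h + (2⁻¹ : ℝ) • g - tr 1 (h + (2⁻¹ : ℝ) • g))
        = (2⁻¹ : ℝ) • (ψ + tr k ψ) := by
      have : tr (k : ℤ) ψ = ψ - (g - tr 1 g) := by rw [← hg]; abel
      rw [this, hψ, map_add, map_smul]
      module
    have h2 : mean ν (tr k ψ * tr k ψ) = mean ν (ψ * ψ) := by rw [← map_mul, mean_tr]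
    rw [h1, smul_mul_smul_comm, map_smul, add_mul, mul_add, mul_add, map_add, map_add, map_add,
      mul_comm (tr _ ψ) ψ, hk, h2, hψ0, hψ, hh, smul_eq_mul]
    ring

lemma mean_add_mul_self_le (φ ψ : LocalAlg C) :
    mean ν ((φ + ψ) * (φ + ψ)) ≤ 2 * mean ν (φ * φ) + 2 * mean ν (ψ * ψ) := by
  have h := mean_mul_self_nonneg ν (φ - ψ)
  simp only [add_mul, mul_add, sub_mul, mul_sub, map_add, map_sub] at h ⊢
  linarith

/-- The potential is normalized to mean zero, which leaves its gradient unchanged, so that the lemma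
can be applied to the potential in turn. -/
lemma exists_sub_gradient_lt (φ : LocalAlg C) (hφ : mean ν φ = 0) {ε : ℝ} (hε : 0 < ε) :
    ∃ h : LocalAlg C, mean ν h = 0 ∧ mean ν ((φ - (h - tr 1 h)) * (φ - (h - tr 1 h))) < ε := by
  obtain ⟨n, hn⟩ := exists_pow_lt_of_lt_one (div_pos hε (show 0 < mean ν (φ * φ) + 1 from
    by linarith [mean_mul_self_nonneg ν φ])) (by norm_num : (1 / 2 : ℝ) < 1)
  obtain ⟨h, hh⟩ := exists_sub_gradient_small ν φ hφ n
  refine ⟨h - mean ν h • 1, by simp, ?_⟩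
  have h1 : h - mean ν h • 1 - tr 1 (h - mean ν h • 1) = h - tr 1 h := by
    rw [map_sub, map_smul, map_one]; abel
  have h0 := mean_mul_self_nonneg ν φ
  rw [h1, hh]
  rw [lt_div_iff₀ (by linarith), one_div, inv_pow] at hn
  have h2 : 0 < ((2 : ℝ) ^ n)⁻¹ := by positivity
  rw [div_eq_inv_mul]
  nlinarith

/-- Discrete Laplacians are dense in the centered local functions. -/
lemma exists_sub_laplacian_lt (φ : LocalAlg C) (hφ : mean ν φ = 0) {ε : ℝ} (hε : 0 < ε) :
    ∃ g : LocalAlg C, mean ν ((φ - ((2 : ℝ) • g - tr 1 g - tr (-1) g))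
      * (φ - ((2 : ℝ) • g - tr 1 g - tr (-1) g))) < ε := by
  obtain ⟨h, hh0, hh⟩ := exists_sub_gradient_lt ν φ hφ (show 0 < ε / 4 by positivity)
  obtain ⟨k, -, hk⟩ := exists_sub_gradient_lt ν h hh0 (show 0 < ε / 16 by positivity)
  -- With φ ≈ (1 - τ)h and h ≈ (1 - τ)k one has φ ≈ (1 - τ)² k, and (1 - τ)² = (2 - τ - τ⁻¹)(-τ).
  refine ⟨-tr 1 k, ?_⟩
  obtain ⟨r, hr⟩ : ∃ r, r = h - (k - tr 1 k) := ⟨_, rfl⟩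
  rw [← hr] at hk
  have h1 : φ - ((2 : ℝ) • (-tr 1 k) - tr 1 (-tr 1 k) - tr (-1) (-tr 1 k))
      = (φ - (h - tr 1 h)) + (r + -tr 1 r) := by
    have h2 : tr (-1) (tr 1 k) = k := by simp [tr_tr]
    rw [hr]
    simp only [map_neg, map_sub, h2, two_smul]
    abel
  rw [h1]
  have h3 := mean_add_mul_self_le ν (φ - (h - tr 1 h)) (r + -tr 1 r)
  have h4 := mean_add_mul_self_le ν r (-tr 1 r)
  have h5 : mean ν (-tr 1 r * -tr 1 r) = mean ν (r * r) := by
    rw [neg_mul_neg (tr 1 r) (tr 1 r), ← map_mul, mean_tr]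
  rw [h5] at h4
  linarith

end Disorder

/-! ### The scalar product and the operators on coefficient sequences -/

section Data

variable {C : ℝ}

/-- Finite sequences of local functions: the coefficient `0` is that of the squares, the coefficient
`k ≥ 1` that of the products of two values at distance `k`. -/
def Data (C : ℝ) : Submodule ℝ (ℕ → LocalAlg C) where
  carrier := {w | ∃ K, ∀ k ≥ K, w k = 0}
  zero_mem' := ⟨0, fun _ _ => rfl⟩
  add_mem' := by
    rintro w w' ⟨K, hK⟩ ⟨K', hK'⟩
    exact ⟨max K K', fun k hk => by simp_all⟩
  smul_mem' := by
    rintro r w ⟨K, hK⟩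
    exact ⟨K, fun k hk => by simp_all⟩

instance : AddCommGroup (Data C) := inferInstance

instance : Module ℝ (Data C) := inferInstance

/-- A linear map given on sequences by finite-range formulas acts on finite sequences. -/
lemma restrict_aux (T : (ℕ → LocalAlg C) →ₗ[ℝ] (ℕ → LocalAlg C)) (n : ℕ)
    (hT : ∀ w k, (∀ j, k ≤ j + n → w j = 0) → T w k = 0) : ∀ w ∈ Data C, T w ∈ Data C := by
  rintro w ⟨K, hK⟩
  exact ⟨K + n, fun k hk => hT w k fun j hj => hK j (by omega)⟩

/-- Minus the lattice Laplacian on the coefficient of the squares. -/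
def lapFun : (ℕ → LocalAlg C) →ₗ[ℝ] (ℕ → LocalAlg C) where
  toFun w k := match k with
    | 0 => (2 : ℝ) • w 0 - tr 1 (w 0) - tr (-1) (w 0)
    | k + 1 => w (k + 1)
  map_add' w w' := by
    funext k
    rcases k with _ | k <;> simp only [Pi.add_apply, map_add, smul_add]
    abel
  map_smul' r w := by
    funext k
    rcases k with _ | k <;> simp only [Pi.smul_apply, map_smul, RingHom.id_apply]
    module

/-- The symmetric part of the generator (with the opposite sign) on the coefficients. -/
def symFun (lam gam : ℝ) : (ℕ → LocalAlg C) →ₗ[ℝ] (ℕ → LocalAlg C) where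
  toFun w k := match k with
    | 0 => lam • w 0
    -- Neighbouring sites: the exchange across their own bond fixes the product, so two bonds act
    -- instead of four and the distance cannot shrink to zero.
    | 1 => (4 * gam) • w 1 + lam • ((2 : ℝ) • w 1 - w 2 - tr (-1) (w 2))
    | k + 2 => (4 * gam) • w (k + 2) + lam • ((4 : ℝ) • w (k + 2) - w (k + 1) - tr 1 (w (k + 1))
        - w (k + 3) - tr (-1) (w (k + 3)))
  map_add' w w' := by
    funext k
    rcases k with _ | _ | k <;> simp only [Pi.add_apply, map_add] <;> module
  map_smul' r w := by
    funext k
    rcases k with _ | _ | k <;> simp only [Pi.smul_apply, map_smul, RingHom.id_apply] <;> module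

/-- The antisymmetric part of the generator on the coefficients. -/
noncomputable def antiFun : (ℕ → LocalAlg C) →ₗ[ℝ] (ℕ → LocalAlg C) where
  toFun w k := match k with
    | 0 => bondL C 0 * w 1
    | 1 => tr (-1) (bondL C 0 * w 2) - bondL C 1 * w 2 - (2 : ℝ) • (bondL C 0 * w 0)
    | k + 2 => tr (-1) (bondL C 0 * w (k + 3)) - bondL C 0 * tr 1 (w (k + 1))
        + bondL C (k + 1) * w (k + 1) - bondL C (k + 2) * w (k + 3)
  map_add' w w' := by
    funext k
    rcases k with _ | _ | k <;> simp only [Pi.add_apply, map_add, mul_add] <;> module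
  map_smul' r w := by
    funext k
    rcases k with _ | _ | k <;>
      simp only [Pi.smul_apply, map_smul, RingHom.id_apply, mul_smul_comm] <;> module

/-- `lapFun` on finite sequences. -/
def lapD : Data C →ₗ[ℝ] Data C :=
  lapFun.restrict (restrict_aux lapFun 0 fun w k h => by
    rcases k with _ | k
    · simp [lapFun, h 0]
    · simpa [lapFun] using h (k + 1))

/-- `symFun` on finite sequences. -/
def symD (lam gam : ℝ) : Data C →ₗ[ℝ] Data C :=
  (symFun lam gam).restrict (restrict_aux (symFun lam gam) 1 fun w k h => by
    rcases k with _ | _ | k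
    · simp [symFun, h 0]
    · simp [symFun, h 1, h 2]
    · simp [symFun, h (k + 1), h (k + 2), h (k + 3)])

/-- `antiFun` on finite sequences. -/
noncomputable def antiD : Data C →ₗ[ℝ] Data C :=
  antiFun.restrict (restrict_aux antiFun 1 fun w k h => by
    rcases k with _ | _ | k
    · simp [antiFun, h 1]
    · simp [antiFun, h 0, h 2]
    · simp [antiFun, h (k + 1), h (k + 3)])

/-- The sequence `(1, 0, 0, …)`, the coefficients of `ω_1² - ω_0²`. -/
def unitD (C : ℝ) : Data C := ⟨Pi.single 0 1, 1, fun k hk => by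
  rw [Pi.single_eq_of_ne (by omega)]⟩

variable (ν : Measure (Set.Icc C⁻¹ C)) [IsProbabilityMeasure ν]

/-- The summands of the scalar product. -/
noncomputable def ipTerm (w w' : ℕ → LocalAlg C) (k : ℕ) : ℝ :=
  -- The weight ½ is the ratio of E[(ω_0 ω_k)²] = β⁻² to χ = 2β⁻².
  if k = 0 then mean ν (w 0 * w' 0) else 2⁻¹ * mean ν (w k * w' k)

/-- The scalar product `E[w_0 w'_0] + ½ ∑_{k ≥ 1} E[w_k w'_k]` on finite sequences. -/
noncomputable def ipD : Data C →ₗ[ℝ] Data C →ₗ[ℝ] ℝ :=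
  LinearMap.mk₂ ℝ (fun w w' => ∑ᶠ k, ipTerm ν w w' k)
    (fun w₁ w₂ w' => by
      rw [← finsum_add_distrib]
      · refine finsum_congr fun k => ?_
        by_cases h : k = 0 <;> simp [ipTerm, h, add_mul, mul_add]
      all_goals
        obtain ⟨K, hK⟩ := w'.2
        refine (Set.finite_lt_nat (K + 1)).subset fun k hk => ?_
        by_contra hcon
        simp only [Set.mem_ofPred_eq, not_lt] at hcon
        exact hk (by simp [ipTerm, hK k (by omega), show k ≠ 0 by omega]))
    (fun r w w' => by
      rw [smul_eq_mul, mul_finsum']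
      · refine finsum_congr fun k => ?_
        by_cases h : k = 0 <;> simp [ipTerm, h]; ring
      · obtain ⟨K, hK⟩ := w'.2
        refine (Set.finite_lt_nat (K + 1)).subset fun k hk => ?_
        by_contra hcon
        simp only [Set.mem_ofPred_eq, not_lt] at hcon
        exact hk (by simp [ipTerm, hK k (by omega), show k ≠ 0 by omega]))
    (fun w w₁ w₂ => by
      rw [← finsum_add_distrib]
      · refine finsum_congr fun k => ?_
        by_cases h : k = 0 <;> simp [ipTerm, h, mul_add]
      all_goals
        obtain ⟨K, hK⟩ := w.2
        refine (Set.finite_lt_nat (K + 1)).subset fun k hk => ?_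
        by_contra hcon
        simp only [Set.mem_ofPred_eq, not_lt] at hcon
        exact hk (by simp [ipTerm, hK k (by omega), show k ≠ 0 by omega]))
    (fun r w w' => by
      rw [smul_eq_mul, mul_finsum']
      · refine finsum_congr fun k => ?_
        by_cases h : k = 0 <;> simp [ipTerm, h]; ring
      · obtain ⟨K, hK⟩ := w'.2
        refine (Set.finite_lt_nat (K + 1)).subset fun k hk => ?_
        by_contra hcon
        simp only [Set.mem_ofPred_eq, not_lt] at hcon
        exact hk (by simp [ipTerm, hK k (by omega), show k ≠ 0 by omega]))

lemma ipD_eq_sum (w w' : Data C) {K : ℕ} (hK : ∀ k > K, w.1 k = 0 ∨ w'.1 k = 0) :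
    ipD ν w w' = mean ν (w.1 0 * w'.1 0)
      + 2⁻¹ * ∑ k ∈ Finset.range K, mean ν (w.1 (k + 1) * w'.1 (k + 1)) := by
  have h : ipD ν w w' = ∑ k ∈ Finset.range (K + 1), ipTerm ν w.1 w'.1 k := by
    refine finsum_eq_sum_of_support_subset _ fun k hk => ?_
    by_contra hcon
    simp only [Finset.coe_range, Set.mem_Iio, not_lt] at hcon
    refine hk ?_
    rcases hK k (by omega) with h | h <;> simp [ipTerm, h, show k ≠ 0 by omega]
  rw [h, Finset.sum_range_succ', Finset.mul_sum, add_comm]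
  simp [ipTerm]

lemma exists_bound (w : Data C) : ∃ K, ∀ k > K, w.1 k = 0 := by
  obtain ⟨K, hK⟩ := w.2
  exact ⟨K, fun k hk => hK k hk.le⟩

lemma ipD_symm (w w' : Data C) : ipD ν w w' = ipD ν w' w := by
  obtain ⟨K, hK⟩ := exists_bound w
  rw [ipD_eq_sum ν w w' fun k hk => Or.inl (hK k hk),
    ipD_eq_sum ν w' w fun k hk => Or.inr (hK k hk)]
  simp only [mul_comm]

lemma ipD_nonneg (w : Data C) : 0 ≤ ipD ν w w := by
  obtain ⟨K, hK⟩ := exists_bound w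
  rw [ipD_eq_sum ν w w fun k hk => Or.inl (hK k hk)]
  have := mean_mul_self_nonneg ν (w.1 0)
  have : 0 ≤ ∑ k ∈ Finset.range K, mean ν (w.1 (k + 1) * w.1 (k + 1)) :=
    Finset.sum_nonneg fun k _ => mean_mul_self_nonneg ν _
  positivity

lemma ipD_unit (w : Data C) : ipD ν w (unitD C) = mean ν (w.1 0) := by
  rw [ipD_eq_sum ν w (unitD C) (K := 0) fun k hk => Or.inr ?_]
  · simp [unitD]
  · simp [unitD, hk.ne']

/-- The Dirichlet form of the exchanges on the pair coefficients, up to distance `M`. -/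
noncomputable def pairEnergy (w w' : ℕ → LocalAlg C) (M : ℕ) : ℝ :=
  ∑ k ∈ Finset.range M, (mean ν ((w (k + 2) - w (k + 1)) * (w' (k + 2) - w' (k + 1)))
    + mean ν ((w (k + 2) - tr 1 (w (k + 1))) * (w' (k + 2) - tr 1 (w' (k + 1)))))

/-- Summation by parts in the distance k, with one boundary term at the cutoff; that term vanishes
for finite sequences once the cutoff is large. -/
lemma sum_symFun (lam gam : ℝ) (w w' : ℕ → LocalAlg C) (M : ℕ) :
    ∑ k ∈ Finset.range (M + 1), mean ν (symFun lam gam w (k + 1) * w' (k + 1))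
      = 4 * gam * ∑ k ∈ Finset.range (M + 1), mean ν (w (k + 1) * w' (k + 1))
        + lam * (pairEnergy ν w w' (M + 1)
          + mean ν ((w (M + 1) + tr 1 (w (M + 1)) - (2 : ℝ) • w (M + 2)) * w' (M + 2))) := by
  induction M with
  | zero =>
    simp only [pairEnergy, zero_add, Finset.sum_range_one]
    have h1 : mean ν (tr (-1) (w 2) * w' 1) = mean ν (w 2 * tr 1 (w' 1)) := by
      rw [mean_tr_mul]; simp
    have h2 : mean ν (tr 1 (w 1) * tr 1 (w' 1)) = mean ν (w 1 * w' 1) := by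
      rw [← map_mul, mean_tr]
    simp only [symFun, LinearMap.coe_mk, AddHom.coe_mk, add_mul, sub_mul, mul_sub, smul_mul_assoc,
      map_add, map_sub, map_smul, h1, h2, two_smul, smul_eq_mul]
    ring
  | succ M ih =>
    rw [Finset.sum_range_succ, ih, Finset.sum_range_succ _ (M + 1), pairEnergy, pairEnergy,
      Finset.sum_range_succ _ (M + 1)]
    have h1 : mean ν (tr (-1) (w (M + 3)) * w' (M + 2)) = mean ν (w (M + 3) * tr 1 (w' (M + 2))) := by
      rw [mean_tr_mul]; simp
    have h2 : mean ν (tr 1 (w (M + 2)) * tr 1 (w' (M + 2))) = mean ν (w (M + 2) * w' (M + 2)) := by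
      rw [← map_mul, mean_tr]
    simp only [symFun, LinearMap.coe_mk, AddHom.coe_mk, add_mul, sub_mul, mul_sub, smul_mul_assoc,
      map_add, map_sub, map_smul, h1, h2, smul_eq_mul, add_assoc,
      Nat.reduceAdd]
    ring_nf

lemma ipD_symD (lam gam : ℝ) (w w' : Data C) {M : ℕ} (hM : ∀ k > M, w'.1 k = 0) :
    ipD ν (symD lam gam w) w' = lam * mean ν (w.1 0 * w'.1 0)
      + 2 * gam * ∑ k ∈ Finset.range (M + 1), mean ν (w.1 (k + 1) * w'.1 (k + 1))
      + lam / 2 * pairEnergy ν w.1 w'.1 (M + 1) := by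
  rw [ipD_eq_sum ν _ w' (K := M + 1) fun k hk => Or.inr (hM k (by omega))]
  have h := sum_symFun ν lam gam w.1 w'.1 M
  rw [hM (M + 2) (by omega), mul_zero, map_zero, add_zero] at h
  change mean ν (symFun lam gam w.1 0 * w'.1 0)
    + 2⁻¹ * ∑ k ∈ Finset.range (M + 1), mean ν (symFun lam gam w.1 (k + 1) * w'.1 (k + 1)) = _
  rw [h]
  simp only [symFun, LinearMap.coe_mk, AddHom.coe_mk, smul_mul_assoc, map_smul, smul_eq_mul]
  ring

lemma symD_symm (lam gam : ℝ) (w w' : Data C) :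
    ipD ν (symD lam gam w) w' = ipD ν w (symD lam gam w') := by
  obtain ⟨K, hK⟩ := exists_bound w
  obtain ⟨K', hK'⟩ := exists_bound w'
  rw [ipD_symm ν w, ipD_symD ν lam gam w w' (M := max K K') fun k hk => hK' k (by simp at hk; omega),
    ipD_symD ν lam gam w' w (M := max K K') fun k hk => hK k (by simp at hk; omega)]
  simp only [pairEnergy, mul_comm]

/-- The exchange energy of the pairs is nonnegative and can be dropped: exchanges control the
coefficient of the squares, and flips give 4 gam on every pair coefficient. -/
lemma symD_coercive {lam gam : ℝ} (hlam : 0 < lam) (w : Data C) :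
    min lam (4 * gam) * ipD ν w w ≤ ipD ν (symD lam gam w) w := by
  obtain ⟨K, hK⟩ := exists_bound w
  rw [ipD_symD ν lam gam w w hK,
    ipD_eq_sum ν w w (K := K + 1) fun k hk => Or.inl (hK k (by omega))]
  have h0 := mean_mul_self_nonneg ν (w.1 0)
  have h1 : 0 ≤ ∑ k ∈ Finset.range (K + 1), mean ν (w.1 (k + 1) * w.1 (k + 1)) :=
    Finset.sum_nonneg fun k _ => mean_mul_self_nonneg ν _
  have h2 : 0 ≤ pairEnergy ν w.1 w.1 (K + 1) :=
    Finset.sum_nonneg fun k _ => add_nonneg (mean_mul_self_nonneg ν _) (mean_mul_self_nonneg ν _)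
  have h3 := mul_le_mul_of_nonneg_right (min_le_left lam (4 * gam)) h0
  have h4 := mul_le_mul_of_nonneg_right (min_le_right lam (4 * gam)) h1
  have h5 := mul_nonneg hlam.le h2
  linarith

/-- The sum telescopes to a boundary term, which gives antisymmetry for finite sequences. The factor
2 on the zeroth term clears the weight ½ and matches the asymmetric constants 1 and -2 coupling the
coefficients 0 and 1. -/
lemma sum_antiFun (w w' : ℕ → LocalAlg C) (M : ℕ) :
    2 * (mean ν (antiFun w 0 * w' 0) + mean ν (w 0 * antiFun w' 0))
      + ∑ k ∈ Finset.range (M + 1), (mean ν (antiFun w (k + 1) * w' (k + 1))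
        + mean ν (w (k + 1) * antiFun w' (k + 1)))
      = mean ν (bondL C 0 * w (M + 2) * tr 1 (w' (M + 1)))
        - mean ν (bondL C (M + 1) * w (M + 2) * w' (M + 1))
        + mean ν (bondL C 0 * w' (M + 2) * tr 1 (w (M + 1)))
        - mean ν (bondL C (M + 1) * w' (M + 2) * w (M + 1)) := by
  have h : ∀ (a b : ℕ → LocalAlg C) (n : ℕ), mean ν (tr (-1) (bondL C 0 * a (n + 2)) * b (n + 1))
      = mean ν (bondL C 0 * a (n + 2) * tr 1 (b (n + 1))) := fun a b n => by
    rw [mean_tr_mul]; simp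
  induction M with
  | zero =>
    have h1 := h w w' 0
    have h2 := h w' w 0
    rw [zero_add, zero_add] at h1 h2
    simp only [zero_add, Finset.sum_range_one, antiFun, LinearMap.coe_mk, AddHom.coe_mk,
      sub_mul, mul_sub, smul_mul_assoc, mul_smul_comm, map_sub, map_smul, h1, smul_eq_mul]
    rw [mul_comm (w 1) (tr (-1) _), h2]
    push_cast
    ring_nf
  | succ M ih =>
    rw [Finset.sum_range_succ, ← add_assoc, ih]
    have h1 := h w w' (M + 1)
    have h2 := h w' w (M + 1)
    simp only [antiFun, LinearMap.coe_mk, AddHom.coe_mk, add_mul, mul_add,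
      sub_mul, mul_sub, map_add, map_sub, add_assoc, Nat.reduceAdd] at h1 h2 ⊢
    rw [mul_comm (w (M + 2)) (tr (-1) _), h1, h2]
    push_cast
    ring_nf

lemma antiD_anti (w w' : Data C) : ipD ν (antiD w) w' = -ipD ν w (antiD w') := by
  obtain ⟨K, hK⟩ := exists_bound w
  obtain ⟨K', hK'⟩ := exists_bound w'
  have h := sum_antiFun ν w.1 w'.1 (max K K')
  have h1 : w.1 (max K K' + 2) = 0 := hK _ (by omega)
  have h2 : w'.1 (max K K' + 2) = 0 := hK' _ (by omega)
  rw [h1, h2, Finset.sum_add_distrib] at h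
  simp only [mul_zero, zero_mul, map_zero, sub_zero, add_zero] at h
  rw [ipD_eq_sum ν _ w' (K := max K K' + 1) fun k hk => Or.inr (hK' k (by omega)),
    ipD_eq_sum ν w _ (K := max K K' + 1) fun k hk => Or.inl (hK k (by omega))]
  change mean ν (antiFun w.1 0 * _) + 2⁻¹ * ∑ k ∈ _, mean ν (antiFun w.1 (k + 1) * _)
    = -(mean ν (_ * antiFun w'.1 0) + 2⁻¹ * ∑ k ∈ _, mean ν (_ * antiFun w'.1 (k + 1)))
  linarith

/-- Each output coefficient is controlled by at most three neighbouring inputs, so the sum meets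
every input at most three times; the weight ½ on pairs and the special role of the index 0 only
affect the constant 6. -/
lemma ipD_bound_of_local (T : Data C →ₗ[ℝ] Data C) {K₀ : ℝ} (hK₀ : 0 ≤ K₀)
    (h0 : ∀ w, mean ν ((T w).1 0 * (T w).1 0)
      ≤ K₀ * (mean ν (w.1 0 * w.1 0) + mean ν (w.1 1 * w.1 1)))
    (h1 : ∀ w k, mean ν ((T w).1 (k + 1) * (T w).1 (k + 1))
      ≤ K₀ * (mean ν (w.1 k * w.1 k) + mean ν (w.1 (k + 1) * w.1 (k + 1))
        + mean ν (w.1 (k + 2) * w.1 (k + 2)))) (w : Data C) :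
    ipD ν (T w) (T w) ≤ (6 * K₀) * ipD ν w w := by
  obtain ⟨K, hK⟩ := exists_bound w
  obtain ⟨K', hK'⟩ := exists_bound (T w)
  obtain ⟨M, hM⟩ : ∃ M, M = max K K' := ⟨_, rfl⟩
  obtain ⟨q, hq⟩ : ∃ q : ℕ → ℝ, ∀ k, mean ν (w.1 k * w.1 k) = q k := ⟨_, fun _ => rfl⟩
  have hq0 : ∀ k, 0 ≤ q k := fun k => hq k ▸ mean_mul_self_nonneg ν _
  have hqM : q (M + 2) = 0 := by rw [← hq, hK _ (by omega), mul_zero, map_zero]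
  rw [ipD_eq_sum ν _ (T w) (K := M + 1) fun k hk => Or.inr (hK' k (by omega)),
    ipD_eq_sum ν w w (K := M + 1) fun k hk => Or.inl (hK k (by omega))]
  have e1 := h0 w
  have e2 := Finset.sum_le_sum fun k (_ : k ∈ Finset.range (M + 1)) => h1 w k
  simp only [hq] at e1 e2 ⊢
  rw [← Finset.mul_sum, Finset.sum_add_distrib, Finset.sum_add_distrib] at e2
  obtain ⟨s, hs⟩ : ∃ s, s = ∑ k ∈ Finset.range (M + 1), q (k + 1) := ⟨_, rfl⟩
  have f1 : ∑ k ∈ Finset.range (M + 1), q k ≤ q 0 + s := by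
    have h := Finset.sum_range_succ' q (M + 1)
    have h' := Finset.sum_range_succ q (M + 1)
    have := hq0 (M + 1)
    linarith
  have f2 : ∑ k ∈ Finset.range (M + 1), q (k + 2) + q 1 = s := by
    have h := Finset.sum_range_succ' (fun k => q (k + 1)) (M + 1)
    have h' := Finset.sum_range_succ (fun k => q (k + 1)) (M + 1)
    simp only [add_assoc, Nat.reduceAdd, zero_add] at h h' hs
    rw [hqM] at h'
    linarith
  have f3 : 0 ≤ ∑ k ∈ Finset.range (M + 1), q (k + 2) := Finset.sum_nonneg fun k _ => hq0 _
  rw [← hs] at e2 ⊢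
  have f4 : K₀ * (∑ k ∈ Finset.range (M + 1), q k + s + ∑ k ∈ Finset.range (M + 1), q (k + 2))
      ≤ K₀ * (q 0 + 3 * s) :=
    mul_le_mul_of_nonneg_left (by linarith [hq0 1]) hK₀
  have f5 : K₀ * (q 0 + q 1) ≤ K₀ * (q 0 + s) := mul_le_mul_of_nonneg_left (by linarith) hK₀
  have f6 := mul_nonneg hK₀ (hq0 0)
  have f7 : 0 ≤ K₀ * s := mul_nonneg hK₀ (by linarith [hq0 1])
  linarith

lemma mean_sub_mul_self_le (φ ψ : LocalAlg C) :
    mean ν ((φ - ψ) * (φ - ψ)) ≤ 2 * mean ν (φ * φ) + 2 * mean ν (ψ * ψ) := by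
  have h := mean_mul_self_nonneg ν (φ + ψ)
  simp only [add_mul, mul_add, sub_mul, mul_sub, map_add, map_sub] at h ⊢
  linarith

lemma mean_smul_mul_self (r : ℝ) (φ : LocalAlg C) :
    mean ν ((r • φ) * (r • φ)) = r ^ 2 * mean ν (φ * φ) := by
  rw [smul_mul_smul_comm, map_smul, smul_eq_mul, sq]

lemma mean_tr_mul_self (x : ℤ) (φ : LocalAlg C) :
    mean ν (tr x φ * tr x φ) = mean ν (φ * φ) := by rw [← map_mul, mean_tr]

lemma mean_bondL_mul_self_le (hC : 0 < C) (x : ℤ) (φ : LocalAlg C) :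
    mean ν ((bondL C x * φ) * (bondL C x * φ)) ≤ C ^ 2 * mean ν (φ * φ) := by
  rw [← smul_eq_mul (C ^ 2), ← map_smul]
  refine mean_mono ν fun m => ?_
  have h1 := bond_le hC m x
  have h2 := bond_nonneg m x
  change ((bondL C x : Disorder C → ℝ) m * (φ : Disorder C → ℝ) m)
    * ((bondL C x : Disorder C → ℝ) m * (φ : Disorder C → ℝ) m)
      ≤ C ^ 2 * ((φ : Disorder C → ℝ) m * (φ : Disorder C → ℝ) m)
  rw [bondL_apply hC, mul_mul_mul_comm, sq]
  exact mul_le_mul_of_nonneg_right (mul_le_mul h1 h1 h2 hC.le) (mul_self_nonneg _)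

lemma symD_bound (lam gam : ℝ) (w : Data C) :
    ipD ν (symD lam gam w) (symD lam gam w)
      ≤ (6 * (32 * gam ^ 2 + 1000 * lam ^ 2)) * ipD ν w w := by
  refine ipD_bound_of_local ν _ (by positivity) (fun w => ?_) (fun w k => ?_) w
  · change mean ν ((lam • w.1 0) * (lam • w.1 0)) ≤ _
    rw [mean_smul_mul_self]
    have h0 := mean_mul_self_nonneg ν (w.1 0)
    have h1 := mean_mul_self_nonneg ν (w.1 1)
    have h2 := mul_nonneg (sq_nonneg lam) h0
    have h3 := mul_nonneg (sq_nonneg lam) h1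
    have h4 := mul_nonneg (sq_nonneg gam) h0
    have h5 := mul_nonneg (sq_nonneg gam) h1
    linarith
  · have h0 := mean_mul_self_nonneg ν (w.1 k)
    have h1 := mean_mul_self_nonneg ν (w.1 (k + 1))
    have h2 := mean_mul_self_nonneg ν (w.1 (k + 2))
    -- Here c is the exchange part, which has one form at distance one and another beyond. The
    -- constant 500 is generous: iterating (x - y)² ≤ 2x² + 2y² produces at most 256.
    have key : ∀ c : LocalAlg C, mean ν (c * c) ≤ 500 * (mean ν (w.1 k * w.1 k)
        + mean ν (w.1 (k + 1) * w.1 (k + 1)) + mean ν (w.1 (k + 2) * w.1 (k + 2))) →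
        mean ν (((4 * gam) • w.1 (k + 1) + lam • c) * ((4 * gam) • w.1 (k + 1) + lam • c))
        ≤ (32 * gam ^ 2 + 1000 * lam ^ 2) * (mean ν (w.1 k * w.1 k)
        + mean ν (w.1 (k + 1) * w.1 (k + 1)) + mean ν (w.1 (k + 2) * w.1 (k + 2))) := by
      intro c hc
      have e := mean_add_mul_self_le ν ((4 * gam) • w.1 (k + 1)) (lam • c)
      rw [mean_smul_mul_self, mean_smul_mul_self] at e
      have e1 := mul_le_mul_of_nonneg_left hc (sq_nonneg lam)
      have e2 := mul_nonneg (sq_nonneg gam) h0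
      have e3 := mul_nonneg (sq_nonneg gam) h2
      linarith
    rcases k with _ | k
    · refine key ((2 : ℝ) • w.1 1 - w.1 2 - tr (-1) (w.1 2)) ?_
      have e1 := mean_sub_mul_self_le ν ((2 : ℝ) • w.1 1 - w.1 2) (tr (-1) (w.1 2))
      have e2 := mean_sub_mul_self_le ν ((2 : ℝ) • w.1 1) (w.1 2)
      rw [mean_tr_mul_self] at e1
      rw [mean_smul_mul_self] at e2
      simp only [zero_add] at h0 h1 h2 ⊢
      linarith
    · refine key ((4 : ℝ) • w.1 (k + 2) - w.1 (k + 1) - tr 1 (w.1 (k + 1))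
        - w.1 (k + 3) - tr (-1) (w.1 (k + 3))) ?_
      have e1 := mean_sub_mul_self_le ν ((4 : ℝ) • w.1 (k + 2) - w.1 (k + 1) - tr 1 (w.1 (k + 1))
        - w.1 (k + 3)) (tr (-1) (w.1 (k + 3)))
      have e2 := mean_sub_mul_self_le ν ((4 : ℝ) • w.1 (k + 2) - w.1 (k + 1)
        - tr 1 (w.1 (k + 1))) (w.1 (k + 3))
      have e3 := mean_sub_mul_self_le ν ((4 : ℝ) • w.1 (k + 2) - w.1 (k + 1)) (tr 1 (w.1 (k + 1)))
      have e4 := mean_sub_mul_self_le ν ((4 : ℝ) • w.1 (k + 2)) (w.1 (k + 1))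
      rw [mean_tr_mul_self] at e1 e3
      rw [mean_smul_mul_self] at e4
      simp only [add_assoc, Nat.reduceAdd] at h0 h1 h2 ⊢
      linarith

lemma antiD_bound (hC : 0 < C) (w : Data C) :
    ipD ν (antiD w) (antiD w) ≤ (6 * (100 * C ^ 2)) * ipD ν w w := by
  refine ipD_bound_of_local ν _ (by positivity) (fun w => ?_) (fun w k => ?_) w
  · change mean ν ((bondL C 0 * w.1 1) * (bondL C 0 * w.1 1)) ≤ _
    have e := mean_bondL_mul_self_le ν hC 0 (w.1 1)
    have h2 := mul_nonneg (sq_nonneg C) (mean_mul_self_nonneg ν (w.1 0))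
    have h3 := mul_nonneg (sq_nonneg C) (mean_mul_self_nonneg ν (w.1 1))
    linarith
  · have h0 := mul_nonneg (sq_nonneg C) (mean_mul_self_nonneg ν (w.1 k))
    have h1 := mul_nonneg (sq_nonneg C) (mean_mul_self_nonneg ν (w.1 (k + 1)))
    have h2 := mul_nonneg (sq_nonneg C) (mean_mul_self_nonneg ν (w.1 (k + 2)))
    rcases k with _ | k
    · change mean ν ((tr (-1) (bondL C 0 * w.1 2) - bondL C 1 * w.1 2
        - (2 : ℝ) • (bondL C 0 * w.1 0)) * (tr (-1) (bondL C 0 * w.1 2) - bondL C 1 * w.1 2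
        - (2 : ℝ) • (bondL C 0 * w.1 0))) ≤ _
      have e1 := mean_sub_mul_self_le ν (tr (-1) (bondL C 0 * w.1 2) - bondL C 1 * w.1 2)
        ((2 : ℝ) • (bondL C 0 * w.1 0))
      have e2 := mean_sub_mul_self_le ν (tr (-1) (bondL C 0 * w.1 2)) (bondL C 1 * w.1 2)
      rw [mean_smul_mul_self] at e1
      rw [mean_tr_mul_self] at e2
      have b1 := mean_bondL_mul_self_le ν hC 0 (w.1 2)
      have b2 := mean_bondL_mul_self_le ν hC 1 (w.1 2)
      have b3 := mean_bondL_mul_self_le ν hC 0 (w.1 0)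
      simp only [zero_add] at h0 h1 h2 ⊢
      linarith
    · change mean ν ((tr (-1) (bondL C 0 * w.1 (k + 3)) - bondL C 0 * tr 1 (w.1 (k + 1))
        + bondL C (k + 1) * w.1 (k + 1) - bondL C (k + 2) * w.1 (k + 3))
        * (tr (-1) (bondL C 0 * w.1 (k + 3)) - bondL C 0 * tr 1 (w.1 (k + 1))
        + bondL C (k + 1) * w.1 (k + 1) - bondL C (k + 2) * w.1 (k + 3))) ≤ _
      have e1 := mean_sub_mul_self_le ν (tr (-1) (bondL C 0 * w.1 (k + 3))
        - bondL C 0 * tr 1 (w.1 (k + 1)) + bondL C (k + 1) * w.1 (k + 1))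
        (bondL C (k + 2) * w.1 (k + 3))
      have e2 := mean_add_mul_self_le ν (tr (-1) (bondL C 0 * w.1 (k + 3))
        - bondL C 0 * tr 1 (w.1 (k + 1))) (bondL C (k + 1) * w.1 (k + 1))
      have e3 := mean_sub_mul_self_le ν (tr (-1) (bondL C 0 * w.1 (k + 3)))
        (bondL C 0 * tr 1 (w.1 (k + 1)))
      rw [mean_tr_mul_self] at e3
      have b1 := mean_bondL_mul_self_le ν hC 0 (w.1 (k + 3))
      have b2 := mean_bondL_mul_self_le ν hC 0 (tr 1 (w.1 (k + 1)))
      have b3 := mean_bondL_mul_self_le ν hC (k + 1) (w.1 (k + 1))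
      have b4 := mean_bondL_mul_self_le ν hC (k + 2) (w.1 (k + 3))
      rw [mean_tr_mul_self] at b2
      simp only [add_assoc, Nat.reduceAdd] at h0 h1 h2 e1 e2 e3 b1 b2 b3 b4 ⊢
      linarith

lemma lapD_symm (w w' : Data C) : ipD ν (lapD w) w' = ipD ν w (lapD w') := by
  obtain ⟨K, hK⟩ := exists_bound w
  obtain ⟨K', hK'⟩ := exists_bound w'
  rw [ipD_eq_sum ν _ w' (K := max K K') fun k hk => Or.inr (hK' k (by omega)),
    ipD_eq_sum ν w _ (K := max K K') fun k hk => Or.inl (hK k (by omega))]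
  change mean ν (((2 : ℝ) • w.1 0 - tr 1 (w.1 0) - tr (-1) (w.1 0)) * w'.1 0) + _
    = mean ν (w.1 0 * ((2 : ℝ) • w'.1 0 - tr 1 (w'.1 0) - tr (-1) (w'.1 0))) + _
  have h1 := mean_tr_mul ν 1 (w.1 0) (w'.1 0)
  have h2 := mean_tr_mul ν (-1) (w.1 0) (w'.1 0)
  rw [neg_neg] at h2
  simp only [sub_mul, mul_sub, map_sub, smul_mul_assoc, mul_smul_comm, map_smul, h1, h2]
  congr 1
  ring

lemma ipD_lapD_unit (w : Data C) : ipD ν (lapD w) (unitD C) = 0 := by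
  rw [ipD_unit]
  change mean ν ((2 : ℝ) • w.1 0 - tr 1 (w.1 0) - tr (-1) (w.1 0)) = 0
  simp only [map_sub, map_smul, mean_tr, smul_eq_mul]
  ring

/-- Only the zeroth coefficient has to be approximated, since `lapD` is the identity on the others.
Orthogonality to the unit sequence means precisely that this coefficient is centered. -/
lemma exists_lapD_close (w : Data C) (hw : ipD ν w (unitD C) = 0) {ε : ℝ} (hε : 0 < ε) :
    ∃ d : Data C, ipD ν (w - lapD d) (w - lapD d) < ε := by
  rw [ipD_unit] at hw
  obtain ⟨g, hg⟩ := exists_sub_laplacian_lt ν (w.1 0) hw hε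
  obtain ⟨K, hK⟩ := w.2
  refine ⟨⟨Function.update w.1 0 g, K + 1, fun k hk => ?_⟩, ?_⟩
  · rw [Function.update_of_ne (by omega), hK k (by omega)]
  · have h : ∀ k, (w - lapD ⟨Function.update w.1 0 g, K + 1, fun k hk => by
        rw [Function.update_of_ne (by omega), hK k (by omega)]⟩ : Data C).1 (k + 1) = 0 := by
      intro k
      change w.1 (k + 1) - Function.update w.1 0 g (k + 1) = 0
      rw [Function.update_of_ne (by omega), sub_self]
    rw [ipD_eq_sum ν _ _ (K := 0) fun k hk => Or.inl ?_, Finset.sum_range_zero, mul_zero, add_zero]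
    · exact hg
    · obtain ⟨k, rfl⟩ := Nat.exists_eq_succ_of_ne_zero hk.ne'
      exact h k

lemma symD_unit (lam gam : ℝ) : symD lam gam (unitD C) = lam • unitD C := by
  ext1
  funext k
  change symFun lam gam (Pi.single 0 1) k = lam • (Pi.single 0 1 : ℕ → LocalAlg C) k
  rcases k with _ | _ | k <;> simp [symFun]

/-- The inverse temperature does not occur here: D is fixed before β is chosen. -/
theorem data_variational (hC : 0 < C) {lam gam : ℝ} (hlam : 0 < lam) (hgam : 0 < gam) :
    ∃ D : ℝ, 0 < D ∧ ∃ nn n0 : Data C → ℝ,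
      (∀ x, IsLUB (Set.range fun p : Data C × ℝ => 2 * ipD ν x (lapD p.1)
        + 2 * p.2 * ipD ν x (unitD C)
        - (lam * p.2 ^ 2 + ipD ν (symD lam gam (lapD p.1)) (lapD p.1))) (nn x)) ∧
      (∀ x, IsLUB (Set.range fun d => 2 * ipD ν x (lapD d)
        - ipD ν (symD lam gam (lapD d)) (lapD d)) (n0 x)) ∧
      IsGLB (Set.range fun d => lam + ipD ν (symD lam gam (lapD d)) (lapD d)
        + n0 (-antiD (unitD C + lapD d))) D ∧
      IsGLB (Set.range fun d => nn (symD lam gam (unitD C + lapD d) + antiD (unitD C + lapD d))) D ∧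
      IsGLB (Set.range fun d => nn (lam • unitD C + (symD lam gam (lapD d) + antiD (lapD d))))
        (lam ^ 2 / D) ∧
      ∀ a : ℝ, (∃ y : ℕ → Data C, Tendsto
        (fun k => nn (symD lam gam (unitD C + lapD (y k)) - antiD (unitD C + lapD (y k))
          - a • unitD C)) atTop (𝓝 0)) ↔ a = D := by
  refine form_variational (X := Data C) (ι := Data C) (ipD ν) (ipD_symm ν) (ipD_nonneg ν)
    (symD (C := C) lam gam) (antiD (C := C)) (unitD C)
    (K := max (6 * (32 * gam ^ 2 + 1000 * lam ^ 2)) (6 * (100 * C ^ 2))) hlam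
    (lt_min hlam (by positivity : 0 < 4 * gam)) (fun x => ?_) (fun x => ?_) (symD_symm ν lam gam)
    (antiD_anti ν) (symD_coercive ν hlam) (symD_unit lam gam) ?_ (lapD (C := C)) (ipD_lapD_unit ν)
    (fun x hx ε hε => exists_lapD_close ν x hx hε)
  · exact (symD_bound ν lam gam x).trans
      (mul_le_mul_of_nonneg_right (le_max_left _ _) (ipD_nonneg ν x))
  · exact (antiD_bound ν hC x).trans
      (mul_le_mul_of_nonneg_right (le_max_right _ _) (ipD_nonneg ν x))
  · rw [ipD_unit]
    simp [unitD]

end Data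

/-! ### Fourth moments of the Gaussian field -/

section Gaussian

/-- Polynomials times exp(v t²/2) are stable under differentiation; four applications to the moment
generating function yield the fourth moment. -/
lemma deriv_mul_exp_sq (v : ℝ) {p p' : ℝ → ℝ} (hp : ∀ t, HasDerivAt p (p' t) t) :
    deriv (fun t => p t * Real.exp (v * t ^ 2 / 2))
      = fun t => (p' t + p t * (v * t)) * Real.exp (v * t ^ 2 / 2) := by
  funext t
  have h1 : HasDerivAt (fun t : ℝ => v * t ^ 2 / 2) (v * t) t := by
    refine (((hasDerivAt_pow 2 t).const_mul v).div_const 2).congr_deriv ?_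
    push_cast
    ring
  have h2 := ((hp t).mul h1.exp).deriv
  have h3 : (p * fun x => Real.exp (v * x ^ 2 / 2)) = fun t => p t * Real.exp (v * t ^ 2 / 2) := rfl
  rw [h3] at h2
  rw [h2]
  ring

lemma integral_pow_four_gaussianReal (v : NNReal) :
    ∫ x, x ^ 4 ∂(gaussianReal 0 v) = 3 * (v : ℝ) ^ 2 := by
  have h := iteratedDeriv_mgf_zero (X := id) (μ := gaussianReal 0 v)
    (by rw [integrableExpSet_id_gaussianReal]; simp) 4
  have h0 : mgf id (gaussianReal 0 v) = fun t => (1 : ℝ) * Real.exp (v * t ^ 2 / 2) := by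
    funext t
    rw [mgf_gaussianReal (μ := 0) (v := v) (by simp)]
    simp
  have h1 : ∀ t : ℝ, HasDerivAt (fun _ : ℝ => (1 : ℝ)) 0 t := fun t => hasDerivAt_const t 1
  have h2 : ∀ t : ℝ, HasDerivAt (fun t : ℝ => 0 + 1 * (v * t)) v t := fun t => by
    simpa using (hasDerivAt_id t).const_mul (v : ℝ)
  have h3 : ∀ t : ℝ, HasDerivAt (fun t : ℝ => (v : ℝ) + (0 + 1 * (v * t)) * (v * t))
      (2 * v ^ 2 * t) t := fun t => by
    have e : (fun t : ℝ => (v : ℝ) + (0 + 1 * (v * t)) * (v * t))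
        = fun t : ℝ => (v : ℝ) + (v : ℝ) ^ 2 * t ^ 2 := by funext t; ring
    rw [e]
    refine (((hasDerivAt_pow 2 t).const_mul ((v : ℝ) ^ 2)).const_add (v : ℝ)).congr_deriv ?_
    push_cast
    ring
  have h4 : ∀ t : ℝ, HasDerivAt (fun t : ℝ => 2 * (v : ℝ) ^ 2 * t
      + ((v : ℝ) + (0 + 1 * (v * t)) * (v * t)) * (v * t)) (3 * v ^ 2 + 3 * v ^ 3 * t ^ 2) t :=
    fun t => by
    have e : (fun t : ℝ => 2 * (v : ℝ) ^ 2 * t + ((v : ℝ) + (0 + 1 * (v * t)) * (v * t)) * (v * t))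
        = fun t : ℝ => 3 * (v : ℝ) ^ 2 * t + (v : ℝ) ^ 3 * t ^ 3 := by funext t; ring
    rw [e]
    refine (((hasDerivAt_id' t).const_mul (3 * (v : ℝ) ^ 2)).fun_add
      ((hasDerivAt_pow 3 t).const_mul ((v : ℝ) ^ 3))).congr_deriv ?_
    push_cast
    ring
  rw [h0, iteratedDeriv_succ', iteratedDeriv_succ', iteratedDeriv_succ', iteratedDeriv_succ',
    iteratedDeriv_zero, deriv_mul_exp_sq _ h1, deriv_mul_exp_sq _ h2, deriv_mul_exp_sq _ h3,
    deriv_mul_exp_sq _ h4] at h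
  simp only [Pi.pow_apply, id] at h
  rw [← h]
  simp

lemma integral_sq_gaussianReal (v : NNReal) : ∫ x, x ^ 2 ∂(gaussianReal 0 v) = v := by
  have h := variance_id_gaussianReal (μ := 0) (v := v)
  rw [variance_eq_integral (by fun_prop)] at h
  simpa using h

variable (β : ℝ)

instance : IsProbabilityMeasure (gibbs β) := by unfold gibbs; infer_instance

lemma map_flipAt (x : ℤ) : (gibbs β).map (flipAt x) = gibbs β := by
  have h := Measure.infinitePi_map_pi (fun _ : ℤ => gaussianReal 0 (Real.toNNReal β⁻¹))
    (f := fun i y => if i = x then -y else y) (fun i => by split_ifs <;> fun_prop)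
  have h1 : (fun (ω : ℤ → ℝ) i => if i = x then -ω i else ω i) = flipAt x := by
    funext ω i
    by_cases hi : i = x
    · subst hi; simp [flipAt]
    · simp [flipAt, hi]
  rw [h1] at h
  rw [gibbs, h]
  congr 1
  funext i
  split_ifs
  · rw [gaussianReal_map_neg, neg_zero]
  · exact Measure.map_id

lemma measurable_flipAt (x : ℤ) : Measurable (flipAt x) := by
  unfold flipAt
  fun_prop

lemma integral_eval_gibbs (i : ℤ) {f : ℝ → ℝ} (hf : Measurable f) :
    ∫ ω, f (ω i) ∂(gibbs β) = ∫ y, f y ∂(gaussianReal 0 (Real.toNNReal β⁻¹)) := by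
  have h := (measurePreserving_eval_infinitePi
    (fun _ : ℤ => gaussianReal 0 (Real.toNNReal β⁻¹)) i).map_eq
  rw [← h, integral_map (measurable_pi_apply i).aemeasurable hf.aestronglyMeasurable]
  rfl

variable {β}

lemma integral_sq_gibbs (hβ : 0 < β) (i : ℤ) : ∫ ω, ω i ^ 2 ∂(gibbs β) = β⁻¹ := by
  rw [integral_eval_gibbs β i (f := fun y => y ^ 2) (by fun_prop), integral_sq_gaussianReal,
    Real.coe_toNNReal _ (inv_pos.2 hβ).le]

lemma integral_pow_four_gibbs (hβ : 0 < β) (i : ℤ) :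
    ∫ ω, ω i ^ 4 ∂(gibbs β) = 3 * β⁻¹ ^ 2 := by
  rw [integral_eval_gibbs β i (f := fun y => y ^ 4) (by fun_prop), integral_pow_four_gaussianReal,
    Real.coe_toNNReal _ (inv_pos.2 hβ).le]

lemma chi_eq (hβ : 0 < β) : chi β = 2 * β⁻¹ ^ 2 := by
  rw [chi, integral_pow_four_gibbs hβ, integral_sq_gibbs hβ]
  ring

lemma integrable_pow_four_gibbs (i : ℤ) : Integrable (fun ω : Config => ω i ^ 4) (gibbs β) := by
  have h := (memLp_id_gaussianReal (μ := 0) (v := Real.toNNReal β⁻¹) 4).integrable_norm_pow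
    (by norm_num)
  have h2 := (measurePreserving_eval_infinitePi
    (fun _ : ℤ => gaussianReal 0 (Real.toNNReal β⁻¹)) i).integrable_comp_of_integrable h
  refine h2.congr (ae_of_all _ fun ω => ?_)
  simp only [Function.comp, Function.eval, id, Real.norm_eq_abs]
  norm_num [Even.pow_abs (by decide : Even 4)]

lemma integrable_mul_four (i j k l : ℤ) :
    Integrable (fun ω : Config => ω i * ω j * (ω k * ω l)) (gibbs β) := by
  refine ((((integrable_pow_four_gibbs i).add (integrable_pow_four_gibbs j)).add
    (integrable_pow_four_gibbs k)).add (integrable_pow_four_gibbs l)).mono'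
    (by fun_prop) (ae_of_all _ fun ω => ?_)
  simp only [Pi.add_apply]
  rw [Real.norm_eq_abs, abs_le]
  constructor <;> nlinarith [sq_nonneg (ω i * ω j - ω k * ω l), sq_nonneg (ω i * ω j + ω k * ω l),
    sq_nonneg (ω i ^ 2 - ω j ^ 2), sq_nonneg (ω k ^ 2 - ω l ^ 2), sq_nonneg (ω i ^ 2),
    sq_nonneg (ω j ^ 2), sq_nonneg (ω k ^ 2), sq_nonneg (ω l ^ 2)]

/-- The combinatorial factor in the fourth moments of a Gaussian field. -/
def wick (i j k l : ℤ) : ℝ :=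
  (if i = j ∧ k = l then 1 else 0) + (if i = k ∧ j = l then 1 else 0)
    + (if i = l ∧ j = k then 1 else 0)

/-- The law is invariant under the flip at i, which changes the sign of an integrand containing ω_i
exactly once. -/
lemma integral_mul_four_of_ne {i j k l : ℤ} (hj : i ≠ j) (hk : i ≠ k) (hl : i ≠ l) :
    ∫ ω, ω i * ω j * (ω k * ω l) ∂(gibbs β) = 0 := by
  have h : ∫ ω, ω i * ω j * (ω k * ω l) ∂(gibbs β)
      = ∫ ω, -(ω i * ω j * (ω k * ω l)) ∂(gibbs β) := by
    conv_lhs => rw [← map_flipAt β i]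
    rw [integral_map (measurable_flipAt i).aemeasurable (by fun_prop)]
    refine integral_congr_ae (ae_of_all _ fun ω => ?_)
    simp [flipAt, hj.symm, hk.symm, hl.symm]
  rw [integral_neg] at h
  linarith

lemma integral_sq_mul_sq (hβ : 0 < β) {i k : ℤ} (h : i ≠ k) :
    ∫ ω, ω i * ω i * (ω k * ω k) ∂(gibbs β) = β⁻¹ ^ 2 := by
  have hind : iIndepFun (fun (i : ℤ) (ω : Config) => ω i ^ 2) (gibbs β) :=
    iIndepFun_infinitePi (P := fun _ : ℤ => gaussianReal 0 (Real.toNNReal β⁻¹))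
      (X := fun _ y => y ^ 2) (fun _ => by fun_prop)
  have h2 := (hind.indepFun h).integral_fun_mul_eq_mul_integral
    (Measurable.aestronglyMeasurable (by fun_prop)) (Measurable.aestronglyMeasurable (by fun_prop))
  rw [integral_sq_gibbs hβ, integral_sq_gibbs hβ] at h2
  rw [sq, ← h2]
  simp only [sq]

/-- Wick's formula for the fourth moments. -/
lemma integral_mul_four (hβ : 0 < β) (i j k l : ℤ) :
    ∫ ω, ω i * ω j * (ω k * ω l) ∂(gibbs β) = β⁻¹ ^ 2 * wick i j k l := by
  have key : ∀ i k l : ℤ, ∫ ω, ω i * ω i * (ω k * ω l) ∂(gibbs β) = β⁻¹ ^ 2 * wick i i k l := by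
    intro i k l
    by_cases hkl : k = l
    · subst hkl
      by_cases hik : i = k
      · subst hik
        have : ∫ ω : Config, ω i * ω i * (ω i * ω i) ∂(gibbs β) = ∫ ω, ω i ^ 4 ∂(gibbs β) :=
          integral_congr_ae (ae_of_all _ fun ω => by ring)
        rw [this, integral_pow_four_gibbs hβ]
        simp [wick]
        ring
      · rw [integral_sq_mul_sq hβ hik]
        simp [wick, hik]
    · have hz : ∀ a b : ℤ, a ≠ b → a ≠ i → ∫ ω : Config, ω i * ω i * (ω a * ω b) ∂(gibbs β) = 0 := by
        intro a b hab hai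
        rw [← integral_mul_four_of_ne (β := β) hai hai hab]
        exact integral_congr_ae (ae_of_all _ fun ω => by ring)
      have hw : wick i i k l = 0 := by
        simp only [wick, hkl, and_false, if_false]
        rw [if_neg (by rintro ⟨rfl, rfl⟩; exact hkl rfl),
          if_neg (by rintro ⟨rfl, rfl⟩; exact hkl rfl)]
        ring
      rw [hw, mul_zero]
      by_cases hki : k = i
      · have := hz l k (Ne.symm hkl) (by rintro rfl; exact hkl hki)
        rw [← this]
        exact integral_congr_ae (ae_of_all _ fun ω => by ring)
      · exact hz k l hkl hki
  by_cases hij : i = j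
  · subst hij; exact key i k l
  by_cases hik : i = k
  · subst hik
    have h1 : ∫ ω : Config, ω i * ω j * (ω i * ω l) ∂(gibbs β)
      = ∫ ω, ω i * ω i * (ω j * ω l) ∂(gibbs β) :=
      integral_congr_ae (ae_of_all _ fun ω => by ring)
    rw [h1, key]
    simp only [wick, true_and, hij, false_and, if_false, eq_comm (a := j) (b := i)]
    ring
  by_cases hil : i = l
  · subst hil
    have h1 : ∫ ω : Config, ω i * ω j * (ω k * ω i) ∂(gibbs β)
      = ∫ ω, ω i * ω i * (ω j * ω k) ∂(gibbs β) :=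
      integral_congr_ae (ae_of_all _ fun ω => by ring)
    rw [h1, key]
    simp only [wick, true_and, hij, hik, false_and, if_false]
    ring
  · rw [integral_mul_four_of_ne hij hik hil]
    simp [wick, hij, hik, hil]

end Gaussian

/-! ### Quadratic functions and their covariance -/

section Quadratic

variable {C : ℝ}

/-- The monomial `φ(m) ω_i ω_j`. -/
def mon (φ : LocalAlg C) (i j : ℤ) : Obs C :=
  fun m ω => (φ : Disorder C → ℝ) m * (ω i * ω j)

lemma mon_comm (φ : LocalAlg C) (i j : ℤ) : mon φ i j = mon φ j i := by
  funext m ω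
  simp only [mon, mul_comm (ω i)]

lemma shift_mon (x : ℤ) (φ : LocalAlg C) (i j : ℤ) :
    shift x (mon φ i j) = mon (tr x φ) (x + i) (x + j) := rfl

/-- The homogeneous quadratic functions of the configuration with local coefficients. -/
def QuadSpan (C : ℝ) : Submodule ℝ (Obs C) :=
  Submodule.span ℝ {f | ∃ φ : LocalAlg C, ∃ i j, f = mon φ i j}

lemma mon_mem (φ : LocalAlg C) (i j : ℤ) : mon φ i j ∈ QuadSpan C :=
  Submodule.subset_span ⟨φ, i, j, rfl⟩

variable (ν : Measure (Set.Icc C⁻¹ C)) [IsProbabilityMeasure ν] {β : ℝ}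

lemma integrable_mul_quadSpan {f g : Obs C} (hf : f ∈ QuadSpan C) (hg : g ∈ QuadSpan C) :
    Integrable (fun p : Disorder C × Config => f p.1 p.2 * g p.1 p.2)
      ((disorderLaw ν).prod (gibbs β)) := by
  induction hf using Submodule.span_induction with
  | mem f hf =>
    obtain ⟨φ, i, j, rfl⟩ := hf
    induction hg using Submodule.span_induction with
    | mem g hg =>
      obtain ⟨ψ, k, l, rfl⟩ := hg
      refine ((integrable_localAlg ν (φ * ψ)).mul_prod
        (integrable_mul_four (β := β) i j k l)).congr (ae_of_all _ fun p => ?_)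
      simp only [mon]
      exact mul_mul_mul_comm _ _ _ _
    | zero => simp
    | add g₁ g₂ _ _ h₁ h₂ =>
      refine (h₁.add h₂).congr (ae_of_all _ fun p => ?_)
      simp [mul_add]
    | smul r g _ h =>
      refine (h.const_mul r).congr (ae_of_all _ fun p => ?_)
      simp; ring
  | zero => simp
  | add f₁ f₂ _ _ h₁ h₂ =>
    refine (h₁.add h₂).congr (ae_of_all _ fun p => ?_)
    simp [add_mul]
  | smul r f _ h =>
    refine (h.const_mul r).congr (ae_of_all _ fun p => ?_)
    simp; ring

variable (β) in
/-- The bilinear form `E⋆_β[f g]` on quadratic functions. -/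
noncomputable def cov : QuadSpan C →ₗ[ℝ] QuadSpan C →ₗ[ℝ] ℝ :=
  LinearMap.mk₂ ℝ (fun f g => expect ν β (f.1 * g.1))
    (fun f₁ f₂ g => by
      refine Eq.trans ?_ (integral_add (integrable_mul_quadSpan ν f₁.2 g.2)
        (integrable_mul_quadSpan ν f₂.2 g.2))
      exact integral_congr_ae (ae_of_all _ fun p => by simp [add_mul]))
    (fun r f g => by
      rw [expect, expect, smul_eq_mul, ← integral_const_mul]
      exact integral_congr_ae (ae_of_all _ fun p => by simp [mul_assoc]))
    (fun f g₁ g₂ => by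
      refine Eq.trans ?_ (integral_add (integrable_mul_quadSpan ν f.2 g₁.2)
        (integrable_mul_quadSpan ν f.2 g₂.2))
      exact integral_congr_ae (ae_of_all _ fun p => by simp [mul_add]))
    (fun r f g => by
      rw [expect, expect, smul_eq_mul, ← integral_const_mul]
      exact integral_congr_ae (ae_of_all _ fun p => by simp; ring))

/-- Monomials as elements of the space of quadratic functions. -/
def monQ (i j : ℤ) : LocalAlg C →ₗ[ℝ] QuadSpan C where
  toFun φ := ⟨mon φ i j, mon_mem φ i j⟩
  map_add' φ ψ := by
    ext m ω
    change ((φ : Disorder C → ℝ) m + (ψ : Disorder C → ℝ) m) * _ = _ * _ + _ * _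
    ring
  map_smul' r φ := by
    ext m ω
    change (r * (φ : Disorder C → ℝ) m) * _ = r * (_ * _)
    ring

lemma cov_apply (f g : QuadSpan C) : cov ν β f g = expect ν β (f.1 * g.1) := rfl

lemma cov_monQ (hβ : 0 < β) (φ ψ : LocalAlg C) (i j k l : ℤ) :
    cov ν β (monQ i j φ) (monQ k l ψ) = β⁻¹ ^ 2 * (wick i j k l * mean ν (φ * ψ)) := by
  have h : cov ν β (monQ i j φ) (monQ k l ψ) = ∫ p : Disorder C × Config,
      ((φ * ψ : LocalAlg C) : Disorder C → ℝ) p.1 * (p.2 i * p.2 j * (p.2 k * p.2 l))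
      ∂((disorderLaw ν).prod (gibbs β)) := by
    refine integral_congr_ae (ae_of_all _ fun p => ?_)
    exact mul_mul_mul_comm _ _ _ _
  rw [h, integral_prod_mul (fun m => ((φ * ψ : LocalAlg C) : Disorder C → ℝ) m)
    (fun ω : Config => ω i * ω j * (ω k * ω l)), integral_mul_four hβ, mean_apply]
  ring

end Quadratic

/-! ### Coefficients of a quadratic function; generators on monomials -/

section Coefficients

variable {C : ℝ}

/-- A finite sequence with a single nonzero coefficient. -/
def singleD (k : ℕ) : LocalAlg C →ₗ[ℝ] Data C where
  toFun φ := ⟨Pi.single k φ, k + 1, fun j hj => Pi.single_eq_of_ne (by omega) _⟩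
  map_add' φ ψ := Subtype.ext (by
    funext j
    by_cases h : j = k
    · subst h; simp
    · simp [Pi.single_eq_of_ne h])
  map_smul' r φ := Subtype.ext (by
    funext j
    by_cases h : j = k
    · subst h; simp
    · simp [Pi.single_eq_of_ne h])

lemma singleD_apply (k j : ℕ) (φ : LocalAlg C) :
    (singleD k φ).1 j = if j = k then φ else 0 := by
  simp [singleD, Pi.single_apply]

/-- The function `φ(m) (ω_{i+1}² - ω_i²)`. -/
def sqDiff (φ : LocalAlg C) (i : ℤ) : Obs C := mon φ (i + 1) (i + 1) - mon φ i i

/-- `HasData f d` means that the formal sum of the translates of the quadratic function `f` has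
the coefficients `d`. -/
inductive HasData : Obs C → Data C → Prop
  | zero : HasData 0 0
  | add {f g : Obs C} {d d' : Data C} : HasData f d → HasData g d' → HasData (f + g) (d + d')
  -- A sum over all translates does not see where a term sits, so each term is moved by -i to start
  -- at the origin, which turns φ into `tr (-i) φ`. A relation is enough: every functional below is
  -- computed from any admissible sequence, and uniqueness of the sequence is never needed.
  | sqDiff (φ : LocalAlg C) (i : ℤ) : HasData (sqDiff φ i) (singleD 0 (tr (-i) φ))
  | mon (φ : LocalAlg C) (i : ℤ) (k : ℕ) :
      HasData (mon φ i (i + (k + 1))) (singleD (k + 1) (tr (-i) φ))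

lemma HasData.congr {f f' : Obs C} {d d' : Data C} (h : HasData f d) (hf : f' = f) (hd : d' = d) :
    HasData f' d' := hf ▸ hd ▸ h

lemma mon_smul (r : ℝ) (φ : LocalAlg C) (i j : ℤ) : mon (r • φ) i j = r • mon φ i j := by
  funext m ω
  change (r * (φ : Disorder C → ℝ) m) * _ = r * (_ * _)
  ring

lemma mon_neg (φ : LocalAlg C) (i j : ℤ) : mon (-φ) i j = -mon φ i j := by
  rw [← neg_one_smul ℝ, mon_smul, neg_one_smul]

lemma HasData.smul {f : Obs C} {d : Data C} (h : HasData f d) (r : ℝ) :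
    HasData (r • f) (r • d) := by
  induction h with
  | zero => simpa using HasData.zero
  | add _ _ h₁ h₂ => simpa only [smul_add] using h₁.add h₂
  | sqDiff φ i =>
    refine (HasData.sqDiff (r • φ) i).congr ?_ (by simp)
    simp only [DisorderedChain.sqDiff, mon_smul, smul_sub]
  | mon φ i k => exact (HasData.mon (r • φ) i k).congr (mon_smul _ _ _ _).symm (by simp)

lemma HasData.neg {f : Obs C} {d : Data C} (h : HasData f d) : HasData (-f) (-d) :=
  (h.smul (-1)).congr (by simp) (by simp)

lemma HasData.sub {f g : Obs C} {d d' : Data C} (hf : HasData f d) (hg : HasData g d') :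
    HasData (f - g) (d - d') :=
  (hf.add hg.neg).congr (sub_eq_add_neg _ _) (sub_eq_add_neg _ _)

lemma HasData.mem_quadSpan {f : Obs C} {d : Data C} (h : HasData f d) : f ∈ QuadSpan C := by
  induction h with
  | zero => exact Submodule.zero_mem _
  | add _ _ h₁ h₂ => exact Submodule.add_mem _ h₁ h₂
  | sqDiff φ i => exact Submodule.sub_mem _ (mon_mem _ _ _) (mon_mem _ _ _)
  | mon φ i k => exact mon_mem _ _ _

/-- Smooth functions of finitely many values of the configuration. -/
def IsCylinder (f : Obs C) : Prop :=
  (∃ S : Finset ℤ, ∀ m, DependsOn (f m) (S : Set ℤ)) ∧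
    ∀ m ω x, DifferentiableAt ℝ (fun t : ℝ => f m (Function.update ω x t)) (ω x)

lemma IsCylinder.add {f g : Obs C} (hf : IsCylinder f) (hg : IsCylinder g) :
    IsCylinder (f + g) := by
  classical
  obtain ⟨⟨S, hS⟩, hf⟩ := hf
  obtain ⟨⟨T, hT⟩, hg⟩ := hg
  refine ⟨⟨S ∪ T, fun m ω ω' h => ?_⟩, fun m ω x => (hf m ω x).add (hg m ω x)⟩
  rw [Pi.add_apply, Pi.add_apply, Pi.add_apply, hS m fun i hi => h i (by simp_all),
    hT m fun i hi => h i (by simp_all)]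

lemma IsCylinder.smul {f : Obs C} (hf : IsCylinder f) (r : ℝ) : IsCylinder (r • f) := by
  obtain ⟨⟨S, hS⟩, hf⟩ := hf
  refine ⟨⟨S, fun m ω ω' h => ?_⟩, fun m ω x => (hf m ω x).const_mul r⟩
  rw [Pi.smul_apply, Pi.smul_apply, Pi.smul_apply, hS m h]

lemma hasDerivAt_update (ω : Config) (x i : ℤ) (t : ℝ) :
    HasDerivAt (fun t : ℝ => Function.update ω x t i) (if i = x then 1 else 0) t := by
  by_cases h : i = x
  · subst h
    simpa using hasDerivAt_id' t
  · simpa [Function.update_of_ne h, h] using hasDerivAt_const t (ω i)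

lemma hasDerivAt_mon (φ : LocalAlg C) (i j x : ℤ) (m : Disorder C) (ω : Config) :
    HasDerivAt (fun t : ℝ => mon φ i j m (Function.update ω x t))
      ((φ : Disorder C → ℝ) m * ((if i = x then 1 else 0) * ω j + ω i * (if j = x then 1 else 0)))
      (ω x) := by
  have h := ((hasDerivAt_update ω x i (ω x)).mul (hasDerivAt_update ω x j (ω x))).const_mul
    ((φ : Disorder C → ℝ) m)
  rw [Function.update_eq_self] at h
  exact h

lemma isCylinder_mon (φ : LocalAlg C) (i j : ℤ) : IsCylinder (mon φ i j) := by
  refine ⟨⟨{i, j}, fun m ω ω' h => ?_⟩, fun m ω x => (hasDerivAt_mon φ i j x m ω).differentiableAt⟩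
  simp only [mon]
  rw [h i (by simp), h j (by simp)]

lemma isCylinder_sqDiff (φ : LocalAlg C) (i : ℤ) : IsCylinder (sqDiff φ i) := by
  have h := (isCylinder_mon φ (i + 1) (i + 1)).add ((isCylinder_mon φ i i).smul (-1))
  rwa [neg_one_smul, ← sub_eq_add_neg] at h

lemma HasData.isCylinder {f : Obs C} {d : Data C} (h : HasData f d) : IsCylinder f := by
  induction h with
  | zero => exact ⟨⟨∅, fun _ _ _ _ => rfl⟩, fun _ _ _ => differentiableAt_const _⟩
  | add _ _ h₁ h₂ => exact h₁.add h₂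
  | sqDiff φ i => exact isCylinder_sqDiff φ i
  | mon φ i k => exact isCylinder_mon _ _ _

lemma IsCylinder.finite_gradFlip {f : Obs C} (hf : IsCylinder f) (m : Disorder C) (ω : Config) :
    (Function.support fun x => gradFlip x f m ω).Finite := by
  obtain ⟨⟨S, hS⟩, -⟩ := hf
  refine S.finite_toSet.subset fun x hx => ?_
  by_contra hcon
  refine hx (sub_eq_zero.2 (hS m fun i hi => ?_))
  exact Function.update_of_ne (by rintro rfl; exact hcon hi) _ _

lemma exchAt_of_ne {x i : ℤ} (h : i ≠ x) (h' : i ≠ x + 1) (ω : Config) : exchAt x ω i = ω i := by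
  rw [exchAt, Equiv.swap_apply_of_ne_of_ne h h']

lemma IsCylinder.finite_gradExch {f : Obs C} (hf : IsCylinder f) (m : Disorder C) (ω : Config) :
    (Function.support fun x => gradExch x f m ω).Finite := by
  classical
  obtain ⟨⟨S, hS⟩, -⟩ := hf
  refine (S ∪ S.image (· - 1)).finite_toSet.subset fun x hx => ?_
  by_contra hcon
  simp only [Finset.coe_union, Finset.coe_image, Set.mem_union, Set.mem_image, not_or,
    not_exists, not_and] at hcon
  refine hx (sub_eq_zero.2 (hS m fun i hi => ?_))
  exact exchAt_of_ne (by rintro rfl; exact hcon.1 hi) (fun h => hcon.2 i hi (by omega)) ω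

lemma IsCylinder.finite_deriv {f : Obs C} (hf : IsCylinder f) (m : Disorder C) (ω : Config)
    (c : ℤ → ℝ) : (Function.support fun x : ℤ =>
      c x * deriv (fun t : ℝ => f m (Function.update ω x t)) (ω x)).Finite := by
  obtain ⟨⟨S, hS⟩, -⟩ := hf
  refine S.finite_toSet.subset fun x hx => ?_
  by_contra hcon
  refine hx ?_
  have : (fun t : ℝ => f m (Function.update ω x t)) = fun _ => f m ω := by
    funext t
    exact hS m fun i hi => Function.update_of_ne (by rintro rfl; exact hcon hi) _ _
  simp only [this, deriv_const, mul_zero]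

lemma IsCylinder.finite_gradFlip_shift {f : Obs C} (hf : IsCylinder f) (m : Disorder C)
    (ω : Config) : (Function.support fun x => gradFlip 0 (shift x f) m ω).Finite := by
  classical
  obtain ⟨⟨S, hS⟩, -⟩ := hf
  refine (S.image (fun i => -i)).finite_toSet.subset fun x hx => ?_
  by_contra hcon
  simp only [Finset.coe_image, Set.mem_image, not_exists, not_and] at hcon
  refine hx (sub_eq_zero.2 (hS _ fun i hi => ?_))
  exact Function.update_of_ne (fun h => hcon i hi (by omega)) _ _

lemma IsCylinder.finite_gradExch_shift {f : Obs C} (hf : IsCylinder f) (m : Disorder C)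
    (ω : Config) : (Function.support fun x => gradExch 0 (shift x f) m ω).Finite := by
  classical
  obtain ⟨⟨S, hS⟩, -⟩ := hf
  refine (S.image (fun i => -i) ∪ S.image (fun i => 1 - i)).finite_toSet.subset fun x hx => ?_
  by_contra hcon
  simp only [Finset.coe_union, Finset.coe_image, Set.mem_union, Set.mem_image, not_or, not_exists,
    not_and] at hcon
  refine hx (sub_eq_zero.2 (hS _ fun i hi => ?_))
  exact exchAt_of_ne (fun h => hcon.1 i hi (by omega)) (fun h => hcon.2 i hi (by omega)) ω

/-- A `finsum` is zero by convention when its support is infinite, so additivity rests on the finite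
supports provided by `IsCylinder`. -/
lemma genS_add (lam gam : ℝ) {f g : Obs C} (hf : IsCylinder f) (hg : IsCylinder g) :
    genS lam gam (f + g) = genS lam gam f + genS lam gam g := by
  funext m ω
  have h1 : ∑ᶠ x, gradFlip x (f + g) m ω = ∑ᶠ x, gradFlip x f m ω + ∑ᶠ x, gradFlip x g m ω := by
    rw [← finsum_add_distrib (hf.finite_gradFlip m ω) (hg.finite_gradFlip m ω)]
    exact finsum_congr fun x => by simp only [gradFlip, Pi.add_apply]; ring
  have h2 : ∑ᶠ x, gradExch x (f + g) m ω = ∑ᶠ x, gradExch x f m ω + ∑ᶠ x, gradExch x g m ω := by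
    rw [← finsum_add_distrib (hf.finite_gradExch m ω) (hg.finite_gradExch m ω)]
    exact finsum_congr fun x => by simp only [gradExch, Pi.add_apply]; ring
  simp only [genS, Pi.add_apply, h1, h2]
  ring

lemma genA_add {f g : Obs C} (hf : IsCylinder f) (hg : IsCylinder g) :
    genA (f + g) = genA f + genA g := by
  funext m ω
  simp only [genA, Pi.add_apply]
  rw [← finsum_add_distrib (hf.finite_deriv m ω _) (hg.finite_deriv m ω _)]
  refine finsum_congr fun x => ?_
  rw [deriv_fun_add (hf.2 m ω x) (hg.2 m ω x)]
  ring

lemma gradFlipGamma_add {f g : Obs C} (hf : IsCylinder f) (hg : IsCylinder g) :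
    gradFlipGamma (f + g) = gradFlipGamma f + gradFlipGamma g := by
  funext m ω
  simp only [gradFlipGamma, Pi.add_apply]
  rw [← finsum_add_distrib (hf.finite_gradFlip_shift m ω) (hg.finite_gradFlip_shift m ω)]
  exact finsum_congr fun x => by simp only [gradFlip, shift, Pi.add_apply]; ring

lemma gradExchGamma_add {f g : Obs C} (hf : IsCylinder f) (hg : IsCylinder g) :
    gradExchGamma (f + g) = gradExchGamma f + gradExchGamma g := by
  funext m ω
  simp only [gradExchGamma, Pi.add_apply]
  rw [← finsum_add_distrib (hf.finite_gradExch_shift m ω) (hg.finite_gradExch_shift m ω)]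
  exact finsum_congr fun x => by simp only [gradExch, shift, Pi.add_apply]; ring

lemma genA_mon (hC : 0 < C) (φ : LocalAlg C) (i j : ℤ) :
    genA (mon φ i j) = mon (bondL C i * φ) (i + 1) j - mon (bondL C (i - 1) * φ) (i - 1) j
      + mon (bondL C j * φ) i (j + 1) - mon (bondL C (j - 1) * φ) i (j - 1) := by
  funext m ω
  simp only [genA, (hasDerivAt_mon φ i j _ m ω).deriv]
  have h : ∀ x : ℤ, (ω (x + 1) * bond m x - ω (x - 1) * bond m (x - 1)) *
      ((φ : Disorder C → ℝ) m * ((if i = x then 1 else 0) * ω j + ω i * (if j = x then 1 else 0)))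
      = (if x = i then (ω (x + 1) * bond m x - ω (x - 1) * bond m (x - 1))
          * ((φ : Disorder C → ℝ) m * ω j) else 0)
        + (if x = j then (ω (x + 1) * bond m x - ω (x - 1) * bond m (x - 1))
          * ((φ : Disorder C → ℝ) m * ω i) else 0) := fun x => by
    simp only [eq_comm (a := x)]
    split_ifs <;> ring
  rw [finsum_congr h, finsum_add_distrib, finsum_eq_single _ i, finsum_eq_single _ j]
  · rw [if_pos rfl, if_pos rfl]
    change _ = ((bondL C i : Disorder C → ℝ) m * (φ : Disorder C → ℝ) m) * _
      - ((bondL C (i - 1) : Disorder C → ℝ) m * (φ : Disorder C → ℝ) m) * _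
      + ((bondL C j : Disorder C → ℝ) m * (φ : Disorder C → ℝ) m) * _
      - ((bondL C (j - 1) : Disorder C → ℝ) m * (φ : Disorder C → ℝ) m) * _
    simp only [bondL_apply hC]
    ring
  · intro x hx
    rw [if_neg hx]
  · intro x hx
    rw [if_neg hx]
  · refine (Set.finite_singleton i).subset fun x hx => ?_
    by_contra hcon
    exact hx (if_neg hcon)
  · refine (Set.finite_singleton j).subset fun x hx => ?_
    by_contra hcon
    exact hx (if_neg hcon)

lemma finsum_gradFlip_diag (φ : LocalAlg C) (i : ℤ) (m : Disorder C) (ω : Config) :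
    ∑ᶠ x, gradFlip x (mon φ i i) m ω = 0 := by
  rw [← finsum_zero (α := ℤ)]
  refine finsum_congr fun x => ?_
  by_cases h : i = x
  · subst h; simp [gradFlip, mon, flipAt]
  · simp [gradFlip, mon, flipAt, h]

lemma finsum_gradFlip_mon (φ : LocalAlg C) {i j : ℤ} (h : i ≠ j) (m : Disorder C) (ω : Config) :
    ∑ᶠ x, gradFlip x (mon φ i j) m ω = -4 * mon φ i j m ω := by
  rw [finsum_eq_sum_of_support_subset (s := {i, j}), Finset.sum_pair h]
  · simp [gradFlip, mon, flipAt, h, h.symm]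
    ring
  · intro x hx
    by_contra hcon
    simp only [Finset.coe_insert, Finset.coe_singleton, Set.mem_insert_iff, Set.mem_singleton_iff,
      not_or] at hcon
    exact hx (by simp [gradFlip, mon, flipAt, Ne.symm hcon.1, Ne.symm hcon.2])

lemma gradExch_mon (x : ℤ) (φ : LocalAlg C) (i j : ℤ) (m : Disorder C) (ω : Config) :
    gradExch x (mon φ i j) m ω = (φ : Disorder C → ℝ) m
      * (ω (Equiv.swap x (x + 1) i) * ω (Equiv.swap x (x + 1) j) - ω i * ω j) := by
  simp only [gradExch, mon, exchAt]
  ring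

lemma support_gradExch_mon (φ : LocalAlg C) (i j : ℤ) (m : Disorder C) (ω : Config)
    (s : Finset ℤ) (hs : ∀ x, i = x ∨ i = x + 1 ∨ j = x ∨ j = x + 1 → x ∈ s) :
    (Function.support fun x => gradExch x (mon φ i j) m ω) ⊆ s := by
  intro x hx
  by_contra hcon
  have h : ¬(i = x ∨ i = x + 1 ∨ j = x ∨ j = x + 1) := fun h => hcon (hs x h)
  push Not at h
  refine hx ?_
  simp only [gradExch_mon, Equiv.swap_apply_of_ne_of_ne h.1 h.2.1,
    Equiv.swap_apply_of_ne_of_ne h.2.2.1 h.2.2.2, sub_self, mul_zero]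

lemma finsum_gradExch_diag (φ : LocalAlg C) (i : ℤ) (m : Disorder C) (ω : Config) :
    ∑ᶠ x, gradExch x (mon φ i i) m ω
      = mon φ (i + 1) (i + 1) m ω + mon φ (i - 1) (i - 1) m ω - 2 * mon φ i i m ω := by
  rw [finsum_eq_sum_of_support_subset (s := {i - 1, i}), Finset.sum_pair (by omega)]
  · have h1 : Equiv.swap (i - 1) (i - 1 + 1) i = i - 1 := by
      rw [sub_add_cancel, Equiv.swap_apply_right]
    simp only [gradExch_mon, h1, Equiv.swap_apply_left, mon]
    ring
  · exact support_gradExch_mon φ i i m ω _ fun x hx => by simp; omega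

/-- The exchange of i and i + 1 leaves the product unchanged; only the two outer bonds contribute.
-/
lemma finsum_gradExch_neighbours (φ : LocalAlg C) (i : ℤ) (m : Disorder C) (ω : Config) :
    ∑ᶠ x, gradExch x (mon φ i (i + 1)) m ω
      = mon φ (i - 1) (i + 1) m ω + mon φ i (i + 2) m ω - 2 * mon φ i (i + 1) m ω := by
  rw [finsum_eq_sum_of_support_subset (s := {i - 1, i, i + 1}),
    Finset.sum_insert (by simp; omega), Finset.sum_pair (by omega)]
  · have h1 : Equiv.swap (i - 1) (i - 1 + 1) i = i - 1 := by
      rw [sub_add_cancel, Equiv.swap_apply_right]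
    have h2 : Equiv.swap (i - 1) (i - 1 + 1) (i + 1) = i + 1 :=
      Equiv.swap_apply_of_ne_of_ne (by omega) (by omega)
    have h3 : Equiv.swap (i + 1) (i + 2) i = i :=
      Equiv.swap_apply_of_ne_of_ne (by omega) (by omega)
    have h4 : i + 1 + 1 = i + 2 := by ring
    simp only [gradExch_mon, h1, h2, h3, Equiv.swap_apply_left, Equiv.swap_apply_right, mon, h4]
    ring
  · exact support_gradExch_mon φ _ _ m ω _ fun x hx => by simp; omega

lemma finsum_gradExch_far (φ : LocalAlg C) {i j : ℤ} (hij : i + 1 < j) (m : Disorder C)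
    (ω : Config) : ∑ᶠ x, gradExch x (mon φ i j) m ω
      = mon φ (i - 1) j m ω + mon φ (i + 1) j m ω + mon φ i (j - 1) m ω + mon φ i (j + 1) m ω
        - 4 * mon φ i j m ω := by
  rw [finsum_eq_sum_of_support_subset (s := {i - 1, i, j - 1, j}),
    Finset.sum_insert (by simp; omega), Finset.sum_insert (by simp; omega),
    Finset.sum_pair (by omega)]
  · have h1 : Equiv.swap (i - 1) (i - 1 + 1) i = i - 1 := by
      rw [sub_add_cancel, Equiv.swap_apply_right]
    have h2 : Equiv.swap (i - 1) (i - 1 + 1) j = j :=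
      Equiv.swap_apply_of_ne_of_ne (by omega) (by omega)
    have h3 : Equiv.swap i (i + 1) j = j :=
      Equiv.swap_apply_of_ne_of_ne (by omega) (by omega)
    have h4 : Equiv.swap (j - 1) (j - 1 + 1) i = i :=
      Equiv.swap_apply_of_ne_of_ne (by omega) (by omega)
    have h5 : Equiv.swap (j - 1) (j - 1 + 1) j = j - 1 := by
      rw [sub_add_cancel, Equiv.swap_apply_right]
    have h6 : Equiv.swap j (j + 1) i = i :=
      Equiv.swap_apply_of_ne_of_ne (by omega) (by omega)
    simp only [gradExch_mon, h1, h2, h3, h4, h5, h6, Equiv.swap_apply_left, mon]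
    ring
  · exact support_gradExch_mon φ _ _ m ω _ fun x hx => by simp; omega

end Coefficients

/-! ### The generators act on coefficients through N and A -/

section Generators

variable {C : ℝ}

lemma data_ext {d d' : Data C} (h : ∀ k, d.1 k = d'.1 k) : d = d' := Subtype.ext (funext h)

/-- The formulas for sequences with a single nonzero entry are what the inductions on `HasData`
compare with the action of the generators on monomials. -/
lemma lapD_single_zero (φ : LocalAlg C) :
    lapD (singleD 0 φ) = singleD 0 ((2 : ℝ) • φ - tr 1 φ - tr (-1) φ) := by
  refine data_ext fun k => ?_
  change lapFun (singleD 0 φ).1 k = _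
  rcases k with _ | k <;> simp [lapFun, singleD_apply]

lemma lapD_single_succ (k : ℕ) (φ : LocalAlg C) :
    lapD (singleD (k + 1) φ) = singleD (k + 1) φ := by
  refine data_ext fun j => ?_
  change lapFun (singleD (k + 1) φ).1 j = _
  rcases j with _ | j <;> simp [lapFun, singleD_apply]

lemma symD_single_zero (lam gam : ℝ) (φ : LocalAlg C) :
    symD lam gam (singleD 0 φ) = singleD 0 (lam • φ) := by
  refine data_ext fun k => ?_
  change symFun lam gam (singleD 0 φ).1 k = _
  rcases k with _ | _ | k <;> simp [symFun, singleD_apply]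

lemma symD_single_one (lam gam : ℝ) (φ : LocalAlg C) :
    symD lam gam (singleD 1 φ) = (4 * gam + 2 * lam) • singleD 1 φ
      - lam • (singleD 2 φ + singleD 2 (tr 1 φ)) := by
  refine data_ext fun k => ?_
  change symFun lam gam (singleD 1 φ).1 k = (4 * gam + 2 * lam) • (singleD 1 φ).1 k
    - lam • ((singleD 2 φ).1 k + (singleD 2 (tr 1 φ)).1 k)
  rcases k with _ | _ | _ | k <;> simp [symFun, singleD_apply] <;> module

lemma symD_single_add_two (lam gam : ℝ) (k : ℕ) (φ : LocalAlg C) :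
    symD lam gam (singleD (k + 2) φ) = (4 * gam + 4 * lam) • singleD (k + 2) φ
      - lam • (singleD (k + 3) φ + singleD (k + 3) (tr 1 φ) + singleD (k + 1) φ
        + singleD (k + 1) (tr (-1) φ)) := by
  refine data_ext fun j => ?_
  change symFun lam gam (singleD (k + 2) φ).1 j = (4 * gam + 4 * lam) • (singleD (k + 2) φ).1 j
    - lam • ((singleD (k + 3) φ).1 j + (singleD (k + 3) (tr 1 φ)).1 j + (singleD (k + 1) φ).1 j
        + (singleD (k + 1) (tr (-1) φ)).1 j)
  rcases j with _ | _ | j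
  · simp [symFun, singleD_apply]
  · rcases k with _ | k
    · simp [symFun, singleD_apply]
      module
    · simp [symFun, singleD_apply]
  · simp only [symFun, singleD_apply, LinearMap.coe_mk, AddHom.coe_mk, apply_ite (tr 1),
      apply_ite (tr (-1)), map_zero]
    split_ifs <;> first | (exfalso; omega) | module

lemma antiD_single_zero (φ : LocalAlg C) :
    antiD (singleD 0 φ) = -singleD 1 ((2 : ℝ) • (bondL C 0 * φ)) := by
  refine data_ext fun k => ?_
  change antiFun (singleD 0 φ).1 k = -(singleD 1 _).1 k
  rcases k with _ | _ | k <;> simp [antiFun, singleD_apply]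

lemma antiD_single_one (φ : LocalAlg C) :
    antiD (singleD 1 φ) = singleD 0 (bondL C 0 * φ) - singleD 2 (bondL C 0 * tr 1 φ)
      + singleD 2 (bondL C 1 * φ) := by
  refine data_ext fun k => ?_
  change antiFun (singleD 1 φ).1 k = (singleD 0 _).1 k - (singleD 2 _).1 k + (singleD 2 _).1 k
  rcases k with _ | _ | _ | k <;> simp [antiFun, singleD_apply]

lemma antiD_single_add_two (k : ℕ) (φ : LocalAlg C) :
    antiD (singleD (k + 2) φ) = singleD (k + 1) (tr (-1) (bondL C 0 * φ))
      - singleD (k + 3) (bondL C 0 * tr 1 φ) + singleD (k + 3) (bondL C (k + 2) * φ)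
      - singleD (k + 1) (bondL C (k + 1) * φ) := by
  refine data_ext fun j => ?_
  change antiFun (singleD (k + 2) φ).1 j = (singleD (k + 1) _).1 j - (singleD (k + 3) _).1 j
    + (singleD (k + 3) _).1 j - (singleD (k + 1) _).1 j
  rcases j with _ | _ | j
  · simp [antiFun, singleD_apply]
  · rcases k with _ | k
    · simp [antiFun, singleD_apply]
    · simp [antiFun, singleD_apply]
  · simp only [antiFun, singleD_apply, LinearMap.coe_mk, AddHom.coe_mk, apply_ite (tr 1), mul_ite,
      apply_ite (tr (-1)), map_zero, mul_zero]
    by_cases h1 : j + 1 = k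
    · subst h1; simp [add_assoc]
    · by_cases h2 : j = k + 1
      · subst h2; simp [add_assoc]
      · split_ifs <;> first | (exfalso; omega) | simp

lemma HasData.mon' (φ : LocalAlg C) {i j : ℤ} (k : ℕ) (h : j = i + (k + 1)) :
    HasData (DisorderedChain.mon φ i j) (singleD (k + 1) (tr (-i) φ)) := h ▸ HasData.mon φ i k

lemma genS_mon_diag (lam gam : ℝ) (φ : LocalAlg C) (i : ℤ) :
    genS lam gam (mon φ i i)
      = lam • (mon φ (i + 1) (i + 1) + mon φ (i - 1) (i - 1) - (2 : ℝ) • mon φ i i) := by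
  funext m ω
  simp only [genS, finsum_gradFlip_diag, finsum_gradExch_diag, Pi.add_apply, Pi.sub_apply,
    Pi.smul_apply, smul_eq_mul]
  ring

lemma genS_sqDiff (lam gam : ℝ) (φ : LocalAlg C) (i : ℤ) :
    genS lam gam (sqDiff φ i)
      = lam • (sqDiff φ (i + 1) + sqDiff φ (i - 1) - (2 : ℝ) • sqDiff φ i) := by
  have h := genS_add lam gam (isCylinder_mon φ (i + 1) (i + 1)) (isCylinder_mon (-φ) i i)
  have h1 : i + 1 - 1 = i := by ring
  have h2 : i - 1 + 1 = i := by ring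
  rw [genS_mon_diag, genS_mon_diag] at h
  simp only [mon_neg, h1, ← sub_eq_add_neg] at h
  simp only [sqDiff, h, h2]
  module

/-- The symmetric part of the generator on coefficients. -/
lemma HasData.genS (lam gam : ℝ) {f : Obs C} {d : Data C} (h : HasData f d) :
    HasData (genS lam gam f) (-symD lam gam (lapD d)) := by
  induction h with
  | zero =>
    refine HasData.zero.congr ?_ (by simp)
    funext m ω
    simp [DisorderedChain.genS, gradFlip, gradExch]
  | add h₁ h₂ ih₁ ih₂ =>
    refine (ih₁.add ih₂).congr (genS_add lam gam h₁.isCylinder h₂.isCylinder) ?_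
    simp only [map_add, neg_add]
  | sqDiff φ i =>
    refine ((((HasData.sqDiff φ (i + 1)).add (HasData.sqDiff φ (i - 1))).sub
      ((HasData.sqDiff φ i).smul 2)).smul lam).congr (genS_sqDiff lam gam φ i) ?_
    rw [lapD_single_zero, symD_single_zero, tr_tr, tr_tr]
    rw [show (1 : ℤ) + -i = -(i - 1) by ring, show (-1 : ℤ) + -i = -(i + 1) by ring]
    simp only [map_sub, map_smul]
    module
  | mon φ i k =>
    rw [lapD_single_succ]
    rcases k with _ | k
    · refine (((HasData.mon φ i 0).smul (-4 * gam)).add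
        (((HasData.mon' φ (i := i - 1) (j := i + 1) 1 (by push_cast; ring)).add
          (HasData.mon' φ (i := i) (j := i + 2) 1 (by push_cast; ring))).sub
          ((HasData.mon φ i 0).smul 2) |>.smul lam)).congr ?_ ?_
      · funext m ω
        have h1 : i + (((0 : ℕ) : ℤ) + 1) = i + 1 := by simp
        simp only [DisorderedChain.genS, h1, finsum_gradFlip_mon φ (show i ≠ i + 1 by omega),
          finsum_gradExch_neighbours, Pi.add_apply, Pi.sub_apply, Pi.smul_apply, smul_eq_mul]
        ring
      · rw [zero_add, symD_single_one, tr_tr, show (1 : ℤ) + -i = -(i - 1) by ring]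
        module
    · refine (((HasData.mon φ i (k + 1)).smul (-4 * gam)).add
        ((((HasData.mon' φ (i := i - 1) (j := i + ((k + 1 : ℕ) + 1)) (k + 2)
            (by push_cast; ring)).add
          (HasData.mon' φ (i := i + 1) (j := i + ((k + 1 : ℕ) + 1)) k (by push_cast; ring))).add
          (HasData.mon' φ (i := i) (j := i + ((k + 1 : ℕ) + 1) - 1) k (by push_cast; ring))).add
          (HasData.mon' φ (i := i) (j := i + ((k + 1 : ℕ) + 1) + 1) (k + 2) (by push_cast; ring))
          |>.sub ((HasData.mon φ i (k + 1)).smul 4) |>.smul lam)).congr ?_ ?_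
      · funext m ω
        simp only [DisorderedChain.genS,
          finsum_gradFlip_mon φ (show i ≠ i + (((k + 1 : ℕ) : ℤ) + 1) by omega),
          finsum_gradExch_far φ (show i + 1 < i + (((k + 1 : ℕ) : ℤ) + 1) by push_cast; omega),
          Pi.add_apply, Pi.sub_apply, Pi.smul_apply, smul_eq_mul]
        ring
      · rw [symD_single_add_two, tr_tr, tr_tr, show (1 : ℤ) + -i = -(i - 1) by ring,
          show (-1 : ℤ) + -i = -(i + 1) by ring]
        module

lemma genA_sqDiff (hC : 0 < C) (φ : LocalAlg C) (i : ℤ) :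
    genA (sqDiff φ i) = (2 : ℝ) • (mon (bondL C (i + 1) * φ) (i + 1) (i + 2)
      - (2 : ℝ) • mon (bondL C i * φ) i (i + 1) + mon (bondL C (i - 1) * φ) (i - 1) i) := by
  have h := genA_add (isCylinder_mon φ (i + 1) (i + 1)) ((isCylinder_mon φ i i).smul (-1))
  have h0 : mon φ (i + 1) (i + 1) + (-1 : ℝ) • mon φ i i = sqDiff φ i := by
    rw [neg_one_smul, ← sub_eq_add_neg, sqDiff]
  rw [← h0, h, ← mon_smul, genA_mon hC, genA_mon hC]
  have h1 : i + 1 - 1 = i := by ring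
  have h2 : i + 1 + 1 = i + 2 := by ring
  simp only [mul_smul_comm, mon_smul, h1, h2, mon_comm _ (i + 2) (i + 1), mon_comm _ (i + 1) i,
    mon_comm _ i (i - 1)]
  module

/-- The antisymmetric part of the generator on coefficients. -/
lemma HasData.genA (hC : 0 < C) {f : Obs C} {d : Data C} (h : HasData f d) :
    HasData (genA f) (antiD (lapD d)) := by
  induction h with
  | zero =>
    refine HasData.zero.congr ?_ (by simp)
    funext m ω
    simp [DisorderedChain.genA]
  | add h₁ h₂ ih₁ ih₂ =>
    refine (ih₁.add ih₂).congr (genA_add h₁.isCylinder h₂.isCylinder) ?_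
    simp only [map_add]
  | sqDiff φ i =>
    refine ((((HasData.mon' (bondL C (i + 1) * φ) (i := i + 1) (j := i + 2) 0
      (by push_cast; ring)).sub ((HasData.mon' (bondL C i * φ) (i := i) (j := i + 1) 0
      (by push_cast; ring)).smul 2)).add (HasData.mon' (bondL C (i - 1) * φ) (i := i - 1) (j := i) 0
      (by push_cast; ring))).smul 2).congr (genA_sqDiff hC φ i) ?_
    rw [lapD_single_zero, antiD_single_zero, tr_tr, tr_tr]
    simp only [map_mul, tr_bondL hC, neg_add_cancel, zero_add, mul_sub, map_sub, map_smul,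
      mul_smul_comm]
    rw [show (1 : ℤ) + -i = -(i - 1) by ring, show (-1 : ℤ) + -i = -(i + 1) by ring]
    module
  | mon φ i k =>
    rw [lapD_single_succ, genA_mon hC]
    rcases k with _ | k
    · refine ((((HasData.sqDiff (bondL C i * φ) i).sub
        (HasData.mon' (bondL C (i - 1) * φ) (i := i - 1) (j := i + 1) 1 (by push_cast; ring))).add
        (HasData.mon' (bondL C (i + 1) * φ) (i := i) (j := i + 2) 1
          (by push_cast; ring)))).congr ?_ ?_
      · have h1 : i + (((0 : ℕ) : ℤ) + 1) = i + 1 := by simp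
        have h2 : i + 1 + 1 = i + 2 := by ring
        have h3 : i + 1 - 1 = i := by ring
        rw [h1, h2, h3, DisorderedChain.sqDiff]
        abel
      · rw [zero_add, antiD_single_one, tr_tr]
        simp only [map_mul, tr_bondL hC, neg_add_cancel]
        rw [show (1 : ℤ) + -i = -(i - 1) by ring,
          show -i + (i + 1) = 1 by ring]
    · refine ((((HasData.mon' (bondL C i * φ) (i := i + 1) (j := i + ((k + 1 : ℕ) + 1)) k
        (by push_cast; ring)).sub (HasData.mon' (bondL C (i - 1) * φ) (i := i - 1)
        (j := i + ((k + 1 : ℕ) + 1)) (k + 2) (by push_cast; ring))).add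
        (HasData.mon' (bondL C (i + ((k + 1 : ℕ) + 1)) * φ) (i := i)
          (j := i + ((k + 1 : ℕ) + 1) + 1) (k + 2) (by push_cast; ring))).sub
        (HasData.mon' (bondL C (i + ((k + 1 : ℕ) + 1) - 1) * φ) (i := i)
          (j := i + ((k + 1 : ℕ) + 1) - 1) k (by push_cast; ring))).congr rfl ?_
      rw [antiD_single_add_two]
      simp only [map_mul, tr_bondL hC, tr_tr]
      rw [show (1 : ℤ) + -i = -(i - 1) by ring, show (-1 : ℤ) + -i = -(i + 1) by ring,
        show -(i - 1) + (i - 1) = 0 by ring, show -(i + 1) + i = -1 + 0 by ring,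
        show -i + (i + (((k + 1 : ℕ) : ℤ) + 1)) = k + 2 by push_cast; ring,
        show -i + (i + (((k + 1 : ℕ) : ℤ) + 1) - 1) = k + 1 by push_cast; ring]

end Generators

/-! ### The bilinear and linear forms in terms of coefficients -/

section Forms

variable {C : ℝ} (ν : Measure (Set.Icc C⁻¹ C)) [IsProbabilityMeasure ν]

lemma finsum_of_finset {f : ℤ → ℝ} {v : ℝ} (s : Finset ℤ) (hs : ∀ x, x ∉ s → f x = 0)
    (hv : ∑ x ∈ s, f x = v) : (Function.support f).Finite ∧ ∑ᶠ x, f x = v := by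
  have h : Function.support f ⊆ s := fun x hx => by
    by_contra hcon
    exact hx (hs x hcon)
  exact ⟨s.finite_toSet.subset h, (finsum_eq_sum_of_support_subset _ h).trans hv⟩

/-- Finiteness of the support is carried along with the value of the sum, because the induction step
needs it to add two `finsum`s. -/
lemma finsum_support_add {f g h : ℤ → ℝ} {v w : ℝ} (hh : ∀ x, h x = f x + g x)
    (hf : (Function.support f).Finite ∧ ∑ᶠ x, f x = v)
    (hg : (Function.support g).Finite ∧ ∑ᶠ x, g x = w) :
    (Function.support h).Finite ∧ ∑ᶠ x, h x = v + w := by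
  have hh' : h = fun x => f x + g x := funext hh
  subst hh'
  refine ⟨(hf.1.union hg.1).subset (Function.support_add f g), ?_⟩
  rw [finsum_add_distrib hf.1 hg.1, hf.2, hg.2]

lemma finsum_support_zero {f : ℤ → ℝ} (h : ∀ x, f x = 0) :
    (Function.support f).Finite ∧ ∑ᶠ x, f x = 0 :=
  finsum_of_finset ∅ (fun x _ => h x) rfl

lemma mean_mul_tr (i x : ℤ) (φ ψ : LocalAlg C) :
    mean ν (φ * tr x ψ) = mean ν (tr (-i) φ * tr (x - i) ψ) := by
  rw [← mean_tr ν (-i), map_mul, tr_tr, neg_add_eq_sub]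

lemma ipD_singleD (a b : ℕ) (φ ψ : LocalAlg C) : ipD ν (singleD a φ) (singleD b ψ)
    = if a = b then (if a = 0 then 1 else 2⁻¹) * mean ν (φ * ψ) else 0 := by
  rw [ipD_eq_sum ν (K := a) _ _ fun k hk => Or.inl (by rw [singleD_apply, if_neg (by omega)])]
  simp only [singleD_apply]
  rcases a with _ | a
  · rcases b with _ | b <;> simp
  · rw [Finset.sum_eq_single_of_mem a (by simp) fun k _ hk => by simp [hk]]
    by_cases h : a + 1 = b
    · simp [h.symm]
    · rw [if_neg h, if_neg h]
      simp

variable {β : ℝ}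

lemma expect_add_mul {f₁ f₂ g : Obs C} (h₁ : f₁ ∈ QuadSpan C) (h₂ : f₂ ∈ QuadSpan C)
    (hg : g ∈ QuadSpan C) :
    expect ν β ((f₁ + f₂) * g) = expect ν β (f₁ * g) + expect ν β (f₂ * g) :=
  (cov ν β).map_add₂ ⟨f₁, h₁⟩ ⟨f₂, h₂⟩ ⟨g, hg⟩

lemma expect_mul_add {f g₁ g₂ : Obs C} (h₁ : g₁ ∈ QuadSpan C) (h₂ : g₂ ∈ QuadSpan C)
    (hf : f ∈ QuadSpan C) :
    expect ν β (f * (g₁ + g₂)) = expect ν β (f * g₁) + expect ν β (f * g₂) :=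
  (cov ν β ⟨f, hf⟩).map_add ⟨g₁, h₁⟩ ⟨g₂, h₂⟩

lemma HasData.shift_mem {f : Obs C} {d : Data C} (h : HasData f d) (x : ℤ) :
    shift x f ∈ QuadSpan C := by
  induction h with
  | zero => exact Submodule.zero_mem _
  | add _ _ h₁ h₂ => exact Submodule.add_mem _ h₁ h₂
  | sqDiff φ i => exact Submodule.sub_mem _ (mon_mem (tr x φ) _ _) (mon_mem (tr x φ) _ _)
  | mon φ i k => exact mon_mem (tr x φ) _ _

lemma expect_mon_mon (hβ : 0 < β) (φ ψ : LocalAlg C) (i j k l : ℤ) :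
    expect ν β (mon φ i j * mon ψ k l) = β⁻¹ ^ 2 * (wick i j k l * mean ν (φ * ψ)) :=
  cov_monQ ν hβ φ ψ i j k l

lemma wick_sq_sq (i k : ℤ) : wick i i k k = 1 + 2 * if i = k then 1 else 0 := by
  by_cases h : i = k <;> simp [wick, h]; norm_num

lemma wick_sq_pair {k l : ℤ} (h : k ≠ l) (i : ℤ) : wick i i k l = 0 := by
  have h1 : ¬(i = k ∧ i = l) := fun ⟨h1, h2⟩ => h (h1.symm.trans h2)
  have h2 : ¬(i = l ∧ i = k) := fun ⟨h1, h2⟩ => h (h2.symm.trans h1)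
  simp [wick, h, h1, h2]

lemma wick_pair_sq {i j : ℤ} (h : i ≠ j) (k : ℤ) : wick i j k k = 0 := by
  have h1 : ¬(i = k ∧ j = k) := fun ⟨h1, h2⟩ => h (h1.trans h2.symm)
  simp [wick, h, h1]

/-- The disconnected parts E[ω_i²] E[ω_k²] cancel between the differences. What is left is the
kernel of the negative lattice Laplacian, the source of `lapD` in the semi-inner product. -/
lemma expect_sqDiff_sqDiff (hβ : 0 < β) (φ ψ : LocalAlg C) (i k : ℤ) :
    expect ν β (sqDiff φ i * sqDiff ψ k) = chi β * mean ν (φ * ψ)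
      * (2 * (if i = k then 1 else 0) - (if i + 1 = k then 1 else 0)
        - if i = k + 1 then 1 else 0) := by
  have h : expect ν β (sqDiff φ i * sqDiff ψ k) = cov ν β (monQ (i + 1) (i + 1) φ - monQ i i φ)
    (monQ (k + 1) (k + 1) ψ - monQ k k ψ) := rfl
  rw [h]
  simp only [map_sub, LinearMap.sub_apply, cov_monQ ν hβ, wick_sq_sq, chi_eq hβ, add_left_inj]
  ring

lemma expect_sqDiff_mon (hβ : 0 < β) (φ ψ : LocalAlg C) (i : ℤ) {k l : ℤ} (h : k ≠ l) :
    expect ν β (sqDiff φ i * mon ψ k l) = 0 := by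
  have h' : expect ν β (sqDiff φ i * mon ψ k l) = cov ν β (monQ (i + 1) (i + 1) φ - monQ i i φ)
    (monQ k l ψ) := rfl
  rw [h']
  simp only [map_sub, LinearMap.sub_apply, cov_monQ ν hβ, wick_sq_pair h]
  ring

lemma expect_mon_sqDiff (hβ : 0 < β) (φ ψ : LocalAlg C) (i : ℤ) {k l : ℤ} (h : k ≠ l) :
    expect ν β (mon ψ k l * sqDiff φ i) = 0 := by
  rw [mul_comm, expect_sqDiff_mon ν hβ φ ψ i h]

/-- The semi-inner product in terms of coefficients. -/
lemma HasData.finsum_inner1 (hβ : 0 < β) {f g : Obs C} {d d' : Data C} (hf : HasData f d)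
    (hg : HasData g d') : (Function.support fun x => expect ν β (f * shift x g)).Finite ∧
      ∑ᶠ x, expect ν β (f * shift x g) = chi β * ipD ν d (lapD d') := by
  induction hf with
  | zero =>
    rw [map_zero, LinearMap.zero_apply, mul_zero]
    exact finsum_support_zero fun x => by rw [zero_mul]; simp [expect]
  | add h₁ h₂ ih₁ ih₂ =>
    rw [map_add, LinearMap.add_apply, mul_add]
    exact finsum_support_add
      (fun x => expect_add_mul ν h₁.mem_quadSpan h₂.mem_quadSpan (hg.shift_mem x)) ih₁ ih₂
  | sqDiff φ i =>
    induction hg with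
    | zero =>
      rw [map_zero, map_zero, mul_zero]
      exact finsum_support_zero fun x => by simp [expect, shift]
    | add h₁ h₂ ih₁ ih₂ =>
      rw [map_add, map_add, mul_add]
      exact finsum_support_add (fun x => expect_mul_add ν (h₁.shift_mem x) (h₂.shift_mem x)
        (HasData.sqDiff φ i).mem_quadSpan) ih₁ ih₂
    | sqDiff ψ k =>
      have h : ∀ x, expect ν β (DisorderedChain.sqDiff φ i * shift x (DisorderedChain.sqDiff ψ k))
          = chi β * mean ν (φ * tr x ψ) * (2 * (if i = x + k then 1 else 0)
            - (if i + 1 = x + k then 1 else 0) - if i = x + k + 1 then 1 else 0) := fun x => by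
        rw [← expect_sqDiff_sqDiff ν hβ, DisorderedChain.sqDiff, DisorderedChain.sqDiff,
          DisorderedChain.sqDiff, add_assoc]
        rfl
      simp only [h]
      refine finsum_of_finset {i - k, i + 1 - k, i - 1 - k} (fun x hx => ?_) ?_
      · simp only [Finset.mem_insert, Finset.mem_singleton, not_or] at hx
        rw [if_neg (by omega), if_neg (by omega), if_neg (by omega)]
        ring
      · rw [Finset.sum_insert (by simp; omega), Finset.sum_pair (by omega), lapD_single_zero, ipD_singleD,
          mean_mul_tr ν i (i - k), mean_mul_tr ν i (i + 1 - k), mean_mul_tr ν i (i - 1 - k)]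
        simp only [mul_sub, map_sub, mul_smul_comm, map_smul, tr_tr, smul_eq_mul]
        rw [show i - k - i = -k by ring, show i + 1 - k - i = 1 + -k by ring,
          show i - 1 - k - i = -1 + -k by ring]
        simp [show ¬ i = i + 1 + 1 by omega, show ¬ i = i - 1 by omega,
          show ¬ i + 1 = i - 1 by omega]
        ring
    | mon ψ k b =>
      rw [lapD_single_succ, ipD_singleD, if_neg (by omega), mul_zero]
      exact finsum_support_zero fun x => expect_sqDiff_mon ν hβ φ (tr x ψ) i (by omega)
  | mon φ i a =>
    induction hg with
    | zero =>
      rw [map_zero, map_zero, mul_zero]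
      exact finsum_support_zero fun x => by simp [expect, shift]
    | add h₁ h₂ ih₁ ih₂ =>
      rw [map_add, map_add, mul_add]
      exact finsum_support_add (fun x => expect_mul_add ν (h₁.shift_mem x) (h₂.shift_mem x)
        (mon_mem _ _ _)) ih₁ ih₂
    | sqDiff ψ k =>
      rw [lapD_single_zero, ipD_singleD, if_neg (by omega), mul_zero]
      refine finsum_support_zero fun x => ?_
      rw [← expect_mon_sqDiff ν hβ (tr x ψ) φ (x + k) (show i ≠ i + (a + 1) by omega),
        DisorderedChain.sqDiff, DisorderedChain.sqDiff, add_assoc]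
      rfl
    | mon ψ k b =>
      have h : ∀ x, expect ν β (DisorderedChain.mon φ i (i + (a + 1))
          * shift x (DisorderedChain.mon ψ k (k + (b + 1))))
          = β⁻¹ ^ 2 * ((if x = i - k ∧ a = b then 1 else 0) * mean ν (φ * tr x ψ)) := fun x => by
        -- Both pairs are written in increasing order at positive distance, so only the
        -- order-preserving Wick pairing survives. It fixes the translation and requires equal
        -- distances.
        rw [shift_mon, expect_mon_mon ν hβ, wick, if_neg (by omega),
          if_neg (c := i = x + (k + (b + 1)) ∧ _) (by omega)]
        simp only [show (i = x + k ∧ i + ((a : ℤ) + 1) = x + (k + (b + 1))) ↔ (x = i - k ∧ a = b) by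
          omega, zero_add, add_zero]
      simp only [h]
      refine finsum_of_finset {i - k} (fun x hx => ?_) ?_
      · rw [if_neg fun h => hx (by simp [h.1])]
        ring
      · rw [Finset.sum_singleton, lapD_single_succ, ipD_singleD, mean_mul_tr ν i,
          show i - k - i = -k by ring, chi_eq hβ]
        by_cases h : a = b <;> simp [h]; ring

lemma HasData.inner1_eq (hβ : 0 < β) {f g : Obs C} {d d' : Data C} (hf : HasData f d)
    (hg : HasData g d') : inner1 ν β f g = chi β * ipD ν d (lapD d') :=
  (hf.finsum_inner1 ν hβ hg).2

lemma mon_one_self (x : ℤ) : mon (1 : LocalAlg C) x x = fun _ ω => ω x ^ 2 := by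
  funext m ω
  change 1 * (ω x * ω x) = _
  ring

/-- The linear form `≪·≫_{⋆⋆}` in terms of coefficients. -/
lemma HasData.finsum_inner2 (hβ : 0 < β) {f : Obs C} {d : Data C} (hf : HasData f d) :
    (Function.support fun x : ℤ => (x : ℝ) * expect ν β (f * DisorderedChain.mon 1 x x)).Finite ∧
      ∑ᶠ x : ℤ, (x : ℝ) * expect ν β (f * DisorderedChain.mon 1 x x)
        = chi β * ipD ν d (unitD C) := by
  induction hf with
  | zero =>
    rw [map_zero, LinearMap.zero_apply, mul_zero]
    exact finsum_support_zero fun x => by rw [zero_mul]; simp [expect]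
  | add h₁ h₂ ih₁ ih₂ =>
    rw [map_add, LinearMap.add_apply, mul_add]
    refine finsum_support_add (fun x => ?_) ih₁ ih₂
    rw [expect_add_mul ν h₁.mem_quadSpan h₂.mem_quadSpan (mon_mem _ _ _), mul_add]
  | sqDiff φ i =>
    have h : ∀ x, expect ν β (DisorderedChain.sqDiff φ i * DisorderedChain.mon 1 x x)
        = chi β * mean ν φ * ((if i + 1 = x then 1 else 0) - if i = x then 1 else 0) := fun x => by
      have h' : expect ν β (DisorderedChain.sqDiff φ i * DisorderedChain.mon 1 x x)
        = cov ν β (monQ (i + 1) (i + 1) φ - monQ i i φ) (monQ x x 1) := rfl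
      rw [h']
      simp only [map_sub, LinearMap.sub_apply, cov_monQ ν hβ, wick_sq_sq, chi_eq hβ, mul_one]
      ring
    simp only [h]
    refine finsum_of_finset {i, i + 1} (fun x hx => ?_) ?_
    · simp only [Finset.mem_insert, Finset.mem_singleton, not_or] at hx
      rw [if_neg (by omega), if_neg (by omega)]
      ring
    · rw [Finset.sum_pair (by omega), ipD_unit, singleD_apply, if_pos (rfl : 0 = 0), mean_tr]
      simp
      ring
  | mon φ i a =>
    rw [ipD_unit, singleD_apply, if_neg (by omega), map_zero, mul_zero]
    refine finsum_support_zero fun x => ?_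
    rw [expect_mon_mon ν hβ, wick_pair_sq (by omega)]
    ring

lemma HasData.inner2_eq (hβ : 0 < β) {f : Obs C} {d : Data C} (hf : HasData f d) :
    inner2 ν β f = chi β * ipD ν d (unitD C) := by
  rw [← (hf.finsum_inner2 ν hβ).2]
  refine finsum_congr fun x => ?_
  rw [mon_one_self]
  rfl

end Forms

/-! ### Variations of the formal sum under a flip and an exchange -/

section Gradients

variable {C : ℝ}

/-- The variation `φ (ω_1 - ω_0) ω_z`. -/
def bondVar (z : ℤ) : LocalAlg C →ₗ[ℝ] QuadSpan C := monQ 1 z - monQ 0 z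

/-- The function `φ (ω_1² - ω_0²)`. -/
def gradQ : LocalAlg C →ₗ[ℝ] QuadSpan C := monQ 1 1 - monQ 0 0

/-- The coefficients, on the right of the bond, of the variation of a formal sum. -/
def rightCoeff (w : Data C) (k : ℕ) : LocalAlg C := w.1 (k + 2) - tr 1 (w.1 (k + 1))

/-- The coefficients, on the left of the bond, of the variation of a formal sum. -/
def leftCoeff (w : Data C) (k : ℕ) : LocalAlg C := tr (-k - 1) (w.1 (k + 1) - w.1 (k + 2))

/-- The variation under the exchange of the sites `0` and `1` of a formal sum with coefficients
`w`, up to distance `K`. -/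
def exchQ (K : ℕ) (w : Data C) : QuadSpan C :=
  -gradQ (w.1 0) + ∑ k ∈ Finset.range K,
    (bondVar (k + 2) (rightCoeff w k) + bondVar (-k - 1) (leftCoeff w k))

/-- The variation under the flip at the origin of a formal sum with coefficients `w`. -/
def flipQ (K : ℕ) (w : Data C) : QuadSpan C :=
  -(2 : ℝ) • ∑ k ∈ Finset.range K,
    (monQ 0 (k + 1) (w.1 (k + 1)) + monQ 0 (-k - 1) (tr (-k - 1) (w.1 (k + 1))))

lemma exchQ_add (K : ℕ) (w w' : Data C) : exchQ K (w + w') = exchQ K w + exchQ K w' := by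
  have h : ∀ k, (w + w').1 k = w.1 k + w'.1 k := fun _ => rfl
  simp only [exchQ, rightCoeff, leftCoeff, h, map_add, map_sub, Finset.sum_add_distrib,
    Finset.sum_sub_distrib]
  abel

lemma flipQ_add (K : ℕ) (w w' : Data C) : flipQ K (w + w') = flipQ K w + flipQ K w' := by
  have h : ∀ k, (w + w').1 k = w.1 k + w'.1 k := fun _ => rfl
  simp only [flipQ, h, map_add, Finset.sum_add_distrib]
  module

lemma exchQ_zero (K : ℕ) : exchQ K (0 : Data C) = 0 := by
  have h : ∀ k, (0 : Data C).1 k = 0 := fun _ => rfl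
  simp [exchQ, rightCoeff, leftCoeff, h]

lemma flipQ_zero (K : ℕ) : flipQ K (0 : Data C) = 0 := by
  have h : ∀ k, (0 : Data C).1 k = 0 := fun _ => rfl
  simp [flipQ, h]

lemma exchQ_single_zero (K : ℕ) (φ : LocalAlg C) : exchQ K (singleD 0 φ) = -gradQ φ := by
  simp [exchQ, rightCoeff, leftCoeff, singleD_apply]

lemma flipQ_single_zero (K : ℕ) (φ : LocalAlg C) : flipQ K (singleD 0 φ) = 0 := by
  simp [flipQ, singleD_apply]

lemma exchQ_single_one {K : ℕ} (hK : 0 < K) (φ : LocalAlg C) :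
    exchQ K (singleD 1 φ) = -bondVar 2 (tr 1 φ) + bondVar (-1) (tr (-1) φ) := by
  simp only [exchQ, rightCoeff, leftCoeff, singleD_apply]
  rw [Finset.sum_eq_single_of_mem 0 (by simpa) fun k _ hk => by simp [hk]]
  simp

lemma exchQ_single_add_two {K n : ℕ} (hK : n + 1 < K) (φ : LocalAlg C) :
    exchQ K (singleD (n + 2) φ) = bondVar (n + 2) φ - bondVar (n + 3) (tr 1 φ)
      + bondVar (-n - 2) (tr (-n - 2) φ) - bondVar (-n - 1) (tr (-n - 1) φ) := by
  simp only [exchQ, rightCoeff, leftCoeff, singleD_apply]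
  rw [← Finset.sum_subset (s₁ := {n, n + 1})
    (fun k hk => by simp at hk; simp; omega) (fun k _ hk => by
      simp only [Finset.mem_insert, Finset.mem_singleton, not_or] at hk
      rw [if_neg (by omega), if_neg (by omega)]
      simp), Finset.sum_pair (by omega)]
  simp
  rw [show -1 + -(n : ℤ) - 1 = -n - 2 by ring, show (n : ℤ) + 1 + 2 = n + 3 by ring]
  abel

lemma flipQ_single_succ {K n : ℕ} (hK : n < K) (φ : LocalAlg C) :
    flipQ K (singleD (n + 1) φ)
      = -(2 : ℝ) • (monQ 0 (n + 1) φ + monQ 0 (-n - 1) (tr (-n - 1) φ)) := by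
  simp only [flipQ, singleD_apply]
  rw [Finset.sum_eq_single_of_mem n (by simpa) fun k _ hk => by simp [hk]]
  simp

lemma gradFlip_mon_of_ne (φ : LocalAlg C) {i j : ℤ} (hi : i ≠ 0) (hj : j ≠ 0) (m : Disorder C)
    (ω : Config) : gradFlip 0 (mon φ i j) m ω = 0 := by
  simp [gradFlip, mon, flipAt, hi, hj]

lemma gradFlip_mon_zero (φ : LocalAlg C) {j : ℤ} (hj : j ≠ 0) (m : Disorder C)
    (ω : Config) : gradFlip 0 (mon φ 0 j) m ω = -2 * mon φ 0 j m ω := by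
  simp [gradFlip, mon, flipAt, hj]
  ring

lemma gradFlipGamma_diag (φ : LocalAlg C) (i : ℤ) : gradFlipGamma (mon φ i i) = 0 := by
  funext m ω
  simp only [gradFlipGamma, shift_mon]
  rw [finsum_congr (g := fun _ => 0), finsum_zero]
  · rfl
  · intro x
    by_cases h : x + i = 0
    · simp [gradFlip, mon, flipAt, h]
    · exact gradFlip_mon_of_ne _ h h m ω

lemma gradFlipGamma_mon (φ : LocalAlg C) (i : ℤ) (n : ℕ) :
    gradFlipGamma (mon φ i (i + (n + 1))) = (flipQ (n + 1) (singleD (n + 1) (tr (-i) φ))).1 := by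
  rw [flipQ_single_succ (by omega), tr_tr]
  funext m ω
  simp only [gradFlipGamma, shift_mon]
  -- Only the two translates that bring one of the two sites to the origin are affected by the flip.
  rw [finsum_eq_sum_of_support_subset (s := {-i, -n - 1 - i}), Finset.sum_pair (by omega)]
  · change _ = -2 * (mon _ 0 _ m ω + mon _ 0 _ m ω)
    rw [show -i + i = 0 by ring, show -i + (i + ((n : ℤ) + 1)) = n + 1 by ring,
      show -(n : ℤ) - 1 - i + i = -n - 1 by ring,
      show -(n : ℤ) - 1 - i + (i + ((n : ℤ) + 1)) = 0 by ring, mon_comm _ (-n - 1) 0,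
      gradFlip_mon_zero _ (by omega), gradFlip_mon_zero _ (by omega),
      show -(n : ℤ) - 1 + -i = -n - 1 - i by ring]
    ring
  · intro x hx
    by_contra hcon
    simp only [Finset.coe_insert, Finset.coe_singleton, Set.mem_insert_iff, Set.mem_singleton_iff,
      not_or] at hcon
    exact hx (gradFlip_mon_of_ne _ (by omega) (by omega) m ω)

/-- The variation of a formal sum under the flip at the origin. -/
lemma HasData.gradFlipGamma_eq {f : Obs C} {d : Data C} (hf : HasData f d) :
    ∃ K₀, ∀ K ≥ K₀, gradFlipGamma f = (flipQ K (lapD d)).1 := by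
  induction hf with
  | zero =>
    refine ⟨0, fun K _ => ?_⟩
    rw [map_zero, flipQ_zero]
    funext m ω
    simp [gradFlipGamma, gradFlip, shift]
  | add h₁ h₂ ih₁ ih₂ =>
    obtain ⟨K₁, ih₁⟩ := ih₁
    obtain ⟨K₂, ih₂⟩ := ih₂
    refine ⟨max K₁ K₂, fun K hK => ?_⟩
    rw [map_add, flipQ_add, gradFlipGamma_add h₁.isCylinder h₂.isCylinder, ih₁ K (by omega),
      ih₂ K (by omega)]
    rfl
  | sqDiff φ i =>
    refine ⟨0, fun K _ => ?_⟩
    rw [lapD_single_zero, flipQ_single_zero]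
    have h := gradFlipGamma_add (isCylinder_mon φ (i + 1) (i + 1)) (isCylinder_mon (-φ) i i)
    rw [gradFlipGamma_diag, gradFlipGamma_diag, mon_neg, ← sub_eq_add_neg, add_zero] at h
    exact h
  | mon φ i n =>
    refine ⟨n + 1, fun K hK => ?_⟩
    rw [gradFlipGamma_mon, lapD_single_succ, flipQ_single_succ (by omega),
      flipQ_single_succ (by omega)]

lemma gradExch_mon_of_ne (φ : LocalAlg C) {i j : ℤ} (hi : i ≠ 0) (hi' : i ≠ 1) (hj : j ≠ 0)
    (hj' : j ≠ 1) (m : Disorder C) (ω : Config) : gradExch 0 (mon φ i j) m ω = 0 := by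
  rw [gradExch_mon, zero_add, Equiv.swap_apply_of_ne_of_ne hi hi', Equiv.swap_apply_of_ne_of_ne hj hj']
  ring

lemma gradExch_mon_zero (φ : LocalAlg C) {j : ℤ} (hj : j ≠ 0) (hj' : j ≠ 1) (m : Disorder C)
    (ω : Config) : gradExch 0 (mon φ 0 j) m ω = (bondVar j φ).1 m ω := by
  change _ = mon φ 1 j m ω - mon φ 0 j m ω
  rw [gradExch_mon, zero_add, Equiv.swap_apply_left, Equiv.swap_apply_of_ne_of_ne hj hj']
  simp only [mon]
  ring

lemma gradExch_mon_one (φ : LocalAlg C) {j : ℤ} (hj : j ≠ 0) (hj' : j ≠ 1) (m : Disorder C)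
    (ω : Config) : gradExch 0 (mon φ 1 j) m ω = -(bondVar j φ).1 m ω := by
  change _ = -(mon φ 1 j m ω - mon φ 0 j m ω)
  have h : Equiv.swap (0 : ℤ) (0 + 1) 1 = 0 := Equiv.swap_apply_right _ _
  rw [gradExch_mon, h, zero_add, Equiv.swap_apply_of_ne_of_ne hj hj']
  simp only [mon]
  ring

lemma gradExchGamma_diag (φ : LocalAlg C) (i : ℤ) :
    gradExchGamma (mon φ i i) = (gradQ (tr (-i) φ - tr (1 - i) φ)).1 := by
  funext m ω
  simp only [gradExchGamma, shift_mon]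
  rw [finsum_eq_sum_of_support_subset (s := {-i, 1 - i}), Finset.sum_pair (by omega), map_sub]
  · change _ = mon _ 1 1 m ω - mon _ 0 0 m ω - (mon _ 1 1 m ω - mon _ 0 0 m ω)
    have h : Equiv.swap (0 : ℤ) (0 + 1) 1 = 0 := Equiv.swap_apply_right _ _
    rw [show -i + i = 0 by ring, show 1 - i + i = 1 by ring, gradExch_mon, gradExch_mon, h,
      Equiv.swap_apply_left]
    simp only [mon, zero_add]
    ring
  · intro x hx
    by_contra hcon
    simp only [Finset.coe_insert, Finset.coe_singleton, Set.mem_insert_iff, Set.mem_singleton_iff,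
      not_or] at hcon
    exact hx (gradExch_mon_of_ne _ (by omega) (by omega) (by omega) (by omega) m ω)

lemma gradExchGamma_neighbours (φ : LocalAlg C) (i : ℤ) :
    gradExchGamma (mon φ i (i + 1))
      = (-bondVar 2 (tr 1 (tr (-i) φ)) + bondVar (-1) (tr (-1) (tr (-i) φ))).1 := by
  rw [tr_tr, tr_tr]
  funext m ω
  simp only [gradExchGamma, shift_mon]
  -- The translate by -i puts the pair on the exchanged bond itself and contributes zero.
  rw [finsum_eq_sum_of_support_subset (s := {-1 - i, -i, 1 - i}),
    Finset.sum_insert (by simp), Finset.sum_pair (by omega)]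
  · rw [show -1 - i + i = -1 by ring, show -1 - i + (i + 1) = 0 by ring, show -i + i = 0 by ring,
      show -i + (i + 1) = 1 by ring, show 1 - i + i = 1 by ring, show 1 - i + (i + 1) = 2 by ring,
      mon_comm _ (-1) 0, gradExch_mon_zero _ (by norm_num) (by norm_num),
      gradExch_mon_one _ (by norm_num) (by norm_num), gradExch_mon, Equiv.swap_apply_left]
    have h : Equiv.swap (0 : ℤ) (0 + 1) 1 = 0 := Equiv.swap_apply_right _ _
    rw [h, show 1 + -i = 1 - i by ring, show -1 + -i = -1 - i by ring]
    change _ = -(bondVar 2 (tr (1 - i) φ)).1 m ω + (bondVar (-1) (tr (-1 - i) φ)).1 m ω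
    rw [zero_add]
    ring
  · intro x hx
    by_contra hcon
    simp only [Finset.coe_insert, Finset.coe_singleton, Set.mem_insert_iff, Set.mem_singleton_iff,
      not_or] at hcon
    exact hx (gradExch_mon_of_ne _ (by omega) (by omega) (by omega) (by omega) m ω)

lemma gradExchGamma_far (φ : LocalAlg C) (i : ℤ) (n : ℕ) :
    gradExchGamma (mon φ i (i + (n + 2)))
      = (bondVar (n + 2) (tr (-i) φ) - bondVar (n + 3) (tr 1 (tr (-i) φ))
      + bondVar (-n - 2) (tr (-n - 2) (tr (-i) φ))
      - bondVar (-n - 1) (tr (-n - 1) (tr (-i) φ))).1 := by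
  rw [tr_tr, tr_tr, tr_tr]
  funext m ω
  simp only [gradExchGamma, shift_mon]
  rw [finsum_eq_sum_of_support_subset (s := {-n - 2 - i, -n - 1 - i, -i, 1 - i}),
    Finset.sum_insert (by simp; omega), Finset.sum_insert (by simp; omega),
    Finset.sum_pair (by omega)]
  · rw [show -(n : ℤ) - 2 - i + i = -n - 2 by ring,
      show -(n : ℤ) - 2 - i + (i + ((n : ℤ) + 2)) = 0 by ring,
      show -(n : ℤ) - 1 - i + i = -n - 1 by ring,
      show -(n : ℤ) - 1 - i + (i + ((n : ℤ) + 2)) = 1 by ring, show -i + i = 0 by ring,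
      show -i + (i + ((n : ℤ) + 2)) = n + 2 by ring, show 1 - i + i = 1 by ring,
      show 1 - i + (i + ((n : ℤ) + 2)) = n + 3 by ring,
      mon_comm _ (-n - 2) 0, mon_comm _ (-n - 1) 1, gradExch_mon_zero _ (by omega) (by omega),
      gradExch_mon_one _ (by omega) (by omega), gradExch_mon_zero _ (by omega) (by omega),
      gradExch_mon_one _ (by omega) (by omega), show 1 + -i = 1 - i by ring,
      show -(n : ℤ) - 2 + -i = -n - 2 - i by ring, show -(n : ℤ) - 1 + -i = -n - 1 - i by ring]
    change _ = (bondVar _ _).1 m ω - (bondVar _ _).1 m ω + (bondVar _ _).1 m ω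
      - (bondVar _ _).1 m ω
    ring
  · intro x hx
    by_contra hcon
    simp only [Finset.coe_insert, Finset.coe_singleton, Set.mem_insert_iff, Set.mem_singleton_iff,
      not_or] at hcon
    exact hx (gradExch_mon_of_ne _ (by omega) (by omega) (by omega) (by omega) m ω)

/-- The variation of a formal sum under the exchange of the sites `0` and `1`. -/
lemma HasData.gradExchGamma_eq {f : Obs C} {d : Data C} (hf : HasData f d) :
    ∃ K₀, ∀ K ≥ K₀, gradExchGamma f = (exchQ K (lapD d)).1 := by
  induction hf with
  | zero =>
    refine ⟨0, fun K _ => ?_⟩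
    rw [map_zero, exchQ_zero]
    funext m ω
    simp [gradExchGamma, gradExch, shift]
  | add h₁ h₂ ih₁ ih₂ =>
    obtain ⟨K₁, ih₁⟩ := ih₁
    obtain ⟨K₂, ih₂⟩ := ih₂
    refine ⟨max K₁ K₂, fun K hK => ?_⟩
    rw [map_add, exchQ_add, gradExchGamma_add h₁.isCylinder h₂.isCylinder, ih₁ K (by omega),
      ih₂ K (by omega)]
    rfl
  | sqDiff φ i =>
    refine ⟨0, fun K _ => ?_⟩
    rw [lapD_single_zero, exchQ_single_zero]
    have h := gradExchGamma_add (isCylinder_mon φ (i + 1) (i + 1)) (isCylinder_mon (-φ) i i)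
    rw [gradExchGamma_diag, gradExchGamma_diag, mon_neg, ← sub_eq_add_neg] at h
    refine h.trans ?_
    rw [← Submodule.coe_add, ← map_add, ← map_neg, tr_tr, tr_tr,
      show -(i + 1) = -1 + -i by ring, show 1 - (i + 1) = -i by ring,
      show 1 - i = 1 + -i by ring]
    congr 2
    simp only [map_neg]
    module
  | mon φ i n =>
    rw [lapD_single_succ]
    rcases n with _ | n
    · refine ⟨1, fun K hK => ?_⟩
      rw [exchQ_single_one (by omega), ← gradExchGamma_neighbours]
      simp
    · refine ⟨n + 2, fun K hK => ?_⟩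
      rw [exchQ_single_add_two (by omega), ← gradExchGamma_far]
      push_cast
      rw [add_assoc]
      norm_num

end Gradients

/-! ### The Dirichlet form in terms of coefficients -/

section Energy

variable {C : ℝ} (ν : Measure (Set.Icc C⁻¹ C)) [IsProbabilityMeasure ν] {β : ℝ}

lemma cov_gradQ (hβ : 0 < β) (φ ψ : LocalAlg C) :
    cov ν β (gradQ φ) (gradQ ψ) = 2 * chi β * mean ν (φ * ψ) := by
  simp [gradQ, cov_monQ ν hβ, wick_sq_sq, chi_eq hβ]
  ring

lemma cov_gradQ_bondVar (hβ : 0 < β) {z : ℤ} (h : z ≠ 0) (h' : z ≠ 1) (φ ψ : LocalAlg C) :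
    cov ν β (gradQ φ) (bondVar z ψ) = 0 := by
  simp [gradQ, bondVar, cov_monQ ν hβ, wick_sq_pair h.symm, wick_sq_pair h'.symm]

lemma cov_bondVar_gradQ (hβ : 0 < β) {z : ℤ} (h : z ≠ 0) (h' : z ≠ 1) (φ ψ : LocalAlg C) :
    cov ν β (bondVar z ψ) (gradQ φ) = 0 := by
  simp [gradQ, bondVar, cov_monQ ν hβ, wick_pair_sq h.symm, wick_pair_sq h'.symm]

lemma cov_bondVar (hβ : 0 < β) {z z' : ℤ} (h : z ≠ 0) (h' : z ≠ 1) (φ ψ : LocalAlg C) :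
    cov ν β (bondVar z φ) (bondVar z' ψ) = if z = z' then chi β * mean ν (φ * ψ) else 0 := by
  simp [bondVar, cov_monQ ν hβ, wick, h.symm, h'.symm, h, h', chi_eq hβ]
  split_ifs <;> ring

lemma cov_monQ_zero (hβ : 0 < β) {z z' : ℤ} (h : z ≠ 0) (φ ψ : LocalAlg C) :
    cov ν β (monQ 0 z φ) (monQ 0 z' ψ)
      = if z = z' then 2⁻¹ * chi β * mean ν (φ * ψ) else 0 := by
  simp [cov_monQ ν hβ, wick, h.symm, h, chi_eq hβ]

/-- The square of an orthogonal sum over the two sides of the origin. -/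
lemma map_sum_two_sided {E : Type*} [AddCommGroup E] [Module ℝ E] (B : E →ₗ[ℝ] E →ₗ[ℝ] ℝ)
    (K : ℕ) (u v : ℕ → E) (p q : ℕ → ℝ) (huu : ∀ k l, B (u k) (u l) = if k = l then p k else 0)
    (hvv : ∀ k l, B (v k) (v l) = if k = l then q k else 0) (huv : ∀ k l, B (u k) (v l) = 0)
    (hvu : ∀ k l, B (v k) (u l) = 0) :
    B (∑ k ∈ Finset.range K, (u k + v k)) (∑ k ∈ Finset.range K, (u k + v k))
      = ∑ k ∈ Finset.range K, (p k + q k) := by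
  simp only [map_sum, LinearMap.sum_apply, map_add, LinearMap.add_apply, huu, hvv, huv, hvu,
    add_zero, zero_add]
  refine Finset.sum_congr rfl fun k hk => ?_
  rw [Finset.sum_ite_eq', Finset.sum_ite_eq', if_pos hk, if_pos hk]

lemma cov_flipQ (hβ : 0 < β) (K : ℕ) (w : Data C) : cov ν β (flipQ K w) (flipQ K w)
    = 4 * chi β * ∑ k ∈ Finset.range K, mean ν (w.1 (k + 1) * w.1 (k + 1)) := by
  have h := map_sum_two_sided (cov ν β) K (fun k => monQ 0 (k + 1) (w.1 (k + 1)))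
    (fun k => monQ 0 (-k - 1) (tr (-k - 1) (w.1 (k + 1))))
    (fun k => 2⁻¹ * chi β * mean ν (w.1 (k + 1) * w.1 (k + 1)))
    (fun k => 2⁻¹ * chi β * mean ν (w.1 (k + 1) * w.1 (k + 1)))
    (fun k l => by
      rw [cov_monQ_zero ν hβ (by omega)]
      by_cases hkl : k = l
      · subst hkl; simp
      · rw [if_neg (by omega), if_neg hkl])
    (fun k l => by
      rw [cov_monQ_zero ν hβ (by omega)]
      by_cases hkl : k = l
      · subst hkl; simp [mean_tr_mul_self]
      · rw [if_neg (by omega), if_neg hkl])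
    (fun k l => by rw [cov_monQ_zero ν hβ (by omega), if_neg (by omega)])
    (fun k l => by rw [cov_monQ_zero ν hβ (by omega), if_neg (by omega)])
  rw [flipQ, map_smul, map_smul, LinearMap.smul_apply, h, Finset.mul_sum, Finset.smul_sum,
    Finset.smul_sum]
  refine Finset.sum_congr rfl fun k _ => ?_
  simp only [smul_eq_mul]
  ring

/-- Terms attached to different sites outside the bond are orthogonal, and all are orthogonal to
ω_1² - ω_0². The norms come from E[(ω_1² - ω_0²)²] = 2χ and E[(ω_1 - ω_0)² ω_z²] = χ; translation
invariance removes the shifts in the left coefficients. -/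
lemma cov_exchQ (hβ : 0 < β) (K : ℕ) (w : Data C) (φ : LocalAlg C) :
    cov ν β (gradQ φ + exchQ K w) (gradQ φ + exchQ K w)
      = chi β * (2 * mean ν ((φ - w.1 0) * (φ - w.1 0)) + pairEnergy ν w.1 w.1 K) := by
  set R : QuadSpan C := ∑ k ∈ Finset.range K,
    (bondVar (k + 2) (rightCoeff w k) + bondVar (-k - 1) (leftCoeff w k)) with hR
  have h := map_sum_two_sided (cov ν β) K (fun k => bondVar (k + 2) (rightCoeff w k))
    (fun k => bondVar (-k - 1) (leftCoeff w k))
    (fun k => chi β * mean ν (rightCoeff w k * rightCoeff w k))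
    (fun k => chi β * mean ν ((w.1 (k + 2) - w.1 (k + 1)) * (w.1 (k + 2) - w.1 (k + 1))))
    (fun k l => by
      rw [cov_bondVar ν hβ (by omega) (by omega)]
      by_cases hkl : k = l
      · subst hkl; simp
      · rw [if_neg (by omega), if_neg hkl])
    (fun k l => by
      rw [cov_bondVar ν hβ (by omega) (by omega)]
      by_cases hkl : k = l
      · subst hkl
        rw [if_pos rfl, if_pos rfl, leftCoeff, mean_tr_mul_self]
        congr 2
        ring
      · rw [if_neg (by omega), if_neg hkl])
    (fun k l => by rw [cov_bondVar ν hβ (by omega) (by omega), if_neg (by omega)])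
    (fun k l => by rw [cov_bondVar ν hβ (by omega) (by omega), if_neg (by omega)])
  have h1 : ∀ ψ, cov ν β (gradQ ψ) R = 0 := fun ψ => by
    rw [hR, map_sum]
    refine Finset.sum_eq_zero fun k _ => ?_
    rw [map_add, cov_gradQ_bondVar ν hβ (by omega) (by omega),
      cov_gradQ_bondVar ν hβ (by omega) (by omega), add_zero]
  have h2 : ∀ ψ, cov ν β R (gradQ ψ) = 0 := fun ψ => by
    rw [hR, map_sum, LinearMap.sum_apply]
    refine Finset.sum_eq_zero fun k _ => ?_
    rw [map_add, LinearMap.add_apply, cov_bondVar_gradQ ν hβ (by omega) (by omega),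
      cov_bondVar_gradQ ν hβ (by omega) (by omega), add_zero]
  have h3 : gradQ φ + exchQ K w = gradQ (φ - w.1 0) + R := by
    rw [exchQ, map_sub]
    abel
  rw [h3, map_add, map_add, LinearMap.add_apply, LinearMap.add_apply, h1, h2, h, cov_gradQ ν hβ,
    pairEnergy, mul_add, Finset.mul_sum]
  simp only [rightCoeff]
  rw [add_zero, zero_add]
  congr 1
  · ring
  · refine Finset.sum_congr rfl fun k _ => ?_
    ring

lemma gradExch_energy : gradExch 0 (energy C) = (gradQ 1 : QuadSpan C).1 := by
  funext m ω
  change ω (Equiv.swap 0 (0 + 1) 0) ^ 2 - ω 0 ^ 2 = 1 * (ω 1 * ω 1) - 1 * (ω 0 * ω 0)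
  rw [Equiv.swap_apply_left, zero_add]
  ring

lemma gradFlip_energy : gradFlip 0 (energy C) = 0 := by
  funext m ω
  simp [gradFlip, energy, flipAt]

/-- The Dirichlet form in terms of coefficients. -/
lemma HasData.dirichlet0_eq (hβ : 0 < β) (lam gam a : ℝ) {f : Obs C} {d : Data C}
    (hf : HasData f d) : dirichlet0 ν lam gam β a f
      = chi β * (lam * a ^ 2 + ipD ν (symD lam gam (lapD d)) (lapD d)) := by
  obtain ⟨K₁, h₁⟩ := hf.gradExchGamma_eq
  obtain ⟨K₂, h₂⟩ := hf.gradFlipGamma_eq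
  obtain ⟨M, hM⟩ := exists_bound (lapD d)
  set N := max M (max K₁ K₂) with hN
  -- A Laplacian has mean zero, which removes the cross term between a and the squares in the
  -- exchange energy.
  have hmean : mean ν ((lapD d).1 0) = 0 := by rw [← ipD_unit, ipD_lapD_unit]
  have e1 : a • gradExch 0 (energy C) + gradExchGamma f
      = (gradQ (a • 1) + exchQ (N + 1) (lapD d)).1 := by
    rw [h₁ (N + 1) (by omega), gradExch_energy, map_smul]
    rfl
  have e2 : a • gradFlip 0 (energy C) + gradFlipGamma f = (flipQ (N + 1) (lapD d)).1 := by
    rw [h₂ (N + 1) (by omega), gradFlip_energy, smul_zero, zero_add]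
  rw [dirichlet0, e1, e2, sq, sq, ← cov_apply, ← cov_apply, cov_flipQ ν hβ, cov_exchQ ν hβ,
    ipD_symD ν lam gam _ _ (M := N) fun k hk => hM k (by omega)]
  have e3 : mean ν ((a • 1 - (lapD d).1 0) * (a • 1 - (lapD d).1 0))
      = a ^ 2 + mean ν ((lapD d).1 0 * (lapD d).1 0) := by
    simp only [sub_mul, mul_sub, smul_mul_assoc, mul_smul_comm, one_mul, mul_one, map_sub,
      map_smul, hmean, mean_one, smul_eq_mul]
    ring
  rw [e3]
  ring

end Energy

/-! ### Correspondence between the set `Quad` and coefficient sequences -/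

section Representation

variable {C : ℝ}

lemma sqDiff_mem_quad (φ : LocalAlg C) (i : ℤ) : sqDiff φ i ∈ Quad C := by
  refine ⟨{i}, fun k l => if k = i ∧ l = i then (φ : Disorder C → ℝ) else 0, fun k l => ?_,
    fun k l => ?_, fun k l h => ?_, fun k l => ?_, fun m ω => ?_⟩
  · beta_reduce
    split_ifs
    · exact φ.2.2
    · exact ⟨∅, fun _ _ _ => rfl⟩
  · beta_reduce
    split_ifs
    · exact φ.2.1
    · exact continuous_const
  · beta_reduce
    rw [if_neg]
    simp only [Finset.mem_singleton] at h
    tauto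
  · simp only [and_comm]
  · simp [sqDiff, mon]
    ring

lemma mon_mem_quad (φ : LocalAlg C) {i j : ℤ} (hij : i ≠ j) : mon φ i j ∈ Quad C := by
  -- The double sum runs over ordered pairs, so each of the two orders receives half of φ.
  refine ⟨{i, j}, fun k l => if (k = i ∧ l = j) ∨ (k = j ∧ l = i) then
    (((2⁻¹ : ℝ) • φ : LocalAlg C) : Disorder C → ℝ) else 0, fun k l => ?_,
    fun k l => ?_, fun k l h => ?_, fun k l => ?_, fun m ω => ?_⟩
  · beta_reduce
    split_ifs
    · exact ((2⁻¹ : ℝ) • φ).2.2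
    · exact ⟨∅, fun _ _ _ => rfl⟩
  · beta_reduce
    split_ifs
    · exact ((2⁻¹ : ℝ) • φ).2.1
    · exact continuous_const
  · beta_reduce
    rw [if_neg]
    simp only [Finset.mem_insert, Finset.mem_singleton] at h
    tauto
  · exact if_congr (by tauto) rfl rfl
  · have h1 : ({i, j} : Finset ℤ).erase i = {j} := by
      rw [Finset.erase_insert (by simpa)]
    have h2 : ({i, j} : Finset ℤ).erase j = {i} := by
      rw [Finset.pair_comm, Finset.erase_insert (by simpa using hij.symm)]
    rw [Finset.sum_pair hij, Finset.sum_pair hij, h1, h2]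
    simp [hij, hij.symm, mon]
    ring

lemma quad_add {f g : Obs C} (hf : f ∈ Quad C) (hg : g ∈ Quad C) : f + g ∈ Quad C := by
  have key : ∀ (Λ Λ' : Finset ℤ) (ψ : ℤ → ℤ → Disorder C → ℝ) (m : Disorder C) (ω : Config),
      (∀ i j, i ∉ Λ ∨ j ∉ Λ → ψ i j = 0) → Λ ⊆ Λ' →
      ∑ i ∈ Λ, ψ i i m * (ω (i + 1) ^ 2 - ω i ^ 2)
        + ∑ i ∈ Λ, ∑ j ∈ Λ.erase i, ψ i j m * (ω i * ω j)
      = ∑ i ∈ Λ', ψ i i m * (ω (i + 1) ^ 2 - ω i ^ 2)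
        + ∑ i ∈ Λ', ∑ j ∈ Λ'.erase i, ψ i j m * (ω i * ω j) := by
    intro Λ Λ' ψ m ω h hs
    rw [Finset.sum_subset hs fun i _ hi => by rw [h i i (Or.inl hi)]; simp]
    congr 1
    rw [← Finset.sum_subset hs (f := fun i => ∑ j ∈ Λ'.erase i, ψ i j m * (ω i * ω j))
      fun i _ hi => Finset.sum_eq_zero fun j _ => by rw [h i j (Or.inl hi)]; simp]
    refine Finset.sum_congr rfl fun i _ => Finset.sum_subset (Finset.erase_subset_erase i hs)
      fun j hj hj' => ?_
    rw [h i j (Or.inr fun hjΛ => hj' (Finset.mem_erase.2 ⟨(Finset.mem_erase.1 hj).1, hjΛ⟩))]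
    simp
  obtain ⟨Λ, ψ, h1, h2, h3, h4, h5⟩ := hf
  obtain ⟨Λ', ψ', h1', h2', h3', h4', h5'⟩ := hg
  refine ⟨Λ ∪ Λ', fun i j => ψ i j + ψ' i j, fun i j => ?_, fun i j => (h2 i j).add (h2' i j),
    fun i j h => ?_, fun i j => by beta_reduce; rw [h4, h4'], fun m ω => ?_⟩
  · obtain ⟨S, hS⟩ := h1 i j
    obtain ⟨T, hT⟩ := h1' i j
    refine ⟨S ∪ T, fun m m' h => ?_⟩
    beta_reduce
    rw [Pi.add_apply, Pi.add_apply, hS fun k hk => h k (by simp_all),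
      hT fun k hk => h k (by simp_all)]
  · simp only [Finset.mem_union, not_or] at h
    beta_reduce
    rw [h3 i j (h.imp (·.1) (·.1)), h3' i j (h.imp (·.2) (·.2)), add_zero]
  · rw [Pi.add_apply, Pi.add_apply, h5, h5', key Λ _ ψ m ω h3 Finset.subset_union_left,
      key Λ' _ ψ' m ω h3' Finset.subset_union_right]
    simp only [Pi.add_apply, add_mul, Finset.sum_add_distrib]
    ring

lemma HasData.mem_quad {f : Obs C} {d : Data C} (h : HasData f d) : f ∈ Quad C := by
  induction h with
  | zero => exact ⟨∅, 0, fun _ _ => ⟨∅, fun _ _ _ => rfl⟩, fun _ _ => continuous_const,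
      fun _ _ _ => rfl, fun _ _ => rfl, fun _ _ => by simp⟩
  | add _ _ h₁ h₂ => exact quad_add h₁ h₂
  | sqDiff φ i => exact sqDiff_mem_quad φ i
  | mon φ i k => exact mon_mem_quad φ (by omega)

lemma exists_hasData_mon (φ : LocalAlg C) {i j : ℤ} (h : i ≠ j) : ∃ d, HasData (mon φ i j) d := by
  rcases lt_or_gt_of_ne h with h | h
  · exact ⟨_, HasData.mon' φ (j - i - 1).toNat (by omega)⟩
  · rw [mon_comm]
    exact ⟨_, HasData.mon' φ (i - j - 1).toNat (by omega)⟩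

lemma exists_hasData_sum {ι : Type*} (s : Finset ι) (f : ι → Obs C)
    (h : ∀ i ∈ s, ∃ d, HasData (f i) d) : ∃ d, HasData (∑ i ∈ s, f i) d :=
  Finset.sum_induction f (fun g => ∃ d, HasData g d)
    (fun _ _ ⟨_, h⟩ ⟨_, h'⟩ => ⟨_, h.add h'⟩) ⟨_, HasData.zero⟩ h

lemma exists_hasData {f : Obs C} (hf : f ∈ Quad C) : ∃ d, HasData f d := by
  obtain ⟨Λ, ψ, h1, h2, -, -, h5⟩ := hf
  let Ψ : ℤ → ℤ → LocalAlg C := fun i j => ⟨ψ i j, h2 i j, h1 i j⟩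
  have h : f = ∑ i ∈ Λ, sqDiff (Ψ i i) i + ∑ i ∈ Λ, ∑ j ∈ Λ.erase i, mon (Ψ i j) i j := by
    funext m ω
    simp only [h5, Pi.add_apply, Finset.sum_apply]
    congr 1
    refine Finset.sum_congr rfl fun i _ => ?_
    change _ = ψ i i m * _ - ψ i i m * _
    ring
  obtain ⟨d, hd⟩ := exists_hasData_sum Λ (fun i => sqDiff (Ψ i i) i)
    fun i _ => ⟨_, HasData.sqDiff _ _⟩
  obtain ⟨d', hd'⟩ := exists_hasData_sum Λ (fun i => ∑ j ∈ Λ.erase i, mon (Ψ i j) i j)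
    fun i _ => exists_hasData_sum _ _ fun j hj =>
      exists_hasData_mon _ (Finset.mem_erase.1 hj).1.symm
  exact ⟨_, h ▸ hd.add hd'⟩

lemma exists_hasData_singleD (k : ℕ) (φ : LocalAlg C) : ∃ f, HasData f (singleD k φ) := by
  rcases k with _ | k
  · exact ⟨_, (HasData.sqDiff φ 0).congr rfl (by simp)⟩
  · exact ⟨_, (HasData.mon φ 0 k).congr rfl (by simp)⟩

/-- With `exists_hasData`, this lets extrema over `Quad` be taken over all sequences instead. -/
lemma exists_obs (d : Data C) : ∃ f, HasData f d := by
  obtain ⟨K, hK⟩ := d.2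
  have h : d = ∑ k ∈ Finset.range K, singleD k (d.1 k) := by
    refine data_ext fun j => ?_
    have h' : (∑ k ∈ Finset.range K, singleD k (d.1 k)).1 j
        = ∑ k ∈ Finset.range K, (singleD k (d.1 k)).1 j := by
      rw [Submodule.coe_sum, Finset.sum_apply]
    rw [h']
    simp only [singleD_apply]
    rw [Finset.sum_ite_eq]
    split_ifs with hj
    · rfl
    · exact hK j (by simpa using hj)
  rw [h]
  exact Finset.sum_induction _ (fun d => ∃ f, HasData f d)
    (fun _ _ ⟨_, h⟩ ⟨_, h'⟩ => ⟨_, h.add h'⟩) ⟨_, HasData.zero⟩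
    fun k _ => exists_hasData_singleD k (d.1 k)

lemma hasData_energyGrad : HasData (energyGrad C) (unitD C) := by
  refine (HasData.sqDiff 1 0).congr ?_ ?_
  · funext m ω
    change _ = 1 * (ω (0 + 1) * ω (0 + 1)) - 1 * (ω 0 * ω 0)
    rw [zero_add]
    simp only [energyGrad]
    ring
  · rw [map_one]
    rfl

/-- The antisymmetric current is -A e because A e = (0, -2/√(m_0 m_1), 0, …). -/
lemma hasData_currentA (hC : 0 < C) : HasData (currentA C) (-antiD (unitD C)) := by
  refine (HasData.mon' ((2 : ℝ) • bondL C 0) (i := 0) (j := 1) 0 (by simp)).congr ?_ ?_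
  · funext m ω
    change _ = (2 * (bondL C 0 : Disorder C → ℝ) m) * _
    rw [bondL_apply hC, currentA]
    ring
  · have h : unitD C = singleD 0 1 := rfl
    rw [h, antiD_single_zero, neg_neg, neg_zero, tr_zero, mul_one]

lemma hasData_currentS (lam : ℝ) : HasData (currentS C lam) (lam • unitD C) :=
  hasData_energyGrad.smul lam

end Representation

/-! ### From real extrema on sequences to extended real extrema on functions -/

section Conclusion

lemma iSup_coe_of_isLUB {ι : Type*} {G : ι → ℝ} {s : ℝ} (h : IsLUB (Set.range G) s) :
    ⨆ i, (G i : EReal) = (s : EReal) := by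
  refine le_antisymm (iSup_le fun i => EReal.coe_le_coe_iff.2 (h.1 ⟨i, rfl⟩)) ?_
  by_contra hcon
  obtain ⟨b, hb, hbs⟩ := EReal.lt_iff_exists_real_btwn.1 (not_le.1 hcon)
  refine (EReal.coe_lt_coe_iff.1 hbs).not_ge (h.2 ?_)
  rintro _ ⟨i, rfl⟩
  exact EReal.coe_le_coe_iff.1 ((le_iSup (fun i => (G i : EReal)) i).trans hb.le)

lemma iInf_coe_of_isGLB {ι : Type*} {G : ι → ℝ} {s : ℝ} (h : IsGLB (Set.range G) s) :
    ⨅ i, (G i : EReal) = (s : EReal) := by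
  refine le_antisymm ?_ (le_iInf fun i => EReal.coe_le_coe_iff.2 (h.1 ⟨i, rfl⟩))
  by_contra hcon
  obtain ⟨b, hbs, hb⟩ := EReal.lt_iff_exists_real_btwn.1 (not_le.1 hcon)
  refine (EReal.coe_lt_coe_iff.1 hbs).not_ge (h.2 ?_)
  rintro _ ⟨i, rfl⟩
  exact EReal.coe_le_coe_iff.1 (hb.le.trans (iInf_le (fun i => (G i : EReal)) i))

lemma isLUB_range_affine {ι : Type*} {G : ι → ℝ} {s c : ℝ} (hc : 0 < c) (r : ℝ)
    (h : IsLUB (Set.range G) s) : IsLUB (Set.range fun i => c * (r + G i)) (c * (r + s)) := by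
  have h' := ((OrderIso.addLeft r).trans (OrderIso.mulLeft₀ c hc)).isLUB_image'.2 h
  rwa [← Set.range_comp] at h'

lemma isGLB_range_affine {ι : Type*} {G : ι → ℝ} {s c : ℝ} (hc : 0 < c) (r : ℝ)
    (h : IsGLB (Set.range G) s) : IsGLB (Set.range fun i => c * (r + G i)) (c * (r + s)) := by
  have h' := ((OrderIso.addLeft r).trans (OrderIso.mulLeft₀ c hc)).isGLB_image'.2 h
  rwa [← Set.range_comp] at h'

variable {C : ℝ}

/-- Surjectivity in both directions suffices: every function has a sequence and every sequence comes
from a function, with no bijection required. -/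
lemma iSup_quad_eq {F : Obs C → EReal} {G : Data C → EReal} (h : ∀ f d, HasData f d → F f = G d) :
    ⨆ f ∈ Quad C, F f = ⨆ d, G d := by
  refine le_antisymm (iSup₂_le fun f hf => ?_) (iSup_le fun d => ?_)
  · obtain ⟨d, hd⟩ := exists_hasData hf
    rw [h f d hd]
    exact le_iSup G d
  · obtain ⟨f, hf⟩ := exists_obs d
    rw [← h f d hf]
    exact le_iSup₂ (f := fun f _ => F f) f hf.mem_quad

lemma iInf_quad_eq {F : Obs C → EReal} {G : Data C → EReal} (h : ∀ f d, HasData f d → F f = G d) :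
    ⨅ f ∈ Quad C, F f = ⨅ d, G d := by
  refine le_antisymm (le_iInf fun d => ?_) (le_iInf₂ fun f hf => ?_)
  · obtain ⟨f, hf⟩ := exists_obs d
    rw [← h f d hf]
    exact iInf₂_le (f := fun f _ => F f) f hf.mem_quad
  · obtain ⟨d, hd⟩ := exists_hasData hf
    rw [h f d hd]
    exact iInf_le G d

variable (ν : Measure (Set.Icc C⁻¹ C)) [IsProbabilityMeasure ν] {β : ℝ}

/-- The semi-norm in terms of coefficients. -/
lemma HasData.normSq_eq (hβ : 0 < β) (lam gam : ℝ) {f : Obs C} {x : Data C} (hf : HasData f x)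
    {n : ℝ} (hn : IsLUB (Set.range fun p : Data C × ℝ => 2 * ipD ν x (lapD p.1)
      + 2 * p.2 * ipD ν x (unitD C)
      - (lam * p.2 ^ 2 + ipD ν (symD lam gam (lapD p.1)) (lapD p.1))) n) :
    normSq ν lam gam β f = ((chi β * n : ℝ) : EReal) := by
  have hchi : 0 < chi β := by rw [chi_eq hβ]; positivity
  rw [← zero_add n, ← iSup_coe_of_isLUB (isLUB_range_affine hchi 0 hn), iSup_prod]
  refine iSup_quad_eq fun g d hg => iSup_congr fun a => ?_
  rw [hf.inner1_eq ν hβ hg, hf.inner2_eq ν hβ, hg.dirichlet0_eq ν hβ]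
  congr 1
  ring

lemma HasData.inner1_genS (hβ : 0 < β) (lam gam : ℝ) {f : Obs C} {d : Data C} (hf : HasData f d) :
    inner1 ν β f (-DisorderedChain.genS lam gam f)
      = chi β * ipD ν (symD lam gam (lapD d)) (lapD d) := by
  rw [hf.inner1_eq ν hβ (hf.genS lam gam).neg, neg_neg, ← lapD_symm, ipD_symm]

/-- The inner supremum in the variational formula for the diffusion coefficient. -/
lemma HasData.iSup_eq (hC : 0 < C) (hβ : 0 < β) (lam gam : ℝ) {f : Obs C} {d : Data C}
    (hf : HasData f d) {n : ℝ} (hn : IsLUB (Set.range fun e =>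
      2 * ipD ν (-antiD (unitD C + lapD d)) (lapD e)
        - ipD ν (symD lam gam (lapD e)) (lapD e)) n) :
    ⨆ g ∈ Quad C, ((inner1 ν β f (-DisorderedChain.genS lam gam f)
      + 2 * inner1 ν β (currentA C - DisorderedChain.genA f) g
      - inner1 ν β g (-DisorderedChain.genS lam gam g) : ℝ) : EReal)
      = ((chi β * (ipD ν (symD lam gam (lapD d)) (lapD d) + n) : ℝ) : EReal) := by
  have hchi : 0 < chi β := by rw [chi_eq hβ]; positivity
  have hx : HasData (currentA C - DisorderedChain.genA f) (-antiD (unitD C + lapD d)) :=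
    ((hasData_currentA hC).sub (hf.genA hC)).congr rfl (by rw [map_add, neg_add, sub_eq_add_neg])
  rw [← iSup_coe_of_isLUB (isLUB_range_affine hchi _ hn)]
  refine iSup_quad_eq fun g e hg => ?_
  rw [hf.inner1_genS ν hβ, hg.inner1_genS ν hβ, hx.inner1_eq ν hβ hg]
  congr 1
  ring

end Conclusion

end DisorderedChain

/-! ### The theorem -/

theorem mainTheorem6 (C : ℝ) (hC : 0 < C)
    (ν : Measure (Set.Icc C⁻¹ C)) [IsProbabilityMeasure ν]
    (lam gam : ℝ) (hlam : 0 < lam) (hgam : 0 < gam) :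
    ∃ D : ℝ, 0 < D ∧ ∀ β : ℝ, 0 < β →
      DisorderedChain.diffusionCoeff ν lam gam β = (D : EReal) ∧
      (∀ a : ℝ,
        (∃ f : ℕ → DisorderedChain.Obs C, (∀ k, f k ∈ DisorderedChain.Quad C) ∧
          Tendsto (fun k => DisorderedChain.normSq ν lam gam β
            (DisorderedChain.current C lam - a • DisorderedChain.energyGrad C
              - DisorderedChain.genL lam gam (f k))) atTop (𝓝 0)) ↔ a = D) ∧
      (D : EReal) = ((1 / DisorderedChain.chi β : ℝ) : EReal) *
        ⨅ f ∈ DisorderedChain.Quad C, DisorderedChain.normSq ν lam gam β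
          (DisorderedChain.currentStar C lam - DisorderedChain.genLStar lam gam f) ∧
      (D : EReal) = ((lam ^ 2 * DisorderedChain.chi β : ℝ) : EReal) /
        ⨅ f ∈ DisorderedChain.Quad C, DisorderedChain.normSq ν lam gam β
          (DisorderedChain.currentS C lam - DisorderedChain.genLStar lam gam f) := by
  open DisorderedChain in
  obtain ⟨D, hD, nn, n0, hnn, hn0, hI, hStar, hS, hUnique⟩ :=
    data_variational ν hC hlam hgam
  refine ⟨D, hD, fun β hβ => ?_⟩
  have hchi : 0 < chi β := by rw [chi_eq hβ]; positivity
  refine ⟨?_, fun a => ?_, ?_, ?_⟩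
  · rw [diffusionCoeff, iInf_quad_eq fun f d hf => hf.iSup_eq ν hC hβ lam gam (hn0 _)]
    -- The abstract infimum contains the constant lam, which stands outside the infimum in the
    -- definition of `diffusionCoeff`; it is subtracted before multiplying by χ.
    have h := iInf_coe_of_isGLB (isGLB_range_affine hchi (-lam) hI)
    simp only [add_assoc, neg_add_cancel_left] at h
    rw [h, ← EReal.coe_mul, ← EReal.coe_add]
    congr 1
    field_simp
    ring
  · have key : ∀ (f : Obs C) (d : Data C), HasData f d → normSq ν lam gam β
        (current C lam - a • energyGrad C - genL lam gam f)
        = ((chi β * nn (symD lam gam (unitD C + lapD d) - antiD (unitD C + lapD d)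
          - a • unitD C) : ℝ) : EReal) := fun f d hf => by
      refine HasData.normSq_eq ν hβ lam gam (HasData.congr ((((hasData_currentA hC).add
        (hasData_currentS lam)).sub (hasData_energyGrad.smul a)).sub
        ((hf.genS lam gam).add (hf.genA hC))) rfl ?_) (hnn _)
      -- Since N e = lam e, the current has coefficients (N - A) e and combines with -L f into (N -
      -- A)(e + W).
      rw [map_add, map_add, symD_unit]
      abel
    rw [← hUnique a]
    constructor
    · rintro ⟨f, hf, hlim⟩
      choose y hy using fun k => exists_hasData (hf k)
      refine ⟨y, ?_⟩
      simp only [key _ _ (hy _)] at hlim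
      have h := (EReal.tendsto_coe.1 hlim).const_mul (chi β)⁻¹
      simpa only [inv_mul_cancel_left₀ hchi.ne', mul_zero] using h
    · rintro ⟨y, hlim⟩
      choose f hf using fun k => exists_obs (y k)
      refine ⟨f, fun k => (hf k).mem_quad, ?_⟩
      simp only [key _ _ (hf _)]
      have h := hlim.const_mul (chi β)
      rw [mul_zero] at h
      exact EReal.tendsto_coe.2 h
  · have key : ∀ (f : Obs C) (d : Data C), HasData f d → normSq ν lam gam β
        (currentStar C lam - genLStar lam gam f)
        = ((chi β * (0 + nn (symD lam gam (unitD C + lapD d) + antiD (unitD C + lapD d))) : ℝ) :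
          EReal) := fun f d hf => by
      rw [zero_add]
      refine HasData.normSq_eq ν hβ lam gam (HasData.congr (((hasData_currentS lam).sub
        (hasData_currentA hC)).sub ((hf.genS lam gam).sub (hf.genA hC))) rfl ?_) (hnn _)
      rw [map_add, map_add, symD_unit]
      abel
    rw [iInf_quad_eq key, iInf_coe_of_isGLB (isGLB_range_affine hchi 0 hStar), ← EReal.coe_mul]
    congr 1
    field_simp
    ring
  · have key : ∀ (f : Obs C) (d : Data C), HasData f d → normSq ν lam gam β
        (currentS C lam - genLStar lam gam f)
        = ((chi β * (0 + nn (lam • unitD C + (symD lam gam (lapD d) + antiD (lapD d)))) : ℝ) :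
          EReal) := fun f d hf => by
      rw [zero_add]
      refine HasData.normSq_eq ν hβ lam gam (HasData.congr ((hasData_currentS lam).sub
        ((hf.genS lam gam).sub (hf.genA hC))) rfl ?_) (hnn _)
      abel
    rw [iInf_quad_eq key, iInf_coe_of_isGLB (isGLB_range_affine hchi 0 hS), ← EReal.coe_div]
    congr 1
    field_simp
    ring
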